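/- **Setting.** Let $0=\beta_0<\beta_1<\dots<\beta_d=|I|$, let $I=[0,|I|)$ with Lebesgue measure $\lambda$, and let $T:I\to I$ be the interval exchange transformation with symmetric permutation $\pi(i)=d-1-i$, that is, $T$ translates the intervals $I_i=[\beta_i,\beta_{i+1})$, $0\le i<d$, so that their order is reversed: $T(x)=x+|I|-\beta_i-\beta_{i+1}$ for $x\in I_i$. For $n\in\mathbb Z$ let $S_n(\phi)(x)=\sum_{0\le i<n}\phi(T^ix)$ if $n\ge 0$ and $S_n(\phi)(x)=-\sum_{n\le i<0}\phi(T^ix)$ if $n<0$. Let $f:I\to\mathbb R$ satisfy $\inf_I f>0$ and have symmetric logarithmic singularities, i.e. $f=f^p+g$ with $g:I\to\mathbb R$ of bounded variation and $$f^p(x)=\sum_{0\le i<d}\chi_{(\beta_i,\beta_{i+1})}(x)\bigl(-C_i\log(x-\beta_i)-C_i\log(\beta_{i+1}-x)\bigr),\qquad C_i\ge 0,\ \text{not all } C_i=0 .$$ The special flow $(T^f_t)_{t\in\mathbb R}$ acts on $X^f=\{(x,r):x\in I,\ 0\le r<f(x)\}$ by $T^f_t(x,r)=(T^nx,\,r+t-S_n(f)(x))$,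 where $n\in\mathbb Z$ is the unique integer with $S_n(f)(x)\le r+t<S_{n+1}(f)(x)$; it preserves the restriction $\mu^f$ of $\lambda\times\lambda_{\mathbb R}$ to $X^f$. For an interval $J=(a,b)\subset I$, the set $\mathcal C=\bigcup_{i=0}^{h-1}T^iJ$ is a Rokhlin tower by intervals with base $J$ and height $h$ if $T^iJ$, $0\le i<h$, are pairwise disjoint intervals. A good rigidity sequence is a sequence of Rokhlin towers by intervals $\mathcal C_n$ with bases $J_n=(a_n,b_n)$, $a_n<b_n$, and heights $h_n\to\infty$ such that, with $q_n=1/(b_n-a_n)$, $$\lambda(\mathcal C_n)\to|I|\qquad\text{and}\qquad |T^{h_n}x-x|\le\frac1{q_n\log q_n}\quad\text{for all } n \text{ and all } x\in\mathcal C_n .$$ **Proposition (Singularity for symmetric logarithmic flows from good rigidity).** Suppose that $T$ admits a good rigidity sequence as above and that, for some $0<c<1/2$ and for $\phi=f^p$ or $\phi=f$, for every $n$ there is a point $x_n$ with $$x_n\in[a_n+c/q_n,\ b_n-c/q_n],\qquad S_{h_n}(\phi')(x_n)=0,$$ where $\phi$ is required to be differentiable at $T^ix_n$ for $0\le i<h_n$.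 Then the special flow $(T^f_t)_{t\in\mathbb R}$ is ergodic with respect to $\mu^f$ and has purely singular spectrum: for every $G\in L^2(X^f,\mu^f)$ the spectral measure $\sigma_G$, i.e. the finite Borel measure on $\mathbb R$ with $\langle G\circ T^f_t,G\rangle=\int_{\mathbb R}e^{its}\,d\sigma_G(s)$ for all $t\in\mathbb R$, is singular with respect to Lebesgue measure. -/

import Mathlib

open MeasureTheory Filter Topology Set

/-- The points `γ 0 < γ 1 < ⋯ < γ d` cut `[γ 0, γ d)` into the `d` intervals `[γ i, γ (i+1))`. -/
theorem existsUnique_piece {d : ℕ} {γ : Fin (d + 1) → ℝ} (hγ : StrictMono γ) {x : ℝ}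
    (hx : x ∈ Ico (γ 0) (γ (Fin.last d))) :
    ∃! i : Fin d, x ∈ Ico (γ i.castSucc) (γ i.succ) := by
  have uniq : ∀ i j : Fin d, x ∈ Ico (γ i.castSucc) (γ i.succ) →
      x ∈ Ico (γ j.castSucc) (γ j.succ) → i ≤ j := by
    intro i j hi hj
    by_contra! hlt
    have : γ j.succ ≤ γ i.castSucc := hγ.monotone (by
      rw [Fin.le_def]; simp only [Fin.val_succ, Fin.val_castSucc]; exact hlt)
    linarith [hi.1, hj.2]
  have ex : ∀ k : Fin (d + 1), x < γ k → ∃ i : Fin d, x ∈ Ico (γ i.castSucc) (γ i.succ) := by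
    intro k
    induction k using Fin.induction with
    | zero => intro h; exact absurd hx.1 (not_le.mpr h)
    | succ i ih =>
      intro h
      by_cases h' : x < γ i.castSucc
      · exact ih h'
      · exact ⟨i, not_lt.mp h', h⟩
  obtain ⟨i, hi⟩ := ex _ hx.2
  exact ⟨i, hi, fun j hj => le_antisymm (uniq j i hj hi) (uniq i j hi hj)⟩

/-- Combinatorial data of an interval exchange transformation of `d` intervals: the endpoints
`0 = β 0 < β 1 < ⋯ < β d = |I|` and the permutation `π`; the `i`-th interval `[β i, β (i+1))`
is the `π i`-th one, from left to right, after the exchange. -/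
structure IET (d : ℕ) where
  β : Fin (d + 1) → ℝ
  strictMono : StrictMono β
  zero : β 0 = 0
  π : Equiv.Perm (Fin d)

namespace IET

variable {d : ℕ} (T : IET d)

/-- The length `|I|` of the exchanged interval. -/
def length : ℝ := T.β (Fin.last d)

/-- The interval `I = [0, |I|)`. -/
abbrev Base : Type := Ico (0 : ℝ) T.length

/-- Lebesgue measure `λ` on `I`. -/
noncomputable def leb : Measure T.Base := Measure.comap Subtype.val volume

/-- The length of the `i`-th exchanged interval. -/
def len (i : Fin d) : ℝ := T.β i.succ - T.β i.castSucc

/-- The endpoints of the intervals after the exchange. -/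
noncomputable def β' (k : Fin (d + 1)) : ℝ :=
  ∑ j : Fin d with (T.π j).castSucc < k, T.len j

/-- The permutation reverses the order of the intervals. -/
def IsSymmetric : Prop := ∀ i, T.π i = i.rev

theorem len_pos (i : Fin d) : 0 < T.len i :=
  sub_pos.mpr (T.strictMono i.castSucc_lt_succ)

theorem β'_zero : T.β' 0 = 0 := by
  simp [β']

theorem β'_succ (k : Fin d) : T.β' k.succ = T.β' k.castSucc + T.len (T.π.symm k) := by
  have h : (Finset.univ.filter fun j : Fin d => (T.π j).castSucc < k.succ) =
      insert (T.π.symm k) (Finset.univ.filter fun j : Fin d => (T.π j).castSucc < k.castSucc) := by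
    ext j
    simp only [Finset.mem_filter, Finset.mem_univ, true_and, Finset.mem_insert,
      Fin.castSucc_lt_succ_iff, Fin.castSucc_lt_castSucc_iff, le_iff_eq_or_lt,
      Equiv.eq_symm_apply]
  rw [β', h, Finset.sum_insert (by simp), β', add_comm]

theorem β'_strictMono : StrictMono T.β' := by
  rw [Fin.strictMono_iff_lt_succ]
  intro k
  rw [β'_succ]
  linarith [T.len_pos (T.π.symm k)]

theorem β'_last : T.β' (Fin.last d) = T.length := by
  have h : T.β' (Fin.last d) = ∑ j : Fin d, T.len j := by
    simp [β', Fin.castSucc_lt_last]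
  have h2 : ∀ k : Fin (d + 1), T.β k = ∑ j : Fin d with j.castSucc < k, T.len j := by
    intro k
    induction k using Fin.induction with
    | zero => simp [T.zero]
    | succ i ih =>
      have hs : (Finset.univ.filter fun j : Fin d => j.castSucc < i.succ) =
          insert i (Finset.univ.filter fun j : Fin d => j.castSucc < i.castSucc) := by
        ext j
        simp only [Finset.mem_filter, Finset.mem_univ, true_and, Finset.mem_insert,
          Fin.castSucc_lt_succ_iff, Fin.castSucc_lt_castSucc_iff, le_iff_eq_or_lt]
      rw [hs, Finset.sum_insert (by simp), ← ih, len]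
      ring
  rw [h, length, h2]
  simp [Fin.castSucc_lt_last]

theorem existsUnique_top (x : T.Base) :
    ∃! i : Fin d, (x : ℝ) ∈ Ico (T.β i.castSucc) (T.β i.succ) :=
  existsUnique_piece T.strictMono (by rw [T.zero]; exact x.2)

theorem existsUnique_bot (y : T.Base) :
    ∃! k : Fin d, (y : ℝ) ∈ Ico (T.β' k.castSucc) (T.β' k.succ) :=
  existsUnique_piece T.β'_strictMono (by rw [T.β'_zero, T.β'_last]; exact y.2)

/-- The index `i` of the interval `[β i, β (i+1))` that contains `x`. -/
noncomputable def topIndex (x : T.Base) : Fin d := (T.existsUnique_top x).choose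

/-- The position `k` of the interval, after the exchange, that contains `y`. -/
noncomputable def botIndex (y : T.Base) : Fin d := (T.existsUnique_bot y).choose

theorem topIndex_mem (x : T.Base) :
    (x : ℝ) ∈ Ico (T.β (T.topIndex x).castSucc) (T.β (T.topIndex x).succ) :=
  (T.existsUnique_top x).choose_spec.1

theorem botIndex_mem (y : T.Base) :
    (y : ℝ) ∈ Ico (T.β' (T.botIndex y).castSucc) (T.β' (T.botIndex y).succ) :=
  (T.existsUnique_bot y).choose_spec.1

theorem topIndex_eq {x : T.Base} {i : Fin d}
    (h : (x : ℝ) ∈ Ico (T.β i.castSucc) (T.β i.succ)) : T.topIndex x = i :=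
  (T.existsUnique_top x).unique (T.topIndex_mem x) h

theorem botIndex_eq {y : T.Base} {k : Fin d}
    (h : (y : ℝ) ∈ Ico (T.β' k.castSucc) (T.β' k.succ)) : T.botIndex y = k :=
  (T.existsUnique_bot y).unique (T.botIndex_mem y) h

theorem fwd_mem (x : T.Base) :
    (x : ℝ) - T.β (T.topIndex x).castSucc + T.β' (T.π (T.topIndex x)).castSucc ∈
      Ico (T.β' (T.π (T.topIndex x)).castSucc) (T.β' (T.π (T.topIndex x)).succ) := by
  have h := T.topIndex_mem x
  rw [β'_succ, Equiv.symm_apply_apply, len]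
  constructor <;> linarith [h.1, h.2]

theorem bwd_mem (y : T.Base) :
    (y : ℝ) - T.β' (T.botIndex y).castSucc + T.β (T.π.symm (T.botIndex y)).castSucc ∈
      Ico (T.β (T.π.symm (T.botIndex y)).castSucc) (T.β (T.π.symm (T.botIndex y)).succ) := by
  have h := T.botIndex_mem y
  rw [β'_succ, len] at h
  constructor <;> linarith [h.1, h.2]

theorem top_subset (i : Fin d) :
    Ico (T.β i.castSucc) (T.β i.succ) ⊆ Ico (0 : ℝ) T.length := by
  apply Ico_subset_Ico
  · rw [← T.zero]; exact T.strictMono.monotone (Fin.zero_le _)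
  · exact T.strictMono.monotone (Fin.le_last _)

theorem bot_subset (k : Fin d) :
    Ico (T.β' k.castSucc) (T.β' k.succ) ⊆ Ico (0 : ℝ) T.length := by
  apply Ico_subset_Ico
  · rw [← T.β'_zero]; exact T.β'_strictMono.monotone (Fin.zero_le _)
  · rw [← T.β'_last]; exact T.β'_strictMono.monotone (Fin.le_last _)

/-- The interval exchange transformation `T : I → I`, a bijection of `I`: it translates the
`i`-th interval to the `π i`-th position. -/
noncomputable def map : Equiv.Perm T.Base where
  toFun x := ⟨(x : ℝ) - T.β (T.topIndex x).castSucc + T.β' (T.π (T.topIndex x)).castSucc,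
    T.bot_subset _ (T.fwd_mem x)⟩
  invFun y := ⟨(y : ℝ) - T.β' (T.botIndex y).castSucc + T.β (T.π.symm (T.botIndex y)).castSucc,
    T.top_subset _ (T.bwd_mem y)⟩
  left_inv x := by
    have h : T.botIndex ⟨_, T.bot_subset _ (T.fwd_mem x)⟩ = T.π (T.topIndex x) :=
      T.botIndex_eq (T.fwd_mem x)
    apply Subtype.ext
    simp only [h, Equiv.symm_apply_apply]
    ring
  right_inv y := by
    have h : T.topIndex ⟨_, T.top_subset _ (T.bwd_mem y)⟩ = T.π.symm (T.botIndex y) :=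
      T.topIndex_eq (T.bwd_mem y)
    apply Subtype.ext
    simp only [h, Equiv.apply_symm_apply]
    ring

/-! ### Roof functions

Functions on `I` are given as functions `ℝ → ℝ`, of which only the values on `I` matter. -/

/-- `p` has pure symmetric logarithmic singularities at the endpoints `β i`. -/
def IsPureSymLog (p : ℝ → ℝ) : Prop :=
  ∃ C : Fin d → ℝ, (∀ i, 0 ≤ C i) ∧ (∃ i, C i ≠ 0) ∧ ∀ x ∈ Ico (0 : ℝ) T.length,
    p x = ∑ i : Fin d, (Ioo (T.β i.castSucc) (T.β i.succ)).indicator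
      (fun y => -(C i) * Real.log (y - T.β i.castSucc) - C i * Real.log (T.β i.succ - y)) x

/-- `p` is the pure symmetric logarithmic part of `f`: `f = p + g` with `g` of bounded
variation on `I`. -/
def IsLogPart (p f : ℝ → ℝ) : Prop :=
  T.IsPureSymLog p ∧ BoundedVariationOn (fun x => f x - p x) (Ico (0 : ℝ) T.length)

/-- `f` has symmetric logarithmic singularities at the endpoints `β i`. -/
def IsSymLog (f : ℝ → ℝ) : Prop := ∃ p : ℝ → ℝ, T.IsLogPart p f

/-- The Birkhoff sum `S_n(f)(x)`, which is `∑_{0 ≤ i < n} f (T^i x)` for `n ≥ 0` and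
`-∑_{n ≤ i < 0} f (T^i x)` for `n < 0`. -/
noncomputable def birkhoff (f : ℝ → ℝ) (n : ℤ) (x : T.Base) : ℝ :=
  ∑ i ∈ Finset.Ico 0 n, f ((T.map ^ i) x) - ∑ i ∈ Finset.Ico n 0, f ((T.map ^ i) x)

/-! ### Rokhlin towers and good rigidity -/

/-- The `i`-th level `T^i J` over the base `J = (a, b)`. -/
def level (a b : ℝ) (i : ℕ) : Set T.Base := (T.map ^ i) '' {x | (x : ℝ) ∈ Ioo a b}

/-- The union of the levels `T^i J`, `0 ≤ i < h`. -/
def tower (a b : ℝ) (h : ℕ) : Set T.Base := ⋃ i ∈ Finset.range h, T.level a b i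

/-- The levels `T^i J`, `0 ≤ i < h`, over the nonempty interval `J = (a, b) ⊆ I` are pairwise
disjoint intervals. -/
structure IsTower (a b : ℝ) (h : ℕ) : Prop where
  nonneg : 0 ≤ a
  lt : a < b
  le : b ≤ T.length
  interval : ∀ i < h, (T.level a b i).OrdConnected
  disjoint : ∀ i < h, ∀ j < h, i ≠ j → Disjoint (T.level a b i) (T.level a b j)

/-- The towers with bases `(a n, b n)` and heights `h n` form a good rigidity sequence. Here
`1 / (b n - a n)` is `q_n`. -/
structure IsGoodRigiditySeq (a b : ℕ → ℝ) (h : ℕ → ℕ) : Prop where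
  isTower : ∀ n, T.IsTower (a n) (b n) (h n)
  height : Tendsto h atTop atTop
  measure : Tendsto (fun n => T.leb (T.tower (a n) (b n) (h n))) atTop
    (𝓝 (ENNReal.ofReal T.length))
  rigid : ∀ n, ∀ x ∈ T.tower (a n) (b n) (h n),
    |((T.map ^ h n) x : ℝ) - x| ≤ 1 / ((1 / (b n - a n)) * Real.log (1 / (b n - a n)))

/-! ### The special flow -/

/-- The region `X^f = {(x, r) : x ∈ I, 0 ≤ r < f x}`. -/
def region (f : ℝ → ℝ) : Set (T.Base × ℝ) := {z | 0 ≤ z.2 ∧ z.2 < f z.1}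

/-- The measure `μ^f`: the restriction of `λ × λ_ℝ` to `X^f`. -/
noncomputable def flowMeasure (f : ℝ → ℝ) : Measure (T.Base × ℝ) :=
  (T.leb.prod (volume : Measure ℝ)).restrict (T.region f)

/-- The unique integer `n` with `S_n(f)(x) ≤ s < S_{n+1}(f)(x)` (it exists for all `x ∈ I` and
all real `s` when `f` is bounded below on `I` by a positive constant). -/
noncomputable def jumps (f : ℝ → ℝ) (s : ℝ) (x : T.Base) : ℤ :=
  Classical.epsilon fun n : ℤ => T.birkhoff f n x ≤ s ∧ s < T.birkhoff f (n + 1) x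

/-- The special flow over `T` under `f`, `T_t^f (x, r) = (T^n x, r + t - S_n(f)(x))`. It maps
`X^f` to itself; points outside `X^f` form a null set of `μ^f`. -/
noncomputable def specialFlow (f : ℝ → ℝ) (t : ℝ) (z : T.Base × ℝ) : T.Base × ℝ :=
  ((T.map ^ T.jumps f (z.2 + t) z.1) z.1,
    z.2 + t - T.birkhoff f (T.jumps f (z.2 + t) z.1) z.1)

end IET

/-! ### Ergodicity and spectrum of a flow -/

/-- The flow preserves `μ`, and every measurable set that is invariant up to null sets is null
or conull. -/
structure IsErgodicFlow {X : Type*} [MeasurableSpace X] (φ : ℝ → X → X) (μ : Measure X) :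
    Prop where
  measurePreserving : ∀ t, MeasurePreserving (φ t) μ μ
  null_or_conull : ∀ A : Set X, MeasurableSet A → (∀ t, φ t ⁻¹' A =ᵐ[μ] A) →
    μ A = 0 ∨ μ Aᶜ = 0

/-- `σ` is the spectral measure of `g`: the finite Borel measure on `ℝ` such that
`⟨g ∘ φ_t, g⟩ = ∫ e^{its} dσ(s)` for all `t`. -/
structure IsSpectralMeasure {X : Type*} [MeasurableSpace X] (φ : ℝ → X → X) (μ : Measure X)
    (g : X → ℂ) (σ : Measure ℝ) : Prop where
  finite : IsFiniteMeasure σ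
  correlation : ∀ t : ℝ, ∫ z, g (φ t z) * (starRingEnd ℂ) (g z) ∂μ =
    ∫ s : ℝ, Complex.exp (Complex.I * t * s) ∂σ

/-- The spectral measure of every `g ∈ L²` (which, for a measurable measure-preserving flow,
exists and is unique by Bochner's theorem) is singular to Lebesgue measure. -/
def HasPurelySingularSpectrum {X : Type*} [MeasurableSpace X] (φ : ℝ → X → X)
    (μ : Measure X) : Prop :=
  ∀ g : X → ℂ, MemLp g 2 μ → ∀ σ : Measure ℝ, IsSpectralMeasure φ μ g σ →
    σ.MutuallySingular volume

namespace IET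

variable {d : ℕ} (T : IET d)

/-! ### The transformation as a measure preserving equivalence -/

/-! Ergodicity. A level straddling a discontinuity would be torn apart by the order-reversing
exchange, so for large `n` the levels are translates of the base (`exists_isTranslationTower`), of
width tending to `0`. A `T`-invariant set has the same measure in every level, hence asymptotically
the same density in every interval, and is null or conull (`null_or_conull_of_isGoodRigiditySeq`).
The special flow is vertical translation on `I × ℝ` modulo the skew product `(x, s) ↦ (T x, s - f
x)`, with `X^f` as fundamental domain. This gives the invariance of `μ^f` and passes ergodicity from
`T` to the flow (`isErgodicFlow_of_base`).

Concentration. Let `l = b n - a n`, and let `ζ n = S_h(f) - c n` with `h = h n` and `c n` the value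
of `S_h(f)` at the centre of the base. Levels in one piece are disjoint translates, so their
distances to an endpoint of the piece are `l`-separated. Linearizing each logarithm at the centre
therefore leaves errors dominated by `∑ 1/j²`: on the base, the Birkhoff sum of the logarithmic part
is affine up to a constant and to logarithms of the distances to the two ends of the base. The slope
is `O(1/l)` by symmetry: `T` followed by `x ↦ |I| - x` reflects each piece in itself, so reversing
and reflecting an orbit preserves the Birkhoff sum but reverses displacements (`birkhoff_reflect`,
`abs_slope_mul_le`). The part of bounded variation contributes a bounded amount. Passing from the
base to level `k` costs `S_k(f)(T^h y) - S_k(f)(y)`, which stays bounded because the rigidity rate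
`l / log(1/l)` compensates the harmonic sum `l⁻¹ log(1/l)`. Thus `ζ n` has a bounded exponential
moment off a set of measure tending to `0` (`exists_concentration`).

Spectrum. Since `T^h → id` in measure, the flow at time `c n` acts approximately as the translation
by `-ζ n x` on the fibre of `x`. The functions `ζ n` are asymptotically `T`-invariant, hence
asymptotically independent of the point (`tendsto_integral_sub_average`), so the flow at time `c n`
resembles the average of the flow at times `-x` over the law of `ζ n`. Along a subsequence the laws
converge to some `P` with an exponential moment, and `e^{i c_n u}` converges weak-* in `L^∞(σ)` to
`χ u = charFun P (-u)`. This limit is nonzero almost everywhere, as `charFun P` is analytic; but on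
the absolutely continuous part of `σ` the limit must be `0` by the Riemann–Lebesgue lemma. So that
part vanishes (`mutuallySingular_of_tendsto_correlation`). -/

theorem β'_eq_of_isSymmetric (hT : T.IsSymmetric) (k : Fin (d + 1)) :
    T.β' k = T.length - T.β k.rev := by
  induction k using Fin.induction with
  | zero => simp [β'_zero, length]
  | succ k ih =>
    have h : T.π.symm k = k.rev := by
      rw [Equiv.symm_apply_eq, hT, Fin.rev_rev]
    rw [β'_succ, ih, h, Fin.rev_castSucc, Fin.rev_succ, len]
    ring

theorem map_apply_of_isSymmetric (hT : T.IsSymmetric) (x : T.Base) :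
    ((T.map x : T.Base) : ℝ) =
      x + T.length - T.β (T.topIndex x).castSucc - T.β (T.topIndex x).succ := by
  have h : ((T.map x : T.Base) : ℝ) =
    (x : ℝ) - T.β (T.topIndex x).castSucc + T.β' (T.π (T.topIndex x)).castSucc := rfl
  rw [h, β'_eq_of_isSymmetric T hT, hT, Fin.rev_castSucc, Fin.rev_rev]
  ring

theorem map_coe_eq (hT : T.IsSymmetric) {x : T.Base} {i : Fin d}
    (h : (x : ℝ) ∈ Ico (T.β i.castSucc) (T.β i.succ)) :
    ((T.map x : T.Base) : ℝ) = x + T.length - T.β i.castSucc - T.β i.succ := by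
  rw [map_apply_of_isSymmetric T hT, T.topIndex_eq h]

theorem measurableEmbedding_coe : MeasurableEmbedding (Subtype.val : T.Base → ℝ) :=
  MeasurableEmbedding.subtype_coe measurableSet_Ico

theorem leb_apply (s : Set T.Base) : T.leb s = volume (Subtype.val '' s) :=
  T.measurableEmbedding_coe.comap_apply _ _

theorem leb_preimage (s : Set ℝ) :
    T.leb (Subtype.val ⁻¹' s) = volume (s ∩ Ico 0 T.length) := by
  rw [leb_apply, Subtype.image_preimage_coe, inter_comm]

theorem leb_univ : T.leb univ = ENNReal.ofReal T.length := by
  have := T.leb_preimage univ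
  simpa using this

instance : IsFiniteMeasure T.leb := ⟨by rw [leb_univ]; exact ENNReal.ofReal_lt_top⟩

theorem topIndex_preimage (i : Fin d) :
    T.topIndex ⁻¹' {i} = Subtype.val ⁻¹' Ico (T.β i.castSucc) (T.β i.succ) := by
  ext x
  refine ⟨fun h => ?_, fun h => T.topIndex_eq h⟩
  have h' : T.topIndex x = i := h
  rw [← h']
  exact T.topIndex_mem x

theorem botIndex_preimage (i : Fin d) :
    T.botIndex ⁻¹' {i} = Subtype.val ⁻¹' Ico (T.β' i.castSucc) (T.β' i.succ) := by
  ext x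
  refine ⟨fun h => ?_, fun h => T.botIndex_eq h⟩
  have h' : T.botIndex x = i := h
  rw [← h']
  exact T.botIndex_mem x

theorem measurable_topIndex : Measurable T.topIndex :=
  measurable_to_countable' fun i => by
    rw [topIndex_preimage]; exact measurable_subtype_coe measurableSet_Ico

theorem measurable_botIndex : Measurable T.botIndex :=
  measurable_to_countable' fun i => by
    rw [botIndex_preimage]; exact measurable_subtype_coe measurableSet_Ico

theorem measurable_map : Measurable T.map := by
  refine Measurable.subtype_mk (h := fun x => T.bot_subset _ (T.fwd_mem x)) ?_
  have h : Measurable fun i : Fin d => T.β i.castSucc := measurable_of_finite _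
  have h' : Measurable fun i : Fin d => T.β' (T.π i).castSucc := measurable_of_finite _
  exact (measurable_subtype_coe.sub (h.comp T.measurable_topIndex)).add
    (h'.comp T.measurable_topIndex)

theorem measurable_map_symm : Measurable T.map.symm := by
  refine Measurable.subtype_mk (h := fun x => T.top_subset _ (T.bwd_mem x)) ?_
  have h : Measurable fun i : Fin d => T.β' i.castSucc := measurable_of_finite _
  have h' : Measurable fun i : Fin d => T.β (T.π.symm i).castSucc := measurable_of_finite _
  exact (measurable_subtype_coe.sub (h.comp T.measurable_botIndex)).add
    (h'.comp T.measurable_botIndex)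

theorem botIndex_map (x : T.Base) : T.botIndex (T.map x) = T.π (T.topIndex x) :=
  T.botIndex_eq (T.fwd_mem x)

theorem measure_eq_sum_fiber {α : Type*} [MeasurableSpace α] (μ : Measure α) {g : α → Fin d}
    (hg : Measurable g) {s : Set α} (hs : MeasurableSet s) :
    μ s = ∑ i, μ (s ∩ g ⁻¹' {i}) := by
  have h : s = ⋃ i ∈ Finset.univ, s ∩ g ⁻¹' {i} := by
    ext x; simp
  conv_lhs => rw [h]
  refine measure_biUnion_finset ?_ fun i _ => hs.inter (hg (measurableSet_singleton i))
  intro i _ j _ hij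
  refine Disjoint.mono inter_subset_right inter_subset_right ?_
  rw [Set.disjoint_left]
  intro x hx hx'
  exact hij (hx.symm.trans hx')

theorem measurePreserving_map : MeasurePreserving T.map T.leb T.leb := by
  refine ⟨T.measurable_map, ?_⟩
  ext s hs
  rw [Measure.map_apply T.measurable_map hs,
    measure_eq_sum_fiber T.leb T.measurable_topIndex (T.measurable_map hs),
    measure_eq_sum_fiber T.leb T.measurable_botIndex hs, ← Equiv.sum_comp T.π fun i => T.leb (s ∩ T.botIndex ⁻¹' {i})]
  refine Finset.sum_congr rfl fun i _ => ?_
  -- On each piece `T` is a single translation, so the identity reduces piece by piece to the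
  -- translation invariance of Lebesgue measure.
  have h : Subtype.val '' (s ∩ T.botIndex ⁻¹' {T.π i}) =
      (fun y => y + (T.β' (T.π i).castSucc - T.β i.castSucc)) ''
        (Subtype.val '' (T.map ⁻¹' s ∩ T.topIndex ⁻¹' {i})) := by
    have hm : ∀ x, T.topIndex x = i → ((T.map x : T.Base) : ℝ) =
        x + (T.β' (T.π i).castSucc - T.β i.castSucc) := by
      rintro x rfl
      change (x : ℝ) - T.β (T.topIndex x).castSucc + T.β' (T.π (T.topIndex x)).castSucc = _
      ring
    ext y
    simp only [mem_image, mem_inter_iff, mem_preimage, mem_singleton_iff]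
    constructor
    · rintro ⟨z, ⟨hz, hzi⟩, rfl⟩
      refine ⟨_, ⟨T.map.symm z, ⟨by simpa using hz, ?_⟩, rfl⟩, ?_⟩
      · have := T.botIndex_map (T.map.symm z)
        rw [Equiv.apply_symm_apply, hzi] at this
        exact (T.π.injective this).symm
      · rw [← hm, Equiv.apply_symm_apply]
        have := T.botIndex_map (T.map.symm z)
        rw [Equiv.apply_symm_apply, hzi] at this
        exact (T.π.injective this).symm
    · rintro ⟨_, ⟨x, ⟨hx, hxi⟩, rfl⟩, rfl⟩
      exact ⟨T.map x, ⟨hx, by rw [botIndex_map, hxi]⟩, hm x hxi⟩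
  rw [leb_apply, leb_apply, h, image_add_right, measure_preimage_add_right]

/-- The interval exchange transformation as a measurable equivalence. -/
noncomputable def mapEquiv : T.Base ≃ᵐ T.Base where
  toEquiv := T.map
  measurable_toFun := T.measurable_map
  measurable_invFun := T.measurable_map_symm

theorem measurePreserving_zpow (n : ℤ) : MeasurePreserving (T.map ^ n) T.leb T.leb := by
  have hs : MeasurePreserving T.map.symm T.leb T.leb :=
    MeasurePreserving.symm T.mapEquiv T.measurePreserving_map
  induction n using Int.induction_on with
  | zero => exact MeasurePreserving.id _
  | succ n ih =>
    rw [zpow_add_one]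
    exact ih.comp T.measurePreserving_map
  | pred n ih =>
    rw [zpow_sub_one]
    exact ih.comp hs

theorem measurePreserving_pow (n : ℕ) : MeasurePreserving (T.map ^ n) T.leb T.leb := by
  rw [← zpow_natCast]
  exact T.measurePreserving_zpow n

/-! ### Birkhoff sums -/

theorem birkhoff_zero (f : ℝ → ℝ) (x : T.Base) : T.birkhoff f 0 x = 0 := by
  simp [birkhoff]

theorem birkhoff_add_one (f : ℝ → ℝ) (n : ℤ) (x : T.Base) :
    T.birkhoff f (n + 1) x = T.birkhoff f n x + f ((T.map ^ n) x) := by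
  unfold birkhoff
  rcases le_or_gt 0 n with h | h
  · have h1 : Finset.Ico 0 (n + 1) = insert n (Finset.Ico 0 n) := by
      ext i; simp only [Finset.mem_Ico, Finset.mem_insert]; omega
    rw [h1, Finset.sum_insert (by simp), Finset.Ico_eq_empty (by omega : ¬ n < 0),
      Finset.Ico_eq_empty (by omega : ¬ n + 1 < 0)]
    simp [add_comm]
  · have h1 : Finset.Ico n 0 = insert n (Finset.Ico (n + 1) 0) := by
      ext i; simp only [Finset.mem_Ico, Finset.mem_insert]; omega
    rw [h1, Finset.sum_insert (by simp), Finset.Ico_eq_empty (by omega : ¬ 0 < n),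
      Finset.Ico_eq_empty (by omega : ¬ 0 < n + 1)]
    simp

theorem birkhoff_natCast (f : ℝ → ℝ) (n : ℕ) (x : T.Base) :
    T.birkhoff f n x = ∑ i ∈ Finset.range n, f ((T.map ^ i) x) := by
  induction n with
  | zero => simp [birkhoff]
  | succ n ih =>
    rw [Nat.cast_succ, birkhoff_add_one, ih, Finset.sum_range_succ, zpow_natCast]

theorem birkhoff_sub_natCast (f p : ℝ → ℝ) (n : ℕ) (x : T.Base) :
    T.birkhoff (fun x => f x - p x) n x = T.birkhoff f n x - T.birkhoff p n x := by
  simp only [birkhoff_natCast, Finset.sum_sub_distrib]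

/-- Split `S_{n+k}` in two ways. When `n` is a rigidity time, `T^n x` is close to `x`, and the
difference of `S_n` between two levels becomes a small increment of `S_k`. -/
theorem birkhoff_pow_apply (f : ℝ → ℝ) (n k : ℕ) (x : T.Base) :
    T.birkhoff f n ((T.map ^ k) x) =
      T.birkhoff f n x + (T.birkhoff f k ((T.map ^ n) x) - T.birkhoff f k x) := by
  have h1 : T.birkhoff f (k + n : ℕ) x = T.birkhoff f k x + T.birkhoff f n ((T.map ^ k) x) := by
    simp only [birkhoff_natCast, Finset.sum_range_add, ← Equiv.Perm.mul_apply, ← pow_add]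
    congr 1
    exact Finset.sum_congr rfl fun i _ => by rw [add_comm]
  have h2 : T.birkhoff f (n + k : ℕ) x = T.birkhoff f n x + T.birkhoff f k ((T.map ^ n) x) := by
    simp only [birkhoff_natCast, Finset.sum_range_add, ← Equiv.Perm.mul_apply, ← pow_add]
    congr 1
    exact Finset.sum_congr rfl fun i _ => by rw [add_comm]
  rw [add_comm] at h1
  linarith

theorem measurable_birkhoff {f : ℝ → ℝ} (hf : Measurable fun x : T.Base => f x) (n : ℤ) :
    Measurable (T.birkhoff f n) := by
  have h : ∀ i : ℤ, Measurable fun x => f ((T.map ^ i) x) := fun i =>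
    hf.comp (T.measurePreserving_zpow i).measurable
  exact (Finset.measurable_fun_sum _ fun i _ => h i).sub
    (Finset.measurable_fun_sum _ fun i _ => h i)

end IET

namespace IET

variable {d : ℕ} (T : IET d)

/-! ### The skew product and its fundamental domain -/

/-- The skew product `(x, s) ↦ (T x, s - f x)` on `I × ℝ`; the space `X^f` of the special flow is
a fundamental domain of it, and the special flow is induced by vertical translation. -/
noncomputable def skew (f : ℝ → ℝ) : Equiv.Perm (T.Base × ℝ) where
  toFun z := (T.map z.1, z.2 - f z.1)
  invFun z := (T.map.symm z.1, z.2 + f (T.map.symm z.1))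
  left_inv z := by simp
  right_inv z := by simp

variable (f : ℝ → ℝ)

theorem skew_apply (z : T.Base × ℝ) : T.skew f z = (T.map z.1, z.2 - f z.1) := rfl

theorem skew_zpow_apply (n : ℤ) (z : T.Base × ℝ) :
    (T.skew f ^ n) z = ((T.map ^ n) z.1, z.2 - T.birkhoff f n z.1) := by
  have step : ∀ n : ℤ, T.skew f ((T.map ^ n) z.1, z.2 - T.birkhoff f n z.1) =
      ((T.map ^ (n + 1)) z.1, z.2 - T.birkhoff f (n + 1) z.1) := by
    intro n
    rw [skew_apply, birkhoff_add_one, add_comm n 1, zpow_one_add, Equiv.Perm.mul_apply]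
    congr 1
    ring
  induction n using Int.induction_on with
  | zero => simp [birkhoff_zero]
  | succ n ih => rw [← step, ← ih, add_comm, zpow_one_add, Equiv.Perm.mul_apply]
  | pred n ih =>
    apply (T.skew f).injective
    rw [step, sub_add_cancel, ← ih, ← Equiv.Perm.mul_apply, ← zpow_one_add, add_sub_cancel]

theorem skew_zpow_mem_region {n : ℤ} {z : T.Base × ℝ} :
    (T.skew f ^ n) z ∈ T.region f ↔
      T.birkhoff f n z.1 ≤ z.2 ∧ z.2 < T.birkhoff f (n + 1) z.1 := by
  rw [skew_zpow_apply, birkhoff_add_one]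
  simp only [region, mem_ofPred_eq, sub_nonneg, sub_lt_iff_lt_add']

variable {f}

theorem birkhoff_strictMono (hf : ∀ x : T.Base, 0 < f x) (x : T.Base) :
    StrictMono fun n => T.birkhoff f n x :=
  strictMono_int_of_lt_succ fun n => by
    rw [birkhoff_add_one]; linarith [hf ((T.map ^ n) x)]

theorem mul_le_birkhoff {m : ℝ} (hf : ∀ x : T.Base, m ≤ f x) (n : ℕ) (x : T.Base) :
    n * m ≤ T.birkhoff f n x := by
  induction n with
  | zero => simp [birkhoff_zero]
  | succ n ih =>
    rw [Nat.cast_succ, Nat.cast_succ, birkhoff_add_one]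
    linarith [hf ((T.map ^ (n : ℤ)) x)]

theorem birkhoff_neg_le {m : ℝ} (hf : ∀ x : T.Base, m ≤ f x) (n : ℕ) (x : T.Base) :
    T.birkhoff f (-n) x ≤ -(n * m) := by
  induction n with
  | zero => simp [birkhoff_zero]
  | succ n ih =>
    have h := T.birkhoff_add_one f (-((n : ℤ) + 1)) x
    have h2 : -((n : ℤ) + 1) + 1 = -n := by ring
    rw [h2] at h
    push_cast
    linarith [hf ((T.map ^ (-((n : ℤ) + 1))) x)]

/-- The Birkhoff sums increase strictly in `n` and are unbounded in both directions, by the lower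
bound `m`, so they cut `ℝ` into consecutive half-open intervals. -/
theorem existsUnique_skew_mem_region {m : ℝ} (hm : 0 < m) (hf : ∀ x : T.Base, m ≤ f x)
    (z : T.Base × ℝ) : ∃! n : ℤ, (T.skew f ^ n) z ∈ T.region f := by
  have hmono := T.birkhoff_strictMono (fun x => hm.trans_le (hf x)) z.1
  simp_rw [skew_zpow_mem_region]
  obtain ⟨N, hN⟩ := exists_nat_gt (|z.2| / m)
  have hN' : |z.2| < N * m := (div_lt_iff₀ hm).1 hN
  obtain ⟨n, hn, hmax⟩ := Int.exists_greatest_of_bdd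
    (P := fun n => T.birkhoff f n z.1 ≤ z.2)
    ⟨N, fun k hk => by
      by_contra! h
      have := hmono h
      have h2 := T.mul_le_birkhoff hf N z.1
      simp only at this
      linarith [le_abs_self z.2]⟩
    ⟨-N, by linarith [T.birkhoff_neg_le hf N z.1, neg_abs_le z.2]⟩
  refine ⟨n, ⟨hn, ?_⟩, ?_⟩
  · by_contra! h
    have := hmax _ h
    omega
  · rintro k ⟨h1, h2⟩
    refine le_antisymm (hmax k h1) ?_
    by_contra! h
    have h3 : k + 1 ≤ n := h
    have := hmono.monotone h3
    linarith

/-- The projection of `I × ℝ` onto the fundamental domain `X^f` of the skew product. -/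
noncomputable def fold (f : ℝ → ℝ) (z : T.Base × ℝ) : T.Base × ℝ :=
  (T.skew f ^ T.jumps f z.2 z.1) z

theorem specialFlow_eq_fold (f : ℝ → ℝ) (t : ℝ) (z : T.Base × ℝ) :
    T.specialFlow f t z = T.fold f (z.1, z.2 + t) := by
  rw [fold, skew_zpow_apply, specialFlow]

section

variable {m : ℝ} (hm : 0 < m) (hf : ∀ x : T.Base, m ≤ f x)
include hm hf

theorem fold_mem_region (z : T.Base × ℝ) : T.fold f z ∈ T.region f := by
  obtain ⟨n, hn, -⟩ := T.existsUnique_skew_mem_region hm hf z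
  rw [fold, skew_zpow_mem_region]
  exact Classical.epsilon_spec (p := fun n : ℤ => T.birkhoff f n z.1 ≤ z.2 ∧
    z.2 < T.birkhoff f (n + 1) z.1) ⟨n, (T.skew_zpow_mem_region f).1 hn⟩

theorem fold_eq {z : T.Base × ℝ} {n : ℤ} (h : (T.skew f ^ n) z ∈ T.region f) :
    T.fold f z = (T.skew f ^ n) z := by
  rw [fold, (T.existsUnique_skew_mem_region hm hf z).unique (T.fold_mem_region hm hf z) h]

theorem fold_of_mem {z : T.Base × ℝ} (h : z ∈ T.region f) : T.fold f z = z := by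
  simpa using T.fold_eq hm hf (n := 0) (by simpa using h)

/-- Composition with `fold` thus turns any function on `X^f` into a skew-invariant function on `I ×
ℝ`, on which the flow is a mere vertical shift. -/
theorem fold_skew_zpow (k : ℤ) (z : T.Base × ℝ) :
    T.fold f ((T.skew f ^ k) z) = T.fold f z := by
  obtain ⟨n, hn, -⟩ := T.existsUnique_skew_mem_region hm hf z
  have h : (T.skew f ^ n) z = (T.skew f ^ (n - k)) ((T.skew f ^ k) z) := by
    rw [← Equiv.Perm.mul_apply, ← zpow_add, sub_add_cancel]
  rw [T.fold_eq hm hf hn, h, T.fold_eq hm hf (n := n - k) (h ▸ hn)]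

end

/-! ### Measurability and invariance of the measure -/

section

variable (hfm : Measurable fun x : T.Base => f x)
include hfm

theorem measurableSet_region : MeasurableSet (T.region f) :=
  (measurableSet_le measurable_const measurable_snd).inter
    (measurableSet_lt measurable_snd (hfm.comp measurable_fst))

theorem measurePreserving_skew_zpow (n : ℤ) :
    MeasurePreserving (T.skew f ^ n) (T.leb.prod volume) (T.leb.prod volume) := by
  have h : ⇑(T.skew f ^ n) = fun z => ((T.map ^ n) z.1, z.2 - T.birkhoff f n z.1) :=
    funext (T.skew_zpow_apply f n)
  rw [h]
  refine (T.measurePreserving_zpow n).skew_product (g := fun x s => s - T.birkhoff f n x) ?_ ?_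
  · exact measurable_snd.sub ((T.measurable_birkhoff hfm n).comp measurable_fst)
  · exact ae_of_all _ fun x => (measurePreserving_sub_right volume _).map_eq

theorem measurable_fold {m : ℝ} (hm : 0 < m) (hf : ∀ x : T.Base, m ≤ f x) :
    Measurable (T.fold f) := by
  intro s hs
  have h : T.fold f ⁻¹' s = ⋃ n : ℤ, (T.skew f ^ n) ⁻¹' (T.region f ∩ s) := by
    ext z
    simp only [mem_preimage, mem_iUnion, mem_inter_iff]
    constructor
    · exact fun h => ⟨_, T.fold_mem_region hm hf z, h⟩
    · rintro ⟨n, hn, hs⟩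
      rwa [T.fold_eq hm hf hn]
  rw [h]
  exact MeasurableSet.iUnion fun n => (T.measurePreserving_skew_zpow hfm n).measurable
    ((T.measurableSet_region hfm).inter hs)

theorem measurable_specialFlow {m : ℝ} (hm : 0 < m) (hf : ∀ x : T.Base, m ≤ f x) (t : ℝ) :
    Measurable (T.specialFlow f t) := by
  rw [funext (T.specialFlow_eq_fold f t)]
  exact (T.measurable_fold hfm hm hf).comp
    (measurable_fst.prodMk (measurable_snd.add_const t))

/-- Vertical translations commute with the skew product, so they carry the fundamental domain `X^f`
to fundamental domains. -/
theorem isFundamentalDomain_region {m : ℝ} (hm : 0 < m) (hf : ∀ x : T.Base, m ≤ f x) (t : ℝ) :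
    IsFundamentalDomain (Subgroup.zpowers (T.skew f))
      ((fun z : T.Base × ℝ => (z.1, z.2 - t)) ⁻¹' T.region f) (T.leb.prod volume) := by
  refine IsFundamentalDomain.mk' ?_ fun z => ?_
  · exact (measurable_fst.prodMk (measurable_snd.sub_const t)
      (T.measurableSet_region hfm)).nullMeasurableSet
  · have key : ∀ n : ℤ, ((T.skew f ^ n) z).1 = ((T.skew f ^ n) (z.1, z.2 - t)).1 ∧
        ((T.skew f ^ n) z).2 - t = ((T.skew f ^ n) (z.1, z.2 - t)).2 := by
      intro n
      simp only [skew_zpow_apply, true_and]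
      ring
    obtain ⟨n, hn, huniq⟩ := T.existsUnique_skew_mem_region hm hf (z.1, z.2 - t)
    refine ⟨⟨T.skew f ^ n, n, rfl⟩, ?_, ?_⟩
    · change (((T.skew f ^ n) z).1, ((T.skew f ^ n) z).2 - t) ∈ T.region f
      rwa [(key n).1, (key n).2]
    · rintro ⟨_, k, rfl⟩ hk
      change (((T.skew f ^ k) z).1, ((T.skew f ^ k) z).2 - t) ∈ T.region f at hk
      rw [(key k).1, (key k).2] at hk
      simp only [huniq k hk]

/-- Up to a vertical shift, the preimage of `s` is the trace of the skew-invariant set `fold ⁻¹' s`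
on a translate of `X^f`. An invariant set has the same measure in any two fundamental domains. -/
theorem measurePreserving_specialFlow {m : ℝ} (hm : 0 < m) (hf : ∀ x : T.Base, m ≤ f x)
    (t : ℝ) : MeasurePreserving (T.specialFlow f t) (T.flowMeasure f) (T.flowMeasure f) := by
  have hX := T.measurableSet_region hfm
  have hsm := T.measurable_specialFlow hfm hm hf t
  have hpow : ∀ g : Subgroup.zpowers (T.skew f),
      MeasurePreserving (fun z : T.Base × ℝ => g • z) (T.leb.prod volume) (T.leb.prod volume) := by
    rintro ⟨_, n, rfl⟩
    exact T.measurePreserving_skew_zpow hfm n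
  have : MeasurableConstSMul (Subgroup.zpowers (T.skew f)) (T.Base × ℝ) :=
    ⟨fun g => (hpow g).measurable⟩
  have : SMulInvariantMeasure (Subgroup.zpowers (T.skew f)) (T.Base × ℝ) (T.leb.prod volume) :=
    ⟨fun g s hs => (hpow g).measure_preimage hs.nullMeasurableSet⟩
  refine ⟨hsm, ?_⟩
  ext s hs
  have hB := T.measurable_fold hfm hm hf hs
  have hinv : ∀ g : Subgroup.zpowers (T.skew f),
      (fun z : T.Base × ℝ => g • z) ⁻¹' (T.fold f ⁻¹' s) = T.fold f ⁻¹' s := by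
    rintro ⟨_, n, rfl⟩
    ext z
    change T.fold f ((T.skew f ^ n) z) ∈ s ↔ T.fold f z ∈ s
    rw [T.fold_skew_zpow hm hf]
  have hshift : MeasurePreserving (fun z : T.Base × ℝ => (z.1, z.2 + t))
      (T.leb.prod volume) (T.leb.prod volume) :=
    (MeasurePreserving.id T.leb).prod (measurePreserving_add_right volume t)
  have h1 := (T.isFundamentalDomain_region hfm hm hf t).measure_set_eq
    (T.isFundamentalDomain_region hfm hm hf 0) hB hinv
  rw [Measure.map_apply hsm hs, flowMeasure, Measure.restrict_apply (hsm hs),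
    Measure.restrict_apply hs]
  have h2 : T.specialFlow f t ⁻¹' s ∩ T.region f = (fun z : T.Base × ℝ => (z.1, z.2 + t)) ⁻¹'
      (T.fold f ⁻¹' s ∩ (fun z : T.Base × ℝ => (z.1, z.2 - t)) ⁻¹' T.region f) := by
    ext z
    simp [specialFlow_eq_fold]
  have h3 : T.fold f ⁻¹' s ∩ (fun z : T.Base × ℝ => (z.1, z.2 - 0)) ⁻¹' T.region f =
      s ∩ T.region f := by
    ext z
    simp only [sub_zero, mem_inter_iff, mem_preimage]
    constructor
    · rintro ⟨h, h'⟩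
      rw [T.fold_of_mem hm hf h'] at h
      exact ⟨h, h'⟩
    · rintro ⟨h, h'⟩
      refine ⟨?_, h'⟩
      rwa [T.fold_of_mem hm hf h']
  rw [h2, hshift.measure_preimage, h1, h3]
  exact (hB.inter (measurable_fst.prodMk (measurable_snd.sub_const t) hX)).nullMeasurableSet

end

end IET

namespace IET

variable {d : ℕ} (T : IET d)

/-! ### Ergodicity of the special flow -/

theorem ae_add_const_iff {p : ℝ → Prop} (c : ℝ) : (∀ᵐ t : ℝ, p (c + t)) ↔ ∀ᵐ t : ℝ, p t := by
  constructor
  · intro h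
    have := (measurePreserving_add_left volume (-c)).quasiMeasurePreserving.ae h
    simpa using this
  · exact fun h => (measurePreserving_add_left volume c).quasiMeasurePreserving.ae h

theorem exists_mem_Ioo_of_ae {p : ℝ → Prop} (h : ∀ᵐ t : ℝ, p t) {u v : ℝ} (huv : u < v) :
    ∃ t ∈ Ioo u v, p t := by
  by_contra! hc
  have h0 : volume (Ioo u v) = 0 :=
    measure_mono_null (fun t ht => hc t ht) h
  rw [Real.volume_Ioo, ENNReal.ofReal_eq_zero] at h0
  linarith

variable {f : ℝ → ℝ}

section

variable (hfm : Measurable fun x : T.Base => f x) {m : ℝ} (hm : 0 < m)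
  (hf : ∀ x : T.Base, m ≤ f x)
include hfm hm hf

/-- Flowing inside a fibre does not change the base point, so by Fubini an invariant set contains
almost all or almost none of almost every fibre. -/
theorem exists_base_of_invariant {A : Set (T.Base × ℝ)} (hA : MeasurableSet A)
    (hinv : ∀ t, T.specialFlow f t ⁻¹' A =ᵐ[T.flowMeasure f] A) :
    ∃ B : Set T.Base, MeasurableSet B ∧
      ∀ᵐ x ∂T.leb, ∀ᵐ s : ℝ, (x, s) ∈ T.region f → ((x, s) ∈ A ↔ x ∈ B) := by
  have hX := T.measurableSet_region hfm
  have h1 : ∀ᵐ t : ℝ, ∀ᵐ z ∂(T.leb.prod volume), z ∈ T.region f → (z.1, z.2 + t) ∈ T.region f →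
      (z ∈ A ↔ (z.1, z.2 + t) ∈ A) := by
    refine ae_of_all _ fun t => ?_
    have := hinv t
    rw [flowMeasure, eventuallyEq_set, ae_restrict_iff' hX] at this
    filter_upwards [this] with z hz hzX hzX'
    have h2 := hz hzX
    rw [mem_preimage, specialFlow_eq_fold, T.fold_of_mem hm hf hzX'] at h2
    exact h2.symm
  have hmeas : MeasurableSet {w : ℝ × (T.Base × ℝ) | w.2 ∈ T.region f →
      (w.2.1, w.2.2 + w.1) ∈ T.region f → (w.2 ∈ A ↔ (w.2.1, w.2.2 + w.1) ∈ A)} := by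
    have hsh : Measurable fun w : ℝ × (T.Base × ℝ) => (w.2.1, w.2.2 + w.1) := by fun_prop
    exact (measurable_snd hX).imp ((hsh hX).imp ((measurable_snd hA).iff (hsh hA)))
  have h2 := (Measure.ae_ae_comm hmeas).1 h1
  have h3 := Measure.ae_ae_of_ae_prod h2
  -- `B` consists of the points whose fibre lies in `A` up to a null set.
  refine ⟨{x | volume (Prod.mk x ⁻¹' (T.region f ∩ Aᶜ)) = 0},
    measurable_measure_prodMk_left (hX.inter hA.compl) (measurableSet_singleton 0), ?_⟩
  filter_upwards [h3] with x hx
  -- A typical height `r`: membership in `A` at almost every other height of the fibre agrees with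
  -- membership at `r`.
  obtain ⟨r, hr, hrt⟩ := exists_mem_Ioo_of_ae hx (hm.trans_le (hf x))
  have hrX : (x, r) ∈ T.region f := ⟨hr.1.le, hr.2⟩
  have h4 : ∀ᵐ s : ℝ, (x, s) ∈ T.region f → ((x, r) ∈ A ↔ (x, s) ∈ A) :=
    (ae_add_const_iff r).1 (hrt.mono fun t ht => ht hrX)
  have h5 : (x, r) ∈ A ↔ volume (Prod.mk x ⁻¹' (T.region f ∩ Aᶜ)) = 0 := by
    constructor
    · intro hA
      refine measure_mono_null (fun s hs => ?_) h4
      simp only [mem_compl_iff, mem_ofPred_eq, Classical.not_imp]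
      exact ⟨hs.1, fun h => hs.2 (h.1 hA)⟩
    · intro h0
      by_contra hA
      have h6 : ∀ᵐ s : ℝ, ¬ (x, s) ∈ T.region f ∩ Aᶜ := by
        exact measure_eq_zero_iff_ae_notMem.1 h0
      obtain ⟨s, hs, h7, h8⟩ := exists_mem_Ioo_of_ae (h4.and h6) (hm.trans_le (hf x))
      have hsX : (x, s) ∈ T.region f := ⟨hs.1.le, hs.2⟩
      exact h8 ⟨hsX, fun h => hA ((h7 hsX).2 h)⟩
  filter_upwards [h4] with s hs hsX
  exact (hs hsX).symm.trans h5

/-- The base set `B` of an invariant set is `T`-invariant, because flowing for time `m / 2` from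
near the roof over `x` leads into the fibre over `T x`. -/
theorem isErgodicFlow_of_base
    (herg : ∀ B : Set T.Base, MeasurableSet B → T.map ⁻¹' B =ᵐ[T.leb] B →
      T.leb B = 0 ∨ T.leb Bᶜ = 0) :
    IsErgodicFlow (T.specialFlow f) (T.flowMeasure f) := by
  refine ⟨T.measurePreserving_specialFlow hfm hm hf, fun A hA hinv => ?_⟩
  have hX := T.measurableSet_region hfm
  obtain ⟨B, hB, hAB⟩ := T.exists_base_of_invariant hfm hm hf hA hinv
  have hBT : T.map ⁻¹' B =ᵐ[T.leb] B := by
    rw [eventuallyEq_set]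
    have h1 := T.measurePreserving_map.quasiMeasurePreserving.ae hAB
    have h2 := hinv (m / 2)
    rw [flowMeasure, eventuallyEq_set, ae_restrict_iff' hX] at h2
    have h3 := Measure.ae_ae_of_ae_prod h2
    filter_upwards [hAB, h1, h3] with x hx hTx hflow
    have hTx' := (ae_add_const_iff (m / 2 - f x)).2 hTx
    -- In the top `m / 2` of the fibre, the flow for time `m / 2` crosses the roof exactly once and
    -- lands below height `m / 2 < f (T x)`.
    obtain ⟨r, hr, h4, h5, h6⟩ := exists_mem_Ioo_of_ae (hx.and (hTx'.and hflow))
      (show f x - m / 2 < f x by linarith)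
    have hrX : (x, r) ∈ T.region f := ⟨by linarith [hf x, hr.1], hr.2⟩
    have hmem : (T.skew f ^ (1 : ℤ)) (x, r + m / 2) ∈ T.region f := by
      rw [zpow_one, skew_apply]
      exact ⟨by simp only; linarith [hr.1], by simp only; linarith [hf (T.map x), hr.2]⟩
    have h7 := h6 hrX
    rw [mem_preimage, specialFlow_eq_fold, T.fold_eq hm hf hmem] at h7
    rw [zpow_one, skew_apply] at h7 hmem
    have h8 : (T.map x, r + m / 2 - f x) = (T.map x, m / 2 - f x + r) := by
      congr 1; ring
    simp only [h8] at h7 hmem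
    rw [mem_preimage, ← h5 hmem, h7, h4 hrX]
  have hfin : ∀ C : Set (T.Base × ℝ), MeasurableSet C → (∀ᵐ x ∂T.leb, ∀ᵐ s : ℝ,
      (x, s) ∈ T.region f → (x, s) ∉ C) → T.flowMeasure f C = 0 := by
    intro C hC h
    rw [flowMeasure, Measure.restrict_apply hC, Measure.measure_prod_null (hC.inter hX)]
    filter_upwards [h] with x hx
    refine measure_mono_null (fun s hs => ?_) hx
    simp only [mem_compl_iff, mem_ofPred_eq, Classical.not_imp, not_not]
    exact ⟨hs.2, hs.1⟩
  rcases herg B hB hBT with h | h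
  · left
    refine hfin A hA ?_
    filter_upwards [hAB, measure_eq_zero_iff_ae_notMem.1 h] with x hx hxB
    filter_upwards [hx] with s hs hsX
    rw [hs hsX]
    exact hxB
  · right
    refine hfin Aᶜ hA.compl ?_
    filter_upwards [hAB, measure_eq_zero_iff_ae_notMem.1 h] with x hx hxB
    filter_upwards [hx] with s hs hsX
    rw [mem_compl_iff, hs hsX]
    exact hxB

end

end IET

namespace IET

variable {d : ℕ} (T : IET d)

/-! ### Towers whose levels are translates of the base -/

theorem level_eq_preimage (a b : ℝ) (i : ℕ) :
    T.level a b i = (T.map ^ (-(i : ℤ))) ⁻¹' {x | (x : ℝ) ∈ Ioo a b} := by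
  rw [level, zpow_neg, zpow_natCast, Equiv.image_eq_preimage_symm]
  rfl

theorem measurableSet_base (a b : ℝ) : MeasurableSet {x : T.Base | (x : ℝ) ∈ Ioo a b} :=
  measurable_subtype_coe measurableSet_Ioo

theorem measurableSet_level (a b : ℝ) (i : ℕ) : MeasurableSet (T.level a b i) := by
  rw [level_eq_preimage]
  exact (T.measurePreserving_zpow _).measurable (T.measurableSet_base a b)

theorem measurableSet_tower (a b : ℝ) (h : ℕ) : MeasurableSet (T.tower a b h) :=
  Finset.measurableSet_biUnion _ fun i _ => T.measurableSet_level a b i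

theorem leb_preimage_of_subset {s : Set ℝ} (hs : s ⊆ Ico 0 T.length) :
    T.leb (Subtype.val ⁻¹' s) = volume s := by
  rw [leb_preimage, inter_eq_left.2 hs]

theorem setLIntegral_level (a b : ℝ) (i : ℕ) (Θ : T.Base → ENNReal) :
    ∫⁻ x in T.level a b i, Θ x ∂T.leb =
      ∫⁻ x in {x : T.Base | (x : ℝ) ∈ Ioo a b}, Θ ((T.map ^ i) x) ∂T.leb := by
  have hemb : MeasurableEmbedding (T.map ^ i) := by
    have : MeasurableEmbedding T.map := T.mapEquiv.measurableEmbedding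
    induction i with
    | zero => exact MeasurableEmbedding.id
    | succ i ih => rw [pow_succ]; exact ih.comp this
  rw [← (T.measurePreserving_pow i).setLIntegral_comp_preimage_emb hemb, level,
    preimage_image_eq _ (T.map ^ i).injective]

namespace IsTower

variable {T} {a b : ℝ} {h : ℕ} (ht : T.IsTower a b h)
include ht

theorem subset : Ioo a b ⊆ Ico 0 T.length := fun _ hx =>
  ⟨ht.nonneg.trans hx.1.le, hx.2.trans_le ht.le⟩

theorem leb_base : T.leb {x : T.Base | (x : ℝ) ∈ Ioo a b} = ENNReal.ofReal (b - a) := by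
  rw [← Real.volume_Ioo, ← T.leb_preimage_of_subset ht.subset]
  rfl

theorem leb_level (i : ℕ) : T.leb (T.level a b i) = ENNReal.ofReal (b - a) := by
  rw [level_eq_preimage, (T.measurePreserving_zpow _).measure_preimage
    (T.measurableSet_base a b).nullMeasurableSet, ht.leb_base]

theorem pairwiseDisjoint :
    (Finset.range h : Set ℕ).PairwiseDisjoint (T.level a b) := fun i hi j hj hij =>
  ht.disjoint i (by simpa using hi) j (by simpa using hj) hij

theorem leb_tower : T.leb (T.tower a b h) = h * ENNReal.ofReal (b - a) := by
  rw [tower, measure_biUnion_finset ht.pairwiseDisjoint fun i _ => T.measurableSet_level a b i]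
  simp [ht.leb_level]

theorem mul_le_length : h * (b - a) ≤ T.length := by
  have h1 : T.leb (T.tower a b h) ≤ T.leb univ := measure_mono (subset_univ _)
  have hL : 0 ≤ T.length := ht.nonneg.trans (ht.lt.le.trans ht.le)
  rw [ht.leb_tower, leb_univ, ← ENNReal.ofReal_natCast, ← ENNReal.ofReal_mul (by positivity),
    ENNReal.ofReal_le_ofReal_iff hL] at h1
  exact h1

end IsTower

/-- A tower over `(a, b)` with levels `(a + τ i, b + τ i)`, the `i`-th of which lies in the piece
`[β (κ i), β (κ i + 1))`, and which returns to itself up to the translation by `τ h`. -/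
structure IsTranslationTower (a b : ℝ) (h : ℕ) (τ : ℕ → ℝ) (κ : ℕ → Fin d) : Prop where
  isTower : T.IsTower a b h
  map_pow : ∀ i ≤ h, ∀ x : T.Base, (x : ℝ) ∈ Ioo a b → (((T.map ^ i) x : T.Base) : ℝ) = x + τ i
  left : ∀ i < h, T.β (κ i).castSucc ≤ a + τ i
  right : ∀ i < h, b + τ i ≤ T.β (κ i).succ

/-- If a level met two pieces, the order reversal would separate its parts by at least `2 * w - (b -
a)`, more than `(b - a) + 2 * ρ`. -/
theorem topIndex_level_eq (hT : T.IsSymmetric) {a b : ℝ} {h : ℕ} (ht : T.IsTower a b h)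
    {w ρ : ℝ} (hw : ∀ i, w ≤ T.len i) (hρ : ∀ x ∈ T.tower a b h, |((T.map ^ h) x : ℝ) - x| ≤ ρ)
    (hρ0 : 0 ≤ ρ) (hlw : (b - a) + ρ < w) {i : ℕ} (hi : i < h) {t : ℝ}
    (hti : ∀ x : T.Base, (x : ℝ) ∈ Ioo a b → (((T.map ^ i) x : T.Base) : ℝ) = x + t)
    {x x' : T.Base} (hx : (x : ℝ) ∈ Ioo a b) (hx' : (x' : ℝ) ∈ Ioo a b) :
    ¬ T.topIndex ((T.map ^ i) x) < T.topIndex ((T.map ^ i) x') := by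
  intro hlt
  set k := T.topIndex ((T.map ^ i) x) with hk
  set k' := T.topIndex ((T.map ^ i) x') with hk'
  have h1 := T.map_apply_of_isSymmetric hT ((T.map ^ i) x)
  have h2 := T.map_apply_of_isSymmetric hT ((T.map ^ i) x')
  rw [← hk, hti x hx] at h1
  rw [← hk', hti x' hx'] at h2
  have h3 : T.β k.succ ≤ T.β k'.castSucc := T.strictMono.monotone (by
    rw [Fin.le_def]; simpa using hlt)
  have h4 := hw k
  have h5 := hw k'
  simp only [len] at h4 h5
  have hgap : (T.map ((T.map ^ i) x') : ℝ) + (2 * w - (b - a)) ≤ T.map ((T.map ^ i) x) := by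
    linarith [hx.1, hx.2, hx'.1, hx'.2]
  rw [← Equiv.Perm.mul_apply, ← Equiv.Perm.mul_apply, ← pow_succ'] at hgap
  -- Below the top, the next level is an interval containing both images and is too short for the
  -- gap. At the top, both images lie within `ρ` of the base.
  rcases (Nat.succ_le_of_lt hi).lt_or_eq with hlt' | heq
  · have hm : ∀ y : T.Base, (y : ℝ) ∈ Ioo a b → (T.map ^ (i + 1)) y ∈ T.level a b (i + 1) :=
      fun y hy => ⟨y, hy, rfl⟩
    have hsub := (ht.interval (i + 1) hlt').out (hm x' hx') (hm x hx)
    have h6 := measure_mono (μ := T.leb) hsub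
    have h7 : Icc ((T.map ^ (i + 1)) x') ((T.map ^ (i + 1)) x) = Subtype.val ⁻¹'
      Icc ((T.map ^ (i + 1)) x' : ℝ) ((T.map ^ (i + 1)) x : ℝ) := rfl
    rw [ht.leb_level, h7, leb_preimage_of_subset, Real.volume_Icc,
      ENNReal.ofReal_le_ofReal_iff (by linarith [ht.lt])] at h6
    · linarith
    · exact Icc_subset_Ico_iff (by linarith [ht.lt]) |>.2
        ⟨((T.map ^ (i + 1)) x').2.1, ((T.map ^ (i + 1)) x).2.2⟩
  · rw [Nat.succ_eq_add_one] at heq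
    rw [heq] at hgap
    have hm : ∀ y : T.Base, (y : ℝ) ∈ Ioo a b → y ∈ T.tower a b h := by
      intro y hy
      simp only [tower, mem_iUnion, Finset.mem_range]
      exact ⟨0, by omega, y, hy, rfl⟩
    have h6 := abs_le.1 (hρ x (hm x hx))
    have h7 := abs_le.1 (hρ x' (hm x' hx'))
    linarith [hx.1, hx.2, hx'.1, hx'.2]

/-- Induction on the level: a translate of the base contained in one piece is translated by `T` as a
whole. -/
theorem exists_isTranslationTower (hT : T.IsSymmetric) {a b : ℝ} {h : ℕ} (ht : T.IsTower a b h)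
    {w ρ : ℝ} (hw : ∀ i, w ≤ T.len i) (hρ : ∀ x ∈ T.tower a b h, |((T.map ^ h) x : ℝ) - x| ≤ ρ)
    (hρ0 : 0 ≤ ρ) (hlw : (b - a) + ρ < w) :
    ∃ τ κ, T.IsTranslationTower a b h τ κ := by
  have hmid : (a + b) / 2 ∈ Ioo a b := ⟨by linarith [ht.lt], by linarith [ht.lt]⟩
  let x₀ : T.Base := ⟨(a + b) / 2, ht.subset hmid⟩
  have piece : ∀ i < h, ∀ t : ℝ,
      (∀ x : T.Base, (x : ℝ) ∈ Ioo a b → (((T.map ^ i) x : T.Base) : ℝ) = x + t) →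
      ∀ x : T.Base, (x : ℝ) ∈ Ioo a b →
        (x : ℝ) + t ∈ Ico (T.β (T.topIndex ((T.map ^ i) x₀)).castSucc)
          (T.β (T.topIndex ((T.map ^ i) x₀)).succ) := by
    intro i hi t hti x hx
    have h1 : T.topIndex ((T.map ^ i) x₀) = T.topIndex ((T.map ^ i) x) := le_antisymm
      (not_lt.1 (T.topIndex_level_eq hT ht hw hρ hρ0 hlw hi hti hx hmid))
      (not_lt.1 (T.topIndex_level_eq hT ht hw hρ hρ0 hlw hi hti hmid hx))
    rw [h1, ← hti x hx]
    exact T.topIndex_mem _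
  have trans : ∀ i ≤ h, ∃ t : ℝ, ∀ x : T.Base, (x : ℝ) ∈ Ioo a b →
      (((T.map ^ i) x : T.Base) : ℝ) = x + t := by
    intro i
    induction i with
    | zero => exact fun _ => ⟨0, fun x _ => by simp⟩
    | succ i ih =>
      intro hi
      obtain ⟨t, hti⟩ := ih (by omega)
      refine ⟨t + T.length - T.β (T.topIndex ((T.map ^ i) x₀)).castSucc -
        T.β (T.topIndex ((T.map ^ i) x₀)).succ, fun x hx => ?_⟩
      have h1 := piece i hi t hti x hx
      rw [← hti x hx] at h1
      rw [pow_succ', Equiv.Perm.mul_apply, T.map_coe_eq hT h1, hti x hx]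
      ring
  choose! τ hτ using trans
  refine ⟨τ, fun i => T.topIndex ((T.map ^ i) x₀), ht, hτ, fun i hi => ?_, fun i hi => ?_⟩
  -- Otherwise points of the open base close to its end would leave the piece; this is why the
  -- closed inequality holds for the endpoints.
  · by_contra! hc
    set β₀ := T.β (T.topIndex ((T.map ^ i) x₀)).castSucc
    obtain ⟨y, hy1, hy2⟩ := exists_between (lt_min ht.lt (by linarith : a < β₀ - τ i))
    have hy : y ∈ Ioo a b := ⟨hy1, hy2.trans_le (min_le_left _ _)⟩
    have h1 := (piece i hi (τ i) (hτ i hi.le) ⟨y, ht.subset hy⟩ hy).1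
    have h2 := hy2.trans_le (min_le_right _ _)
    simp only at h1
    linarith
  · by_contra! hc
    set β₀ := T.β (T.topIndex ((T.map ^ i) x₀)).succ
    obtain ⟨y, hy1, hy2⟩ := exists_between (max_lt ht.lt (by linarith : β₀ - τ i < b))
    have hy : y ∈ Ioo a b := ⟨(le_max_left _ _).trans_lt hy1, hy2⟩
    have h1 := (piece i hi (τ i) (hτ i hi.le) ⟨y, ht.subset hy⟩ hy).2
    have h2 := (le_max_right _ _).trans_lt hy1
    simp only at h1
    linarith

namespace IsTranslationTower

variable {T} {a b : ℝ} {h : ℕ} {τ : ℕ → ℝ} {κ : ℕ → Fin d} (ht : T.IsTranslationTower a b h τ κ)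
include ht

theorem exists_base_point {u : ℝ} (hu : u ∈ Ioo a b) : ∃ x : T.Base, (x : ℝ) = u :=
  ⟨⟨u, ht.isTower.subset hu⟩, rfl⟩

theorem level_eq {i : ℕ} (hi : i ≤ h) :
    T.level a b i = Subtype.val ⁻¹' Ioo (a + τ i) (b + τ i) := by
  ext y
  constructor
  · rintro ⟨x, hx, rfl⟩
    rw [mem_preimage, ht.map_pow i hi x hx]
    exact ⟨by linarith [hx.1], by linarith [hx.2]⟩
  · intro hy
    have hu : (y : ℝ) - τ i ∈ Ioo a b := ⟨by linarith [hy.1], by linarith [hy.2]⟩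
    refine ⟨⟨_, ht.isTower.subset hu⟩, hu, Subtype.ext ?_⟩
    rw [ht.map_pow i hi _ hu]
    simp

theorem le_abs_sub {i j : ℕ} (hi : i < h) (hj : j < h) (hij : i ≠ j) :
    b - a ≤ |τ i - τ j| := by
  by_contra! hc
  have h1 := abs_lt.1 hc
  -- The two base points are symmetric about the centre and chosen so that their images in levels
  -- `i` and `j` coincide.
  have hu : (a + b) / 2 - (τ i - τ j) / 2 ∈ Ioo a b := ⟨by linarith, by linarith⟩
  have hv : (a + b) / 2 + (τ i - τ j) / 2 ∈ Ioo a b := ⟨by linarith, by linarith⟩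
  have hu' : (T.map ^ i) ⟨_, ht.isTower.subset hu⟩ ∈ T.level a b i := ⟨_, hu, rfl⟩
  refine Set.disjoint_left.1 (ht.isTower.disjoint i hi j hj hij) hu'
    ⟨⟨_, ht.isTower.subset hv⟩, hv, ?_⟩
  apply Subtype.ext
  rw [ht.map_pow i hi.le _ hu, ht.map_pow j hj.le _ hv]
  simp only
  ring

end IsTranslationTower

/-! ### Good rigidity sequences -/

theorem length_pos_of_isTower {a b : ℝ} {h : ℕ} (ht : T.IsTower a b h) : 0 < T.length :=
  ht.nonneg.trans_lt (ht.lt.trans_le ht.le)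

theorem exists_pos_le_len (hL : 0 < T.length) : ∃ w > 0, ∀ i, w ≤ T.len i := by
  have : Nonempty (Fin d) := by
    rcases d with _ | d
    · have : T.length = 0 := T.zero
      exact absurd this hL.ne'
    · exact ⟨0⟩
  obtain ⟨i, hi⟩ := Finite.exists_min T.len
  exact ⟨T.len i, T.len_pos i, hi⟩

namespace IsGoodRigiditySeq

variable {T} {a b : ℕ → ℝ} {h : ℕ → ℕ} (hrig : T.IsGoodRigiditySeq a b h)
include hrig

/-- The disjoint levels give `h n * (b n - a n) ≤ |I|`, and `h n → ∞`. -/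
theorem tendsto_width : Tendsto (fun n => b n - a n) atTop (𝓝[>] 0) := by
  refine tendsto_nhdsWithin_iff.2 ⟨?_, Eventually.of_forall fun n =>
    sub_pos.2 (hrig.isTower n).lt⟩
  have h1 : Tendsto (fun n => T.length / (h n : ℝ)) atTop (𝓝 0) :=
    tendsto_const_nhds.div_atTop (tendsto_natCast_atTop_atTop.comp hrig.height)
  refine squeeze_zero' (Eventually.of_forall fun n => (sub_pos.2 (hrig.isTower n).lt).le) ?_ h1
  filter_upwards [hrig.height.eventually_gt_atTop 0] with n hn
  rw [le_div_iff₀ (by exact_mod_cast hn), mul_comm]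
  exact (hrig.isTower n).mul_le_length

theorem tendsto_log : Tendsto (fun n => Real.log (1 / (b n - a n))) atTop atTop := by
  simp_rw [one_div]
  exact Real.tendsto_log_atTop.comp (tendsto_inv_nhdsGT_zero.comp hrig.tendsto_width)

theorem tendsto_radius :
    Tendsto (fun n => 1 / ((1 / (b n - a n)) * Real.log (1 / (b n - a n)))) atTop (𝓝 0) := by
  have h1 : Tendsto (fun n => 1 / (b n - a n)) atTop atTop := by
    simp_rw [one_div]
    exact tendsto_inv_nhdsGT_zero.comp hrig.tendsto_width
  exact tendsto_const_nhds.div_atTop (h1.atTop_mul_atTop₀ hrig.tendsto_log)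

theorem eventually_isTranslationTower (hT : T.IsSymmetric) :
    ∀ᶠ n in atTop, ∃ τ κ, T.IsTranslationTower (a n) (b n) (h n) τ κ := by
  obtain ⟨w, hw, hlen⟩ := T.exists_pos_le_len (T.length_pos_of_isTower (hrig.isTower 0))
  have h1 := (hrig.tendsto_width.mono_right nhdsWithin_le_nhds).add hrig.tendsto_radius
  rw [add_zero] at h1
  filter_upwards [h1.eventually_lt_const hw, hrig.tendsto_log.eventually_gt_atTop 0] with n hn hl
  have := sub_pos.2 (hrig.isTower n).lt
  exact T.exists_isTranslationTower hT (hrig.isTower n) hlen (hrig.rigid n) (by positivity) hn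

theorem tendsto_leb_compl :
    Tendsto (fun n => T.leb (T.tower (a n) (b n) (h n))ᶜ) atTop (𝓝 0) := by
  have h1 : ∀ n, T.leb (T.tower (a n) (b n) (h n))ᶜ =
      ENNReal.ofReal T.length - T.leb (T.tower (a n) (b n) (h n)) := fun n => by
    rw [measure_compl (T.measurableSet_tower _ _ _) (measure_ne_top _ _), leb_univ]
  simp_rw [h1]
  have := ENNReal.Tendsto.sub (tendsto_const_nhds (x := ENNReal.ofReal T.length)) hrig.measure
    (Or.inl ENNReal.ofReal_ne_top)
  rwa [tsub_self] at this

end IsGoodRigiditySeq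

/-! ### Ergodicity of the interval exchange transformation -/

/-- `K` is approximated from inside by the levels in `S`, each carrying mass `θ` of `B`. What is
missed lies outside the tower or in the boundary set `E`. -/
theorem abs_measureReal_inter_sub_le {a b : ℝ} {h : ℕ} (ht : T.IsTower a b h) {B K E : Set T.Base}
    (hB : MeasurableSet B)
    {θ : ℝ} (hθ : ∀ i < h, T.leb.real (B ∩ T.level a b i) = θ) {S : Finset ℕ}
    (hS : S ⊆ Finset.range h) (hSK : ∀ i ∈ S, T.level a b i ⊆ K)
    (hE : ∀ i < h, i ∉ S → T.level a b i ∩ K ⊆ E) :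
    |T.leb.real (B ∩ K) - S.card * θ| ≤ T.leb.real (T.tower a b h)ᶜ + T.leb.real E := by
  have hsum : T.leb.real (⋃ i ∈ S, B ∩ T.level a b i) = S.card * θ := by
    rw [measureReal_biUnion_finset]
    · rw [Finset.sum_congr rfl fun i hi => hθ i (Finset.mem_range.1 (hS hi))]
      simp
    · exact fun i hi j hj hij => (ht.pairwiseDisjoint (hS hi) (hS hj) hij).mono
        inter_subset_right inter_subset_right
    · exact fun i _ => hB.inter (T.measurableSet_level a b i)
  have h1 : T.leb.real (⋃ i ∈ S, B ∩ T.level a b i) ≤ T.leb.real (B ∩ K) :=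
    measureReal_mono (iUnion₂_subset fun i hi => inter_subset_inter_right _ (hSK i hi))
  have h2 : T.leb.real (B ∩ K) ≤ T.leb.real (⋃ i ∈ S, B ∩ T.level a b i) +
      (T.leb.real (T.tower a b h)ᶜ + T.leb.real E) := by
    refine (measureReal_mono (μ := T.leb) (s₂ := (⋃ i ∈ S, B ∩ T.level a b i) ∪
      ((T.tower a b h)ᶜ ∪ E)) ?_).trans ((measureReal_union_le _ _).trans
        (add_le_add_right (measureReal_union_le _ _) _))
    rintro x ⟨hxB, hxK⟩
    by_cases hx : x ∈ T.tower a b h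
    · simp only [tower, mem_iUnion, Finset.mem_range] at hx
      obtain ⟨i, hi, hxi⟩ := hx
      by_cases hiS : i ∈ S
      · exact Or.inl (mem_biUnion hiS ⟨hxB, hxi⟩)
      · exact Or.inr (Or.inr (hE i hi hiS ⟨hxi, hxK⟩))
    · exact Or.inr (Or.inl hx)
  have h3 : 0 ≤ T.leb.real (T.tower a b h)ᶜ + T.leb.real E := by positivity
  rw [hsum] at h1 h2
  rw [abs_le]
  constructor <;> linarith

/-- An invariant `B` meets all levels in the same mass `θ`. Counting levels shows that `B` is
independent of every initial segment of `I`, hence of itself. -/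
theorem null_or_conull_of_isGoodRigiditySeq (hT : T.IsSymmetric) {a b : ℕ → ℝ} {h : ℕ → ℕ}
    (hrig : T.IsGoodRigiditySeq a b h) {B : Set T.Base} (hB : MeasurableSet B)
    (hinv : T.map ⁻¹' B =ᵐ[T.leb] B) : T.leb B = 0 ∨ T.leb Bᶜ = 0 := by
  have hpow : ∀ i : ℕ, (T.map ^ i) ⁻¹' B =ᵐ[T.leb] B := by
    intro i
    induction i with
    | zero => exact EventuallyEq.rfl
    | succ i ih =>
      have h1 := T.measurePreserving_map.quasiMeasurePreserving.preimage_ae_eq ih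
      exact h1.trans hinv
  have hlevel : ∀ n i, T.leb.real (B ∩ T.level (a n) (b n) i) =
      T.leb.real (B ∩ T.level (a n) (b n) 0) := by
    intro n i
    have h1 : (T.map ^ i) ⁻¹' (B ∩ T.level (a n) (b n) i) =ᵐ[T.leb]
        (B ∩ T.level (a n) (b n) 0 : Set T.Base) := by
      rw [preimage_inter, level, preimage_image_eq _ (T.map ^ i).injective]
      have h0 : T.level (a n) (b n) 0 = {x : T.Base | (x : ℝ) ∈ Ioo (a n) (b n)} := by
        simp [level]
      rw [h0]
      exact (hpow i).inter EventuallyEq.rfl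
    rw [← measureReal_congr h1, measureReal_def, measureReal_def,
      (T.measurePreserving_pow i).measure_preimage
        (hB.inter (T.measurableSet_level _ _ _)).nullMeasurableSet]
  have hL := T.length_pos_of_isTower (hrig.isTower 0)
  have huniv : T.leb.real univ = T.length := by
    rw [measureReal_def, leb_univ, ENNReal.toReal_ofReal hL.le]
  have key : ∀ y : T.Base, T.length * T.leb.real (B ∩ Iic y) =
      T.leb.real B * T.leb.real (Iic y) := by
    intro y
    have herr : Tendsto (fun n => 4 * T.length * (T.leb.real (T.tower (a n) (b n) (h n))ᶜ +
        (b n - a n))) atTop (𝓝 0) := by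
      have h1 := (ENNReal.tendsto_toReal ENNReal.zero_ne_top).comp hrig.tendsto_leb_compl
      have h2 := (h1.add (hrig.tendsto_width.mono_right nhdsWithin_le_nhds)).const_mul
        (4 * T.length)
      simpa [Measure.real, Function.comp_def] using h2
    have hle : ∀ᶠ n in atTop, |T.length * T.leb.real (B ∩ Iic y) -
        T.leb.real B * T.leb.real (Iic y)| ≤ 4 * T.length *
          (T.leb.real (T.tower (a n) (b n) (h n))ᶜ + (b n - a n)) := by
      filter_upwards [hrig.eventually_isTranslationTower hT] with n ⟨τ, κ, ht⟩
      classical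
      set e := T.leb.real (T.tower (a n) (b n) (h n))ᶜ + (b n - a n) with he
      set S := (Finset.range (h n)).filter fun i => T.level (a n) (b n) i ⊆ Iic y with hS
      -- A level meeting `Iic y` but not contained in it lies, inside `Iic y`, within one width of
      -- `y`.
      set E : Set T.Base := Subtype.val ⁻¹' (Icc ((y : ℝ) - (b n - a n)) y) with hE
      have hlt := sub_pos.2 ht.isTower.lt
      have hEle : T.leb.real E ≤ b n - a n := by
        have : T.leb E ≤ ENNReal.ofReal (b n - a n) := by
          rw [hE, leb_preimage]
          refine (measure_mono inter_subset_left).trans ?_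
          rw [Real.volume_Icc]
          exact ENNReal.ofReal_le_ofReal (by linarith)
        exact ENNReal.toReal_le_of_le_ofReal hlt.le this
      have hSK : ∀ i ∈ S, T.level (a n) (b n) i ⊆ Iic y := fun i hi =>
        (Finset.mem_filter.1 hi).2
      have hES : ∀ i < h n, i ∉ S → T.level (a n) (b n) i ∩ Iic y ⊆ E := by
        rintro i hi hiS x ⟨hx, hxy⟩
        have hne : ¬ T.level (a n) (b n) i ⊆ Iic y := fun hc =>
          hiS (Finset.mem_filter.2 ⟨Finset.mem_range.2 hi, hc⟩)
        obtain ⟨z, hz, hzy⟩ := Set.not_subset.1 hne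
        rw [ht.level_eq hi.le] at hx hz
        have h1 : (y : ℝ) < z := not_le.1 hzy
        exact ⟨by linarith [hx.1, hz.2], hxy⟩
      have hθ1 : ∀ i < h n, T.leb.real (univ ∩ T.level (a n) (b n) i) = b n - a n := by
        intro i _
        rw [univ_inter, measureReal_def, ht.isTower.leb_level, ENNReal.toReal_ofReal hlt.le]
      have A1 := T.abs_measureReal_inter_sub_le ht.isTower hB (fun i _ => hlevel n i)
        (Finset.filter_subset _ _) hSK hES
      have A2 := T.abs_measureReal_inter_sub_le ht.isTower MeasurableSet.univ hθ1
        (Finset.filter_subset _ _) hSK hES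
      have A3 := T.abs_measureReal_inter_sub_le (K := univ) (E := ∅) ht.isTower hB
        (fun i _ => hlevel n i) subset_rfl (fun _ _ => subset_univ _)
        (fun i hi hi' => absurd (Finset.mem_range.2 hi) hi')
      have A4 := T.abs_measureReal_inter_sub_le (K := univ) (E := ∅) ht.isTower MeasurableSet.univ
        hθ1 subset_rfl (fun _ _ => subset_univ _)
        (fun i hi hi' => absurd (Finset.mem_range.2 hi) hi')
      set θ := T.leb.real (B ∩ T.level (a n) (b n) 0)
      rw [inter_univ, measureReal_empty, Finset.card_range] at A3 A4
      rw [univ_inter] at A2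
      rw [huniv] at A4
      have hθ0 : 0 ≤ θ := measureReal_nonneg
      have hcard : (S.card : ℝ) ≤ h n := by
        have := Finset.card_le_card (Finset.filter_subset
          (fun i => T.level (a n) (b n) i ⊆ Iic y) (Finset.range (h n)))
        rw [Finset.card_range] at this
        exact_mod_cast this
      have hθl : θ ≤ b n - a n := by
        have h1 : T.leb.real (T.level (a n) (b n) 0) = b n - a n := by
          rw [measureReal_def, ht.isTower.leb_level, ENNReal.toReal_ofReal hlt.le]
        rw [← h1]
        exact measureReal_mono inter_subset_right
      have hBK0 : 0 ≤ T.leb.real (B ∩ Iic y) := measureReal_nonneg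
      have hBK : T.leb.real (B ∩ Iic y) ≤ T.length :=
        (measureReal_mono (subset_univ _)).trans_eq huniv
      have hBL : T.leb.real B ≤ T.length :=
        (measureReal_mono (subset_univ _)).trans_eq huniv
      have hB0 : 0 ≤ T.leb.real B := measureReal_nonneg
      have hhl := ht.isTower.mul_le_length
      have hSl : (S.card : ℝ) * (b n - a n) ≤ T.length :=
        (mul_le_mul_of_nonneg_right hcard hlt.le).trans hhl
      have hS0 : (0 : ℝ) ≤ S.card := by positivity
      have e1 : |T.leb.real (B ∩ Iic y) - S.card * θ| ≤ e := A1.trans (by linarith)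
      have e2 : |T.leb.real (Iic y) - S.card * (b n - a n)| ≤ e := A2.trans (by linarith)
      have e3 : |T.leb.real B - h n * θ| ≤ e := A3.trans (by linarith)
      have e4 : |T.length - h n * (b n - a n)| ≤ e := A4.trans (by linarith)
      -- The terms `h * (b - a) * card S * θ` cancel. Each of the four remaining differences is at
      -- most `e` and has a factor bounded by `|I|`.
      have hid : T.length * T.leb.real (B ∩ Iic y) - T.leb.real B * T.leb.real (Iic y) =
          (T.length - h n * (b n - a n)) * T.leb.real (B ∩ Iic y) +
          (h n * (b n - a n)) * (T.leb.real (B ∩ Iic y) - S.card * θ) -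
          ((T.leb.real B - h n * θ) * (S.card * (b n - a n)) +
          T.leb.real B * (T.leb.real (Iic y) - S.card * (b n - a n))) := by ring
      have hhl0 : 0 ≤ (h n : ℝ) * (b n - a n) := by positivity
      have hSl0 : 0 ≤ (S.card : ℝ) * (b n - a n) := by positivity
      have he0 : 0 ≤ e := (abs_nonneg _).trans e1
      rw [hid]
      refine (abs_sub _ _).trans ((add_le_add (abs_add_le _ _) (abs_add_le _ _)).trans ?_)
      simp only [abs_mul, abs_of_nonneg hBK0, abs_of_nonneg hhl0, abs_of_nonneg hSl0,
        abs_of_nonneg hB0]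
      have m1 := mul_le_mul e4 hBK hBK0 he0
      have m2 := mul_le_mul hhl e1 (abs_nonneg _) hL.le
      have m3 := mul_le_mul e3 hSl hSl0 he0
      have m4 := mul_le_mul hBL e2 (abs_nonneg _) hL.le
      linarith
    have h0 := ge_of_tendsto herr hle
    exact sub_eq_zero.1 (abs_eq_zero.1 (le_antisymm h0 (abs_nonneg _)))
  -- Finite measures agreeing on all `Iic y` are equal; evaluation at `B` then gives `|I| λ(B) =
  -- λ(B)²`.
  have hmeas : ENNReal.ofReal T.length • T.leb.restrict B = T.leb B • T.leb := by
    have : IsFiniteMeasure (ENNReal.ofReal T.length • T.leb.restrict B) :=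
      Measure.smul_finite _ ENNReal.ofReal_ne_top
    refine Measure.ext_of_Iic _ _ fun y => ?_
    rw [Measure.smul_apply, Measure.smul_apply, Measure.restrict_apply measurableSet_Iic,
      smul_eq_mul, smul_eq_mul, inter_comm]
    have h1 := congrArg ENNReal.ofReal (key y)
    rw [ENNReal.ofReal_mul hL.le, ENNReal.ofReal_mul measureReal_nonneg] at h1
    simpa [Measure.real] using h1
  have hfin := DFunLike.congr_fun hmeas B
  rw [Measure.smul_apply, Measure.smul_apply, Measure.restrict_apply hB, inter_self, smul_eq_mul,
    smul_eq_mul, ← leb_univ] at hfin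
  by_cases h0 : T.leb B = 0
  · exact Or.inl h0
  · right
    rw [mul_comm, ENNReal.mul_right_inj h0 (measure_ne_top _ _)] at hfin
    rw [measure_compl hB (measure_ne_top _ _), hfin, tsub_self]

end IET

namespace IET

variable {d : ℕ}

/-! ### Sums over separated families -/

/-- The pair (colour, index) determines `i`, so every index occurs at most `d` times. -/
theorem sum_le_card_mul_sum {h N : ℕ} {κ : ℕ → Fin d} {idx : ℕ → ℕ}
    (hinj : ∀ i < h, ∀ j < h, κ i = κ j → idx i = idx j → i = j) (hN : ∀ i < h, idx i ≤ N)
    {g Φ : ℕ → ℝ} (hΦ : ∀ j, 0 ≤ Φ j) (hg : ∀ i < h, g i ≤ Φ (idx i)) :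
    ∑ i ∈ Finset.range h, g i ≤ d * ∑ j ∈ Finset.range (N + 1), Φ j := by
  classical
  calc ∑ i ∈ Finset.range h, g i ≤ ∑ i ∈ Finset.range h, Φ (idx i) :=
        Finset.sum_le_sum fun i hi => hg i (Finset.mem_range.1 hi)
    _ = ∑ q ∈ (Finset.range h).image fun i => (κ i, idx i), Φ q.2 := by
        rw [Finset.sum_image]
        intro i hi j hj hij
        simp only [Prod.mk.injEq] at hij
        exact hinj i (by simpa using hi) j (by simpa using hj) hij.1 hij.2
    _ ≤ ∑ q ∈ (Finset.univ : Finset (Fin d)) ×ˢ Finset.range (N + 1), Φ q.2 := by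
        refine Finset.sum_le_sum_of_subset_of_nonneg ?_ fun q _ _ => hΦ q.2
        intro q hq
        obtain ⟨i, hi, rfl⟩ := Finset.mem_image.1 hq
        simp only [Finset.mem_product, Finset.mem_univ, true_and, Finset.mem_range]
        exact Nat.lt_succ_of_le (hN i (Finset.mem_range.1 hi))
    _ = d * ∑ j ∈ Finset.range (N + 1), Φ j := by
        rw [Finset.sum_product]
        simp

/-- The values `G i`, `i < h`, are nonnegative, at most `Λ`, and those with the same colour `κ i`
are at distance at least `l` from each other. -/
structure IsSeparated (h : ℕ) (κ : ℕ → Fin d) (l Λ : ℝ) (G : ℕ → ℝ) : Prop where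
  pos : 0 < l
  nonneg : ∀ i < h, 0 ≤ G i
  le : ∀ i < h, G i ≤ Λ
  sep : ∀ i < h, ∀ j < h, κ i = κ j → i ≠ j → l ≤ |G i - G j|

namespace IsSeparated

variable {h : ℕ} {κ : ℕ → Fin d} {l Λ : ℝ} {G : ℕ → ℝ} (hG : IsSeparated h κ l Λ G)
include hG

theorem mono {m : ℕ} (hm : m ≤ h) : IsSeparated m κ l Λ G :=
  ⟨hG.pos, fun i hi => hG.nonneg i (hi.trans_le hm), fun i hi => hG.le i (hi.trans_le hm),
    fun i hi j hj => hG.sep i (hi.trans_le hm) j (hj.trans_le hm)⟩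

/-- Two values in the same slot `[j l, (j + 1) l)` are less than `l` apart, so they cannot share a
colour. -/
theorem floor_inj : ∀ i < h, ∀ j < h, κ i = κ j → ⌊G i / l⌋₊ = ⌊G j / l⌋₊ → i = j := by
  intro i hi j hj hk hij
  by_contra hne
  have h1 := hG.sep i hi j hj hk hne
  have a1 := Nat.floor_le (div_nonneg (hG.nonneg i hi) hG.pos.le)
  have a2 := Nat.lt_floor_add_one (G i / l)
  have b1 := Nat.floor_le (div_nonneg (hG.nonneg j hj) hG.pos.le)
  have b2 := Nat.lt_floor_add_one (G j / l)
  rw [hij] at a1 a2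
  have h2 : |G i / l - G j / l| < 1 := by
    rw [abs_lt]; constructor <;> linarith
  rw [← sub_div, abs_div, abs_of_pos hG.pos, div_lt_one hG.pos] at h2
  linarith

theorem floor_le (i : ℕ) (hi : i < h) : ⌊G i / l⌋₊ ≤ ⌊Λ / l⌋₊ :=
  Nat.floor_le_floor (div_le_div_of_nonneg_right (hG.le i hi) hG.pos.le)

theorem floor_mul_le (i : ℕ) (hi : i < h) : (⌊G i / l⌋₊ : ℝ) * l ≤ G i :=
  (le_div_iff₀ hG.pos).1 (Nat.floor_le (div_nonneg (hG.nonneg i hi) hG.pos.le))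

/-- A value in slot `j ≥ 1` contributes at most `1 / (j l)`, which sums to a harmonic number; only
slot `0` needs the margin `v`. -/
theorem sum_inv_le (hΛ : l ≤ Λ) {v : ℝ} (hv : 0 < v) :
    ∑ i ∈ Finset.range h, 1 / (G i + v) ≤ d * (1 / v + 1 / l * (1 + Real.log (Λ / l))) := by
  have hl := hG.pos
  refine (sum_le_card_mul_sum (N := ⌊Λ / l⌋₊) (Φ := fun j => if j = 0 then 1 / v else 1 / l * (j : ℝ)⁻¹)
    hG.floor_inj hG.floor_le (fun j => ?_) fun i hi => ?_).trans ?_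
  · split_ifs <;> positivity
  · have h0 := hG.nonneg i hi
    split_ifs with h1
    · exact one_div_le_one_div_of_le hv (by linarith)
    · have h2 := hG.floor_mul_le i hi
      have h3 : (0 : ℝ) < ⌊G i / l⌋₊ := by exact_mod_cast Nat.pos_of_ne_zero h1
      rw [one_div_mul_eq_div, ← one_div, div_div]
      exact one_div_le_one_div_of_le (by positivity) (by linarith)
  · refine mul_le_mul_of_nonneg_left ?_ (Nat.cast_nonneg d)
    rw [Finset.sum_range_succ']
    have h1 : ∑ j ∈ Finset.range ⌊Λ / l⌋₊, (if j + 1 = 0 then 1 / v else 1 / l * ((j + 1 : ℕ) : ℝ)⁻¹)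
        = 1 / l * ((harmonic ⌊Λ / l⌋₊ : ℚ) : ℝ) := by
      rw [harmonic, Rat.cast_sum, Finset.mul_sum]
      refine Finset.sum_congr rfl fun j _ => ?_
      simp
    rw [h1, if_pos rfl, add_comm]
    gcongr
    exact harmonic_floor_le_one_add_log _ ((one_le_div hl).2 hΛ)

end IsSeparated

/-! ### The error of linearizing a logarithm -/

/-- The error of the linear approximation of `u ↦ log (G + u)` at `u₀`. -/
noncomputable def logErr (G u₀ u : ℝ) : ℝ :=
  Real.log (G + u) - Real.log (G + u₀) - (u - u₀) / (G + u₀)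

theorem abs_log_sub_log_le {x y v : ℝ} (hv : 0 < v) (hx : v ≤ x) (hy : v ≤ y) :
    |Real.log x - Real.log y| ≤ |x - y| / v := by
  have key : ∀ x y : ℝ, v ≤ x → v ≤ y → Real.log x - Real.log y ≤ |x - y| / v := by
    intro x y hx hy
    have hx0 := hv.trans_le hx
    have hy0 := hv.trans_le hy
    rw [← Real.log_div hx0.ne' hy0.ne']
    have h1 := Real.log_le_sub_one_of_pos (div_pos hx0 hy0)
    have h2 : x / y - 1 = (x - y) / y := by field_simp
    rw [h2] at h1
    refine h1.trans ((div_le_div_of_nonneg_right (le_abs_self _) hy0.le).trans ?_)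
    exact div_le_div_of_nonneg_left (abs_nonneg _) hv hy
  rw [abs_le]
  refine ⟨?_, key x y hx hy⟩
  have := key y x hy hx
  rw [abs_sub_comm] at this
  linarith

/-- Bound for the slot nearest the singularity: adding `G ≥ 0` to both terms brings the ratio `u /
u₀` closer to `1`, and the linear term is at most `1`. -/
theorem abs_logErr_le {G u₀ u : ℝ} (hG : 0 ≤ G) (hu₀ : 0 < u₀) (hu : 0 < u)
    (huu : |u - u₀| ≤ u₀) : |logErr G u₀ u| ≤ |Real.log (u / u₀)| + 1 := by
  have h1 : |(u - u₀) / (G + u₀)| ≤ 1 := by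
    rw [abs_div, abs_of_pos (by linarith : 0 < G + u₀), div_le_one (by linarith)]
    linarith
  have h2 : |Real.log (G + u) - Real.log (G + u₀)| ≤ |Real.log (u / u₀)| := by
    rw [← Real.log_div (by linarith) (by linarith)]
    rcases le_total u u₀ with h | h
    · have e1 : (G + u) / (G + u₀) ≤ 1 := (div_le_one (by linarith)).2 (by linarith)
      have e2 : u / u₀ ≤ (G + u) / (G + u₀) := by
        rw [div_le_div_iff₀ hu₀ (by linarith)]
        nlinarith
      have e3 : 0 < u / u₀ := by positivity
      rw [abs_of_nonpos (Real.log_nonpos (by linarith) e1),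
        abs_of_nonpos (Real.log_nonpos e3.le (e2.trans e1)), neg_le_neg_iff]
      exact Real.log_le_log e3 e2
    · have e1 : 1 ≤ (G + u) / (G + u₀) := (one_le_div (by linarith)).2 (by linarith)
      have e2 : (G + u) / (G + u₀) ≤ u / u₀ := by
        rw [div_le_div_iff₀ (by linarith) hu₀]
        nlinarith
      rw [abs_of_nonneg (Real.log_nonneg e1), abs_of_nonneg (Real.log_nonneg (e1.trans e2))]
      exact Real.log_le_log (by linarith) e2
  exact (abs_sub _ _).trans (add_le_add h2 h1)

/-- Away from the singularity the error is quadratic in the relative displacement `v`, which is at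
most `1 / (2 j)`. -/
theorem abs_logErr_le_sq {G u₀ u : ℝ} {j : ℝ} (hj : 1 ≤ j) (hG : j * (2 * u₀) ≤ G) (hu₀ : 0 < u₀)
    (huu : |u - u₀| ≤ u₀) : |logErr G u₀ u| ≤ (j ^ 2)⁻¹ := by
  set v := (u - u₀) / (G + u₀) with hv
  have hGu : 2 * j * u₀ < G + u₀ := by linarith
  have hjpos : 0 < 2 * j * u₀ := by positivity
  have hv1 : |v| ≤ 1 / (2 * j) := by
    rw [hv, abs_div, abs_of_pos (hjpos.trans hGu), div_le_div_iff₀ (hjpos.trans hGu) (by positivity)]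
    nlinarith
  have hv2 : (1 : ℝ) / (2 * j) ≤ 1 / 2 := one_div_le_one_div_of_le (by norm_num) (by linarith)
  have hv3 := abs_le.1 (hv1.trans hv2)
  have h1 : logErr G u₀ u = Real.log (1 + v) - v := by
    have e1 : 1 + v = (G + u) / (G + u₀) := by
      rw [hv]
      have : G + u₀ ≠ 0 := by linarith
      field_simp
      ring
    have e2 : 0 < G + u := by
      have := abs_le.1 huu
      nlinarith
    rw [logErr, e1, Real.log_div e2.ne' (by linarith)]
  have hpos : 0 < 1 + v := by linarith [hv3.1]
  have h2 := Real.log_le_sub_one_of_pos hpos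
  have h3 := Real.one_sub_inv_le_log_of_pos hpos
  -- For `|v| ≤ 1/2` this yields `v - 2 v² ≤ log (1 + v) ≤ v`.
  have h4 : v - 2 * v ^ 2 ≤ 1 - (1 + v)⁻¹ := by
    have e1 : 1 - (1 + v)⁻¹ = v / (1 + v) := by field_simp; ring
    rw [e1, le_div_iff₀ hpos]
    nlinarith [sq_nonneg v, hv3.1]
  have h5 : v ^ 2 ≤ (1 / (2 * j)) ^ 2 := by
    rw [← sq_abs]
    exact pow_le_pow_left₀ (abs_nonneg v) hv1 2
  have h6 : 2 * (1 / (2 * j)) ^ 2 = (j ^ 2)⁻¹ / 2 := by field_simp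
  have h7 : 0 < (j ^ 2)⁻¹ := by positivity
  rw [h1, abs_le]
  constructor <;> linarith

/-- Taking `u₀ = l / 2`, slot `0` gives `|log| + 1` and the others give `∑ 1 / j² ≤ 2`. No logarithm
of `Λ / l` appears, unlike in `sum_inv_le`. -/
theorem IsSeparated.sum_abs_logErr_le {h : ℕ} {κ : ℕ → Fin d} {l Λ : ℝ} {G : ℕ → ℝ}
    (hG : IsSeparated h κ l Λ G) {u : ℝ} (hu : 0 < u) (huu : |u - l / 2| ≤ l / 2) :
    ∑ i ∈ Finset.range h, |logErr (G i) (l / 2) u| ≤ d * (|Real.log (u / (l / 2))| + 3) := by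
  have hl := hG.pos
  refine (sum_le_card_mul_sum (N := ⌊Λ / l⌋₊)
    (Φ := fun j => if j = 0 then |Real.log (u / (l / 2))| + 1 else ((j : ℝ) ^ 2)⁻¹)
    hG.floor_inj hG.floor_le (fun j => ?_) fun i hi => ?_).trans ?_
  · split_ifs <;> positivity
  · split_ifs with h1
    · exact abs_logErr_le (hG.nonneg i hi) (by positivity) hu huu
    · refine abs_logErr_le_sq (by exact_mod_cast Nat.one_le_iff_ne_zero.2 h1) ?_ (by positivity) huu
      have := hG.floor_mul_le i hi
      linarith
  · refine mul_le_mul_of_nonneg_left ?_ (Nat.cast_nonneg d)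
    rw [Finset.sum_range_succ', if_pos rfl]
    have h1 : ∑ j ∈ Finset.range ⌊Λ / l⌋₊, (if j + 1 = 0 then |Real.log (u / (l / 2))| + 1
        else (((j + 1 : ℕ) : ℝ) ^ 2)⁻¹) = ∑ j ∈ Finset.Ioo 0 (⌊Λ / l⌋₊ + 1), ((j : ℝ) ^ 2)⁻¹ := by
      rw [show Finset.Ioo 0 (⌊Λ / l⌋₊ + 1) = Finset.Ico (0 + 1) (⌊Λ / l⌋₊ + 1) by
        ext; simp [Nat.succ_le_iff], ← Finset.sum_Ico_add', Nat.Ico_zero_eq_range]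
      refine Finset.sum_congr rfl fun j _ => ?_
      simp
    have h2 := sum_Ioo_inv_sq_le (α := ℝ) 0 (⌊Λ / l⌋₊ + 1)
    rw [h1]
    norm_num at h2
    linarith

end IET

namespace IET

variable {d : ℕ} (T : IET d)

/-! ### Birkhoff sums of the logarithmic part along a tower -/

/-- `p` is given on the interior of the `k`-th piece by the symmetric logarithmic formula with
coefficient `C k ∈ [0, D]`. -/
structure IsLogOn (p : ℝ → ℝ) (C : Fin d → ℝ) (D : ℝ) : Prop where
  eq : ∀ k, ∀ x ∈ Ioo (T.β k.castSucc) (T.β k.succ),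
    p x = -(C k) * Real.log (x - T.β k.castSucc) - C k * Real.log (T.β k.succ - x)
  nonneg : ∀ k, 0 ≤ C k
  le : ∀ k, C k ≤ D

theorem β_nonneg (k : Fin (d + 1)) : 0 ≤ T.β k := by
  rw [← T.zero]
  exact T.strictMono.monotone (Fin.zero_le _)

theorem β_le (k : Fin (d + 1)) : T.β k ≤ T.length :=
  T.strictMono.monotone (Fin.le_last _)

theorem piece_subset (k : Fin d) : Ioo (T.β k.castSucc) (T.β k.succ) ⊆ Ico 0 T.length :=
  Ioo_subset_Ico_self.trans (T.top_subset k)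

theorem IsPureSymLog.exists_isLogOn {p : ℝ → ℝ} (hp : T.IsPureSymLog p) :
    ∃ C D, 0 ≤ D ∧ T.IsLogOn p C D := by
  obtain ⟨C, hC, -, hp⟩ := hp
  refine ⟨C, ∑ k, C k, Finset.sum_nonneg fun k _ => hC k, fun k x hx => ?_, hC,
    fun k => Finset.single_le_sum (fun k _ => hC k) (Finset.mem_univ k)⟩
  rw [hp x (T.piece_subset k hx), Finset.sum_eq_single k]
  · rw [indicator_of_mem hx]
  · intro j _ hj
    refine indicator_of_notMem (fun hxj => hj ?_) _
    have h1 := T.topIndex_eq (x := ⟨x, T.piece_subset k hx⟩) (Ioo_subset_Ico_self hx)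
    have h2 := T.topIndex_eq (x := ⟨x, T.piece_subset k hx⟩) (Ioo_subset_Ico_self hxj)
    exact h2.symm.trans h1
  · simp

namespace IsTranslationTower

variable {T} {a b : ℝ} {h : ℕ} {τ : ℕ → ℝ} {κ : ℕ → Fin d} (ht : T.IsTranslationTower a b h τ κ)
include ht

theorem width_pos : 0 < b - a := sub_pos.2 ht.isTower.lt

theorem mem_piece {x : T.Base} (hx : (x : ℝ) ∈ Ioo a b) {i : ℕ} (hi : i < h) :
    (((T.map ^ i) x : T.Base) : ℝ) ∈ Ioo (T.β (κ i).castSucc) (T.β (κ i).succ) := by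
  rw [ht.map_pow i hi.le x hx]
  exact ⟨by linarith [hx.1, ht.left i hi], by linarith [hx.2, ht.right i hi]⟩

/-- Within one piece the endpoint is common, so distances to it differ by the offsets `τ i - τ j`,
at least one width for disjoint levels. -/
theorem isSeparated_left :
    IsSeparated h κ (b - a) T.length fun i => a + τ i - T.β (κ i).castSucc where
  pos := ht.width_pos
  nonneg i hi := sub_nonneg.2 (ht.left i hi)
  le i hi := by
    have h1 := ht.right i hi
    have h2 := T.β_le (κ i).succ
    have h3 := T.β_nonneg (κ i).castSucc
    linarith [ht.width_pos]
  sep i hi j hj hk hij := by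
    have := ht.le_abs_sub hi hj hij
    rw [hk]
    convert this using 2
    ring

theorem isSeparated_right :
    IsSeparated h κ (b - a) T.length fun i => T.β (κ i).succ - (b + τ i) where
  pos := ht.width_pos
  nonneg i hi := sub_nonneg.2 (ht.right i hi)
  le i hi := by
    have h1 := ht.left i hi
    have h2 := T.β_le (κ i).succ
    have h3 := T.β_nonneg (κ i).castSucc
    linarith [ht.width_pos]
  sep i hi j hj hk hij := by
    have := ht.le_abs_sub hi hj hij
    rw [hk, abs_sub_comm]
    convert this using 2
    ring

theorem width_le_length : b - a ≤ T.length := by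
  linarith [ht.isTower.nonneg, ht.isTower.le]

variable {p : ℝ → ℝ} {C : Fin d → ℝ} {D : ℝ} (hp : T.IsLogOn p C D)
include hp

theorem apply_map_pow {x : T.Base} (hx : (x : ℝ) ∈ Ioo a b) {i : ℕ} (hi : i < h) :
    p ((T.map ^ i) x) =
      -(C (κ i)) * Real.log (a + τ i - T.β (κ i).castSucc + (x - a)) -
        C (κ i) * Real.log (T.β (κ i).succ - (b + τ i) + (b - x)) := by
  rw [hp.eq _ _ (ht.mem_piece hx hi), ht.map_pow i hi.le x hx]
  congr 3 <;> ring_nf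

/-- A Lipschitz estimate at distance `v` from the ends of the base: the derivatives of the
logarithms are reciprocals of separated distances. -/
theorem abs_birkhoff_sub_le {x y : T.Base} (hx : (x : ℝ) ∈ Ioo a b) (hy : (y : ℝ) ∈ Ioo a b)
    {v : ℝ} (hv : 0 < v) (hxa : a + v ≤ x) (hxb : x ≤ b - v) (hya : a + v ≤ y) (hyb : y ≤ b - v)
    {m : ℕ} (hm : m ≤ h) :
    |T.birkhoff p m x - T.birkhoff p m y| ≤ 2 * D * |(x : ℝ) - y| *
      (d * (1 / v + 1 / (b - a) * (1 + Real.log (T.length / (b - a))))) := by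
  have hterm : ∀ i ∈ Finset.range m, |p ((T.map ^ i) x) - p ((T.map ^ i) y)| ≤
      D * |(x : ℝ) - y| * (1 / (a + τ i - T.β (κ i).castSucc + v)) +
        D * |(x : ℝ) - y| * (1 / (T.β (κ i).succ - (b + τ i) + v)) := by
    intro i hi
    have hih : i < h := (Finset.mem_range.1 hi).trans_le hm
    rw [ht.apply_map_pow hp hx hih, ht.apply_map_pow hp hy hih]
    have e1 := ht.isSeparated_left.nonneg i hih
    have e2 := ht.isSeparated_right.nonneg i hih
    set G := a + τ i - T.β (κ i).castSucc
    set G' := T.β (κ i).succ - (b + τ i)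
    have h1 := abs_log_sub_log_le (x := G + (x - a)) (y := G + (y - a)) (v := G + v)
      (by linarith) (by linarith) (by linarith)
    have h2 := abs_log_sub_log_le (x := G' + (b - x)) (y := G' + (b - y)) (v := G' + v)
      (by linarith) (by linarith) (by linarith)
    have h3 : G + (x - a) - (G + (y - a)) = x - y := by ring
    have h4 : |G' + (b - x) - (G' + (b - y))| = |(x : ℝ) - y| := by
      rw [← abs_neg]; congr 1; ring
    rw [h3] at h1
    rw [h4] at h2
    have h5 : -C (κ i) * Real.log (G + (x - a)) - C (κ i) * Real.log (G' + (b - x)) -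
        (-C (κ i) * Real.log (G + (y - a)) - C (κ i) * Real.log (G' + (b - y))) =
        -(C (κ i) * (Real.log (G + (x - a)) - Real.log (G + (y - a)))) -
          C (κ i) * (Real.log (G' + (b - x)) - Real.log (G' + (b - y))) := by ring
    rw [h5]
    refine (abs_sub _ _).trans (add_le_add ?_ ?_)
    · rw [abs_neg, abs_mul, abs_of_nonneg (hp.nonneg _), mul_assoc, mul_one_div]
      exact mul_le_mul (hp.le _) h1 (abs_nonneg _) ((hp.nonneg (κ i)).trans (hp.le (κ i)))
    · rw [abs_mul, abs_of_nonneg (hp.nonneg _), mul_assoc, mul_one_div]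
      exact mul_le_mul (hp.le _) h2 (abs_nonneg _) ((hp.nonneg (κ i)).trans (hp.le (κ i)))
  -- `κ 0` only supplies some piece, whose coefficient lies between `0` and `D`.
  have hD : 0 ≤ D := (hp.nonneg _).trans (hp.le (κ 0))
  rw [birkhoff_natCast, birkhoff_natCast, ← Finset.sum_sub_distrib]
  refine (Finset.abs_sum_le_sum_abs _ _).trans ((Finset.sum_le_sum hterm).trans ?_)
  rw [Finset.sum_add_distrib, ← Finset.mul_sum, ← Finset.mul_sum]
  have s1 := (ht.isSeparated_left.mono hm).sum_inv_le ht.width_le_length hv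
  have s2 := (ht.isSeparated_right.mono hm).sum_inv_le ht.width_le_length hv
  have hnn : 0 ≤ D * |(x : ℝ) - y| := by positivity
  have m1 := mul_le_mul_of_nonneg_left s1 hnn
  have m2 := mul_le_mul_of_nonneg_left s2 hnn
  linarith

/-- The slope is the sum of the derivatives at the centre. It may be as large as `l⁻¹ log(1/l)`, but
the second order errors are summable; the constant `6` is `3` from each side. -/
theorem exists_slope : ∃ σ : ℝ, ∀ x x₀ : T.Base, (x : ℝ) ∈ Ioo a b → (x₀ : ℝ) = (a + b) / 2 →
    |T.birkhoff p h x - T.birkhoff p h x₀ - σ * (x - x₀)| ≤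
      D * d * (|Real.log ((x - a) / ((b - a) / 2))| + |Real.log ((b - x) / ((b - a) / 2))| + 6) := by
  set G := fun i => a + τ i - T.β (κ i).castSucc with hG
  set G' := fun i => T.β (κ i).succ - (b + τ i) with hG'
  have hw := ht.width_pos
  refine ⟨∑ i ∈ Finset.range h, (-C (κ i) / (G i + (b - a) / 2) + C (κ i) / (G' i + (b - a) / 2)),
    fun x x₀ hx hx₀ => ?_⟩
  have hx₀' : (x₀ : ℝ) ∈ Ioo a b := by rw [hx₀]; constructor <;> linarith
  have hterm : ∀ i ∈ Finset.range h, p ((T.map ^ i) x) - p ((T.map ^ i) x₀) -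
      (-C (κ i) / (G i + (b - a) / 2) + C (κ i) / (G' i + (b - a) / 2)) * (x - x₀) =
      -(C (κ i) * logErr (G i) ((b - a) / 2) (x - a)) -
        C (κ i) * logErr (G' i) ((b - a) / 2) (b - x) := by
    intro i hi
    have hih : i < h := Finset.mem_range.1 hi
    rw [ht.apply_map_pow hp hx hih, ht.apply_map_pow hp hx₀' hih, logErr, logErr, hx₀]
    simp only [hG, hG']
    have e1 : (a + b) / 2 - a = (b - a) / 2 := by ring
    have e2 : b - (a + b) / 2 = (b - a) / 2 := by ring
    rw [e1, e2]
    ring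
  have hu : |(x - a : ℝ) - (b - a) / 2| ≤ (b - a) / 2 := by
    rw [abs_le]; constructor <;> linarith [hx.1, hx.2]
  have hu' : |(b - x : ℝ) - (b - a) / 2| ≤ (b - a) / 2 := by
    rw [abs_le]; constructor <;> linarith [hx.1, hx.2]
  have hD : 0 ≤ D := (hp.nonneg _).trans (hp.le (κ 0))
  rw [birkhoff_natCast, birkhoff_natCast, Finset.sum_mul, ← Finset.sum_sub_distrib,
    ← Finset.sum_sub_distrib, Finset.sum_congr rfl hterm]
  have hbound : ∀ i ∈ Finset.range h, |-(C (κ i) * logErr (G i) ((b - a) / 2) (x - a)) -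
        C (κ i) * logErr (G' i) ((b - a) / 2) (b - x)| ≤
      D * |logErr (G i) ((b - a) / 2) (x - a)| + D * |logErr (G' i) ((b - a) / 2) (b - x)| := by
    intro i _
    refine (abs_sub _ _).trans ?_
    rw [abs_neg, abs_mul, abs_mul, abs_of_nonneg (hp.nonneg _)]
    gcongr <;> exact hp.le _
  refine (Finset.abs_sum_le_sum_abs _ _).trans ((Finset.sum_le_sum hbound).trans ?_)
  rw [Finset.sum_add_distrib, ← Finset.mul_sum, ← Finset.mul_sum]
  have s1 := ht.isSeparated_left.sum_abs_logErr_le (u := x - a) (by linarith [hx.1]) hu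
  have s2 := ht.isSeparated_right.sum_abs_logErr_le (u := b - x) (by linarith [hx.2]) hu'
  have m1 := mul_le_mul_of_nonneg_left s1 hD
  have m2 := mul_le_mul_of_nonneg_left s2 hD
  linarith

omit hp

/-- A tower over a smaller base. -/
theorem mono {a' b' : ℝ} (ha : a ≤ a') (hab : a' < b') (hb : b' ≤ b) :
    T.IsTranslationTower a' b' h τ κ := by
  have hsub : Ioo a' b' ⊆ Ioo a b := Ioo_subset_Ioo ha hb
  have hl : ∀ i, T.level a' b' i ⊆ T.level a b i := fun i =>
    image_mono fun x hx => hsub hx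
  refine ⟨⟨ht.isTower.nonneg.trans ha, hab, hb.trans ht.isTower.le, fun i hi => ?_,
    fun i hi j hj hij => (ht.isTower.disjoint i hi j hj hij).mono (hl i) (hl j)⟩,
    fun i hi x hx => ht.map_pow i hi x (hsub hx), fun i hi => ?_, fun i hi => ?_⟩
  · have : T.level a' b' i = Subtype.val ⁻¹' Ioo (a' + τ i) (b' + τ i) := by
      ext y
      constructor
      · rintro ⟨x, hx, rfl⟩
        rw [mem_preimage, ht.map_pow i hi.le x (hsub hx)]
        exact ⟨by linarith [hx.1], by linarith [hx.2]⟩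
      · intro hy
        have hu : (y : ℝ) - τ i ∈ Ioo a' b' := ⟨by linarith [hy.1], by linarith [hy.2]⟩
        refine ⟨⟨_, ht.isTower.subset (hsub hu)⟩, hu, Subtype.ext ?_⟩
        rw [ht.map_pow i hi.le _ (hsub hu)]
        simp
    rw [this]
    exact ordConnected_Ioo.preimage_mono fun _ _ h => h
  · linarith [ht.left i hi]
  · linarith [ht.right i hi]

theorem leb_tower_real :
    T.leb.real (T.tower a b h) = h * (b - a) := by
  rw [measureReal_def, ht.isTower.leb_tower, ENNReal.toReal_mul, ENNReal.toReal_natCast,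
    ENNReal.toReal_ofReal ht.width_pos.le]

end IsTranslationTower

/-! ### Bounded variation -/

/-- `P` is the variation accumulated from the least point of `s`. -/
theorem exists_abs_sub_le_sub {g : ℝ → ℝ} {s : Set ℝ} (hg : BoundedVariationOn g s)
    {x₀ : ℝ} (hx₀ : x₀ ∈ s) (hmin : ∀ x ∈ s, x₀ ≤ x) :
    ∃ (P : ℝ → ℝ) (V : ℝ), (∀ x ∈ s, P x ∈ Icc 0 V) ∧ MonotoneOn P s ∧
      ∀ x ∈ s, ∀ y ∈ s, x ≤ y → |g x - g y| ≤ P y - P x := by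
  have hl := hg.locallyBoundedVariationOn
  refine ⟨variationOnFromTo g s x₀, (eVariationOn g s).toReal, fun x hx => ?_,
    variationOnFromTo.monotoneOn hl hx₀, fun x hx y hy hxy => ?_⟩
  · rw [variationOnFromTo.eq_of_le g s (hmin x hx)]
    exact ⟨ENNReal.toReal_nonneg, ENNReal.toReal_mono hg (eVariationOn.mono _ inter_subset_left)⟩
  · have h1 := variationOnFromTo.add hl hx₀ hx hy
    have h2 : variationOnFromTo g s x₀ y - variationOnFromTo g s x₀ x =
        variationOnFromTo g s x y := by linarith
    rw [h2, variationOnFromTo.eq_of_le g s hxy, ← Real.dist_eq, dist_edist]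
    refine ENNReal.toReal_mono (hl x y hx hy) ?_
    exact eVariationOn.edist_le _ ⟨hx, ⟨le_rfl, hxy⟩⟩ ⟨hy, ⟨hxy, le_rfl⟩⟩

theorem sum_sub_le_of_pairwiseDisjoint {ι : Type*} {S : Finset ι} {u v : ι → ℝ} {V : ℝ}
    (huv : ∀ i ∈ S, u i ≤ v i) (hu : ∀ i ∈ S, 0 ≤ u i) (hv : ∀ i ∈ S, v i ≤ V) (hV : 0 ≤ V)
    (hd : (S : Set ι).PairwiseDisjoint fun i => Ioo (u i) (v i)) :
    ∑ i ∈ S, (v i - u i) ≤ V := by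
  have h1 : volume (⋃ i ∈ S, Ioo (u i) (v i)) ≤ volume (Icc 0 V) :=
    measure_mono (iUnion₂_subset fun i hi x hx =>
      ⟨(hu i hi).trans hx.1.le, hx.2.le.trans (hv i hi)⟩)
  rw [measure_biUnion_finset hd fun _ _ => measurableSet_Ioo, Real.volume_Icc, sub_zero] at h1
  simp only [Real.volume_Ioo] at h1
  rw [← ENNReal.ofReal_sum_of_nonneg fun i hi => sub_nonneg.2 (huv i hi)] at h1
  exact (ENNReal.ofReal_le_ofReal_iff hV).1 h1

/-- Denjoy–Koksma argument: the segments from `T^i x` to `T^i y` lie in different levels, so the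
monotone function `P` maps them to disjoint intervals of `[0, V]`. -/
theorem exists_abs_birkhoff_sub_le_of_boundedVariationOn (hL : 0 < T.length) {g : ℝ → ℝ}
    (hg : BoundedVariationOn g (Ico 0 T.length)) :
    ∃ V : ℝ, 0 ≤ V ∧ ∀ (a b : ℝ) (h : ℕ) (τ : ℕ → ℝ) (κ : ℕ → Fin d),
      T.IsTranslationTower a b h τ κ → ∀ m ≤ h, ∀ x y : T.Base, (x : ℝ) ∈ Ioo a b →
        (y : ℝ) ∈ Ioo a b → |T.birkhoff g m x - T.birkhoff g m y| ≤ V := by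
  have h0 : (0 : ℝ) ∈ Ico 0 T.length := ⟨le_rfl, hL⟩
  obtain ⟨P, V, hPV, hP, hgP⟩ := exists_abs_sub_le_sub hg h0 fun x hx => hx.1
  have hV : 0 ≤ V := (hPV 0 h0).1.trans (hPV 0 h0).2
  refine ⟨V, hV, fun a b h τ κ ht m hm => ?_⟩
  have key : ∀ x y : T.Base, (x : ℝ) ∈ Ioo a b → (y : ℝ) ∈ Ioo a b → (x : ℝ) ≤ y →
      |T.birkhoff g m x - T.birkhoff g m y| ≤ V := by
    intro x y hx hy hxy
    have hle : ∀ i < m, ((T.map ^ i) x : ℝ) ≤ (T.map ^ i) y := fun i hi => by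
      rw [ht.map_pow i (hi.le.trans hm) x hx, ht.map_pow i (hi.le.trans hm) y hy]
      linarith
    rw [birkhoff_natCast, birkhoff_natCast, ← Finset.sum_sub_distrib]
    refine (Finset.abs_sum_le_sum_abs _ _).trans ((Finset.sum_le_sum fun i hi =>
      hgP _ ((T.map ^ i) x).2 _ ((T.map ^ i) y).2 (hle i (Finset.mem_range.1 hi))).trans ?_)
    refine sum_sub_le_of_pairwiseDisjoint (fun i hi => hP ((T.map ^ i) x).2 ((T.map ^ i) y).2
      (hle i (Finset.mem_range.1 hi))) (fun i _ => (hPV _ ((T.map ^ i) x).2).1)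
      (fun i _ => (hPV _ ((T.map ^ i) y).2).2) hV ?_
    intro i hi j hj hij
    have hi' : i < h := (Finset.mem_range.1 (Finset.mem_coe.1 hi)).trans_le hm
    have hj' : j < h := (Finset.mem_range.1 (Finset.mem_coe.1 hj)).trans_le hm
    have hsep := ht.le_abs_sub hi' hj' hij
    have hcase : ((T.map ^ i) y : ℝ) ≤ (T.map ^ j) x ∨ ((T.map ^ j) y : ℝ) ≤ (T.map ^ i) x := by
      rw [ht.map_pow i hi'.le x hx, ht.map_pow i hi'.le y hy, ht.map_pow j hj'.le x hx,
        ht.map_pow j hj'.le y hy]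
      rcases le_abs.1 hsep with h1 | h1
      · right; linarith [hx.1, hy.2]
      · left; linarith [hx.1, hy.2]
    rw [Function.onFun, Set.disjoint_left]
    intro z hz hz'
    rcases hcase with h1 | h1
    · have := hP ((T.map ^ i) y).2 ((T.map ^ j) x).2 h1
      linarith [hz.2, hz'.1]
    · have := hP ((T.map ^ j) y).2 ((T.map ^ i) x).2 h1
      linarith [hz.1, hz'.2]
  intro x y hx hy
  rcases le_total (x : ℝ) y with hxy | hxy
  · exact key x y hx hy hxy
  · rw [abs_sub_comm]
    exact key y x hy hx hxy

theorem measurable_of_isLogPart {p f : ℝ → ℝ} (hpf : T.IsLogPart p f) :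
    Measurable fun x : T.Base => f x := by
  obtain ⟨⟨C, -, -, hp⟩, hg⟩ := hpf
  have h1 : Measurable fun x : T.Base => p x := by
    have : (fun x : T.Base => p x) = fun x : T.Base => ∑ i : Fin d,
        (Ioo (T.β i.castSucc) (T.β i.succ)).indicator (fun y => -(C i) *
          Real.log (y - T.β i.castSucc) - C i * Real.log (T.β i.succ - y)) (x : ℝ) :=
      funext fun x => hp x x.2
    rw [this]
    refine Finset.measurable_fun_sum _ fun i _ => Measurable.comp (Measurable.indicator ?_
      measurableSet_Ioo) measurable_subtype_coe
    fun_prop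
  obtain ⟨P, Q, hP, hQ, hPQ⟩ := hg.locallyBoundedVariationOn.exists_monotoneOn_sub_monotoneOn
  have h2 : ∀ P : ℝ → ℝ, MonotoneOn P (Ico 0 T.length) → Measurable fun x : T.Base => P x :=
    fun P hP => Monotone.measurable fun x y hxy => hP x.2 y.2 hxy
  have h3 : (fun x : T.Base => f x) = fun x : T.Base => p x + (P x - Q x) := by
    funext x
    have := congrFun hPQ x
    simp only [Pi.sub_apply] at this
    linarith
  rw [h3]
  exact h1.add ((h2 P hP).sub (h2 Q hQ))

end IET

namespace IET

variable {d : ℕ} (T : IET d)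

/-! ### The symmetry `x ↦ |I| - x` -/

/-- Equal coefficients at the two ends make `p` even about the centre of each piece. -/
theorem IsLogOn.reflect {T : IET d} {p : ℝ → ℝ} {C : Fin d → ℝ} {D : ℝ} (hp : T.IsLogOn p C D)
    {k : Fin d} {x y : ℝ} (hx : x ∈ Ioo (T.β k.castSucc) (T.β k.succ))
    (hxy : x + y = T.β k.castSucc + T.β k.succ) : p x = p y := by
  have hy : y ∈ Ioo (T.β k.castSucc) (T.β k.succ) :=
    ⟨by linarith [hx.2], by linarith [hx.1]⟩
  rw [hp.eq k x hx, hp.eq k y hy]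
  have h1 : T.β k.succ - y = x - T.β k.castSucc := by linarith
  have h2 : y - T.β k.castSucc = T.β k.succ - x := by linarith
  rw [h1, h2]
  ring

/-- If `T u + v = |I|` with `u` inside a piece, then `v` is the mirror image of `u` in that piece.
So the orbit of `z` is the reversed orbit of `x`, reflected piece by piece, and passes through the
same values of `p`. -/
theorem birkhoff_reflect (hT : T.IsSymmetric) {p : ℝ → ℝ} {C : Fin d → ℝ} {D : ℝ}
    (hp : T.IsLogOn p C D) {h : ℕ} {x z : T.Base} (hxz : ((T.map ^ h) x : ℝ) + z = T.length)
    (hx : ∀ i < h, ∃ k : Fin d, ((T.map ^ i) x : ℝ) ∈ Ioo (T.β k.castSucc) (T.β k.succ)) :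
    T.birkhoff p h z = T.birkhoff p h x := by
  have step : ∀ i < h, ((T.map ^ i) z : ℝ) + (T.map ^ (h - i)) x = T.length →
      ((T.map ^ (i + 1)) z : ℝ) + (T.map ^ (h - (i + 1))) x = T.length ∧
        p ((T.map ^ i) z) = p ((T.map ^ (h - (i + 1))) x) := by
    intro i hi hsum
    obtain ⟨k, hk⟩ := hx (h - (i + 1)) (by omega)
    have e1 : h - i = (h - (i + 1)) + 1 := by omega
    rw [e1, pow_succ' T.map, Equiv.Perm.mul_apply,
      T.map_coe_eq hT (Ioo_subset_Ico_self hk)] at hsum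
    have hz : ((T.map ^ i) z : ℝ) ∈ Ioo (T.β k.castSucc) (T.β k.succ) :=
      ⟨by linarith [hk.2], by linarith [hk.1]⟩
    rw [pow_succ', Equiv.Perm.mul_apply, T.map_coe_eq hT (Ioo_subset_Ico_self hz)]
    exact ⟨by linarith, hp.reflect hz (by linarith)⟩
  have hall : ∀ i ≤ h, ((T.map ^ i) z : ℝ) + (T.map ^ (h - i)) x = T.length := by
    intro i
    induction i with
    | zero => intro _; rw [add_comm]; simpa using hxz
    | succ i ih => exact fun hi => (step i hi (ih (by omega))).1
  rw [birkhoff_natCast, birkhoff_natCast,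
    ← Finset.sum_range_reflect fun i => p ((T.map ^ i) x)]
  refine Finset.sum_congr rfl fun i hi => ?_
  have hi' := Finset.mem_range.1 hi
  rw [(step i hi' (hall i hi'.le)).2]
  rw [show h - 1 - i = h - (i + 1) by omega]

/-- Positivity is needed because `0` is reflected to `|I|`, which is not in `I`. -/
theorem leb_reflect {M : Set T.Base} (hM : MeasurableSet M) (hpos : ∀ x ∈ M, 0 < (x : ℝ)) :
    MeasurableSet {y : T.Base | ∃ z ∈ M, (y : ℝ) + z = T.length} ∧
      T.leb {y : T.Base | ∃ z ∈ M, (y : ℝ) + z = T.length} = T.leb M := by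
  have hM' : MeasurableSet (Subtype.val '' M : Set ℝ) :=
    T.measurableEmbedding_coe.measurableSet_image.2 hM
  have h1 : {y : T.Base | ∃ z ∈ M, (y : ℝ) + z = T.length} =
      Subtype.val ⁻¹' ((fun y : ℝ => T.length - y) ⁻¹' (Subtype.val '' M)) := by
    ext y
    simp only [mem_ofPred_eq, mem_preimage, mem_image]
    constructor
    · rintro ⟨z, hz, hyz⟩
      exact ⟨z, hz, by linarith⟩
    · rintro ⟨z, hz, hyz⟩
      exact ⟨z, hz, by linarith⟩
  have h2 : Measurable fun y : ℝ => T.length - y := by fun_prop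
  refine ⟨h1 ▸ measurable_subtype_coe (h2 hM'), ?_⟩
  rw [h1, leb_preimage_of_subset, leb_apply]
  · exact (Measure.measurePreserving_sub_left volume T.length).measure_preimage
      hM'.nullMeasurableSet
  · rintro y ⟨z, hz, hyz⟩
    have := hpos z hz
    have := z.2.2
    exact ⟨by linarith, by linarith⟩

namespace IsTranslationTower

variable {T} {a b : ℝ} {h : ℕ} {τ : ℕ → ℝ} {κ : ℕ → Fin d} (ht : T.IsTranslationTower a b h τ κ)
include ht

theorem pos_of_mem_tower {x : T.Base} (hx : x ∈ T.tower a b h) : 0 < (x : ℝ) := by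
  simp only [tower, mem_iUnion, Finset.mem_range] at hx
  obtain ⟨i, hi, hxi⟩ := hx
  rw [ht.level_eq hi.le] at hxi
  exact (T.β_nonneg _).trans_lt ((ht.left i hi).trans_lt hxi.1)

/-- The tower and the preimage under `T^h` of its reflection both have more than half the measure of
`I`, so they intersect. -/
theorem exists_reflected_pair (hhalf : T.length < 2 * (h * (b - a))) :
    ∃ x ∈ T.tower a b h, ∃ z ∈ T.tower a b h, ((T.map ^ h) x : ℝ) + z = T.length := by
  by_contra! hc
  have hM := T.measurableSet_tower a b h
  obtain ⟨hm, hv⟩ := T.leb_reflect hM fun x hx => ht.pos_of_mem_tower hx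
  have hpre := (T.measurePreserving_pow h).measure_preimage hm.nullMeasurableSet
  have hd : Disjoint (T.tower a b h)
      ((T.map ^ h) ⁻¹' {y : T.Base | ∃ z ∈ T.tower a b h, (y : ℝ) + z = T.length}) := by
    rw [Set.disjoint_left]
    rintro x hx ⟨z, hz, hxz⟩
    exact hc x hx z hz hxz
  have h1 := measure_union (μ := T.leb) hd ((T.measurePreserving_pow h).measurable hm)
  have h2 := measure_mono (μ := T.leb) (subset_univ (T.tower a b h ∪
    ((T.map ^ h) ⁻¹' {y : T.Base | ∃ z ∈ T.tower a b h, (y : ℝ) + z = T.length})))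
  rw [h1, hpre, hv, ht.isTower.leb_tower, leb_univ, ← ENNReal.ofReal_natCast,
    ← ENNReal.ofReal_mul (by positivity), ← ENNReal.ofReal_add
    (mul_nonneg (by positivity) ht.width_pos.le) (mul_nonneg (by positivity) ht.width_pos.le),
    ENNReal.ofReal_le_ofReal_iff (T.length_pos_of_isTower ht.isTower).le] at h2
  linarith

theorem map_pow_coe_shift {k : ℕ} (hk : k ≤ h) {y : T.Base} (hy : (y : ℝ) ∈ Ioo a b)
    (hy' : (y : ℝ) + τ h ∈ Ioo a b) :
    ((T.map ^ h) ((T.map ^ k) y) : ℝ) = (T.map ^ k) y + τ h := by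
  rw [← Equiv.Perm.mul_apply, ← pow_add, add_comm, pow_add, Equiv.Perm.mul_apply,
    ht.map_pow k hk _ (by rwa [ht.map_pow h le_rfl y hy]), ht.map_pow h le_rfl y hy,
    ht.map_pow k hk y hy]
  ring

/-- The orbit climbs to the top of the tower, re-enters the base at `y + τ h`, and climbs again,
always in the interior of pieces. -/
theorem mem_piece_of_level {k : ℕ} (hk : k < h) {y : T.Base} (hy : (y : ℝ) ∈ Ioo a b)
    (hy' : (y : ℝ) + τ h ∈ Ioo a b) {i : ℕ} (hi : i < h) :
    ∃ j : Fin d, ((T.map ^ i) ((T.map ^ k) y) : ℝ) ∈ Ioo (T.β j.castSucc) (T.β j.succ) := by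
  rw [← Equiv.Perm.mul_apply, ← pow_add]
  rcases lt_or_ge (i + k) h with hik | hik
  · exact ⟨_, ht.mem_piece hy hik⟩
  · have e : i + k = (i + k - h) + h := by omega
    rw [e, pow_add, Equiv.Perm.mul_apply]
    exact ⟨_, ht.mem_piece (by rwa [ht.map_pow h le_rfl y hy]) (by omega)⟩

/-- The slope of the Birkhoff sums of `p` on the base is bounded by a multiple of `1 / (b - a)`,
by symmetry, as soon as they are linear on the middle part of the base up to `K'` and change at
most by `K` from one level to another. -/
theorem abs_slope_mul_le (hT : T.IsSymmetric) {p : ℝ → ℝ} {C : Fin d → ℝ} {D : ℝ}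
    (hp : T.IsLogOn p C D) (hlarge : 2 * T.length < 3 * (h * (b - a)))
    (hτ : |τ h| ≤ (b - a) / 32) {K K' σ c : ℝ}
    (hK : ∀ k < h, ∀ y : T.Base, (y : ℝ) ∈ Ioo (a + (b - a) / 16) (b - (b - a) / 16) →
      |T.birkhoff p h ((T.map ^ k) y) - T.birkhoff p h y| ≤ K)
    (hK' : ∀ y : T.Base, (y : ℝ) ∈ Ioo (a + (b - a) / 16) (b - (b - a) / 16) →
      |T.birkhoff p h y - c - σ * (y - (a + b) / 2)| ≤ K') :
    |σ| * (b - a) ≤ 32 * (K + K') := by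
  have hl := ht.width_pos
  -- The pair is sought over the middle three quarters of the base, to leave room for shifts by a
  -- sixteenth. This subtower still fills more than half of `I`, by `hlarge`.
  have hmid := ht.mono (a' := a + (b - a) / 8) (b' := b - (b - a) / 8) (by linarith) (by linarith)
    (by linarith)
  have hτ' := abs_le.1 hτ
  obtain ⟨x, hx, z, hz, hxz⟩ := hmid.exists_reflected_pair (by nlinarith)
  simp only [tower, mem_iUnion, Finset.mem_range] at hx hz
  obtain ⟨k, hk, y, hy, rfl⟩ := hx
  obtain ⟨l, hl', w, hw, rfl⟩ := hz
  simp only [mem_ofPred_eq, mem_Ioo] at hy hw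
  have hy1 : (y : ℝ) ∈ Ioo (a + (b - a) / 16) (b - (b - a) / 16) :=
    ⟨by linarith [hy.1], by linarith [hy.2]⟩
  have hw1 : (w : ℝ) ∈ Ioo (a + (b - a) / 16) (b - (b - a) / 16) :=
    ⟨by linarith [hw.1], by linarith [hw.2]⟩
  -- Moving `y` up and `w` down by the same amount preserves the relation `T^h x + z = |I|`.
  have hy2 : (y : ℝ) + (b - a) / 16 ∈ Ioo (a + (b - a) / 16) (b - (b - a) / 16) :=
    ⟨by linarith [hy.1], by linarith [hy.2]⟩
  have hw2 : (w : ℝ) - (b - a) / 16 ∈ Ioo (a + (b - a) / 16) (b - (b - a) / 16) :=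
    ⟨by linarith [hw.1], by linarith [hw.2]⟩
  have hsub : Ioo (a + (b - a) / 16) (b - (b - a) / 16) ⊆ Ioo a b :=
    Ioo_subset_Ioo (by linarith) (by linarith)
  have hshift : ∀ u ∈ Ioo (a + (b - a) / 16) (b - (b - a) / 16), u + τ h ∈ Ioo a b :=
    fun u hu => ⟨by linarith [hu.1], by linarith [hu.2]⟩
  obtain ⟨y', hy'⟩ := ht.exists_base_point (hsub hy2)
  obtain ⟨w', hw'⟩ := ht.exists_base_point (hsub hw2)
  rw [← hy'] at hy2
  rw [← hw'] at hw2
  have e1 := T.birkhoff_reflect hT hp hxz fun i hi =>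
    ht.mem_piece_of_level hk (hsub hy1) (hshift _ hy1) hi
  have hxz' : ((T.map ^ h) ((T.map ^ k) y') : ℝ) + (T.map ^ l) w' = T.length := by
    rw [ht.map_pow_coe_shift hk.le (hsub hy1) (hshift _ hy1), ht.map_pow k hk.le y (hsub hy1),
      ht.map_pow l hl'.le w (hsub hw1)] at hxz
    rw [ht.map_pow_coe_shift hk.le (hsub hy2) (hshift _ hy2), ht.map_pow k hk.le y' (hsub hy2),
      ht.map_pow l hl'.le w' (hsub hw2), hy', hw']
    linarith
  have e2 := T.birkhoff_reflect hT hp hxz' fun i hi =>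
    ht.mem_piece_of_level hk (hsub hy2) (hshift _ hy2) hi
  have k1 := abs_le.1 (hK k hk y hy1)
  have k2 := abs_le.1 (hK k hk y' hy2)
  have k3 := abs_le.1 (hK l hl' w hw1)
  have k4 := abs_le.1 (hK l hl' w' hw2)
  have l1 := abs_le.1 (hK' y hy1)
  have l2 := abs_le.1 (hK' y' hy2)
  have l3 := abs_le.1 (hK' w hw1)
  have l4 := abs_le.1 (hK' w' hw2)
  rw [hy'] at l2
  rw [hw'] at l4
  have m1 : σ * ((y : ℝ) + (b - a) / 16 - (a + b) / 2) =
    σ * (y - (a + b) / 2) + σ * (b - a) / 16 := by ring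
  have m2 : σ * ((w : ℝ) - (b - a) / 16 - (a + b) / 2) =
    σ * (w - (a + b) / 2) - σ * (b - a) / 16 := by ring
  rw [m1] at l2
  rw [m2] at l4
  -- Comparing the two reflected pairs, the affine parts differ by `σ (b - a) / 8`, while four
  -- approximations cost `K + K'` each.
  have : |σ * (b - a)| ≤ 32 * (K + K') := by
    rw [abs_le]
    constructor <;> linarith [k1.1, k1.2, k2.1, k2.2, k3.1, k3.2, k4.1, k4.2, l1.1, l1.2, l2.1,
      l2.2, l3.1, l3.2, l4.1, l4.2]
  rwa [abs_mul, abs_of_pos hl] at this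

end IsTranslationTower

end IET

namespace IET

variable {d : ℕ} (T : IET d)

/-! ### Concentration of Birkhoff sums along a good rigidity sequence -/

theorem abs_log_le_of_mem {t : ℝ} (h1 : 1 / 8 ≤ t) (h2 : t ≤ 2) : |Real.log t| ≤ 7 := by
  have ht : 0 < t := by linarith
  have e1 := Real.log_le_sub_one_of_pos ht
  have e2 := Real.one_sub_inv_le_log_of_pos ht
  have e3 : t⁻¹ ≤ 8 := by
    rw [inv_le_comm₀ ht (by norm_num)]
    linarith
  rw [abs_le]
  constructor <;> linarith

/-- Three effects add up: the affine part and its logarithmic error on the base, the change from the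
base to level `k`, and the bounded variation part. -/
theorem exists_abs_birkhoff_sub_le (hT : T.IsSymmetric) (hL : 0 < T.length) {f : ℝ → ℝ}
    (hf : T.IsSymLog f) :
    ∃ K₁ K₂ : ℝ, 0 ≤ K₁ ∧ 0 ≤ K₂ ∧ ∀ (a b : ℝ) (h : ℕ) (τ : ℕ → ℝ) (κ : ℕ → Fin d),
      T.IsTranslationTower a b h τ κ → ∀ Λ : ℝ, Λ = Real.log (1 / (b - a)) → 32 ≤ Λ →
      1 + Real.log T.length ≤ Λ → |τ h| ≤ (b - a) / Λ → 2 * T.length < 3 * (h * (b - a)) →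
      ∀ x₀ : T.Base, (x₀ : ℝ) = (a + b) / 2 → ∀ k < h, ∀ y : T.Base,
        (y : ℝ) ∈ Ioo (a + 2 * ((b - a) / Λ)) (b - 2 * ((b - a) / Λ)) →
        |T.birkhoff f h ((T.map ^ k) y) - T.birkhoff f h x₀| ≤ K₁ + K₂ *
          (|Real.log ((y - a) / ((b - a) / 2))| + |Real.log ((b - y) / ((b - a) / 2))|) := by
  obtain ⟨p, hp, hg⟩ := hf
  obtain ⟨C, D, hD, hpl⟩ := hp.exists_isLogOn
  obtain ⟨V, hV, hgV⟩ := T.exists_abs_birkhoff_sub_le_of_boundedVariationOn hL hg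
  set E := D * d with hE
  have hE0 : 0 ≤ E := by positivity
  -- Here `832 = 32 * (6 + 20)` comes from the slope, one `6` from the linearization and another `6`
  -- from the change of level; `V` is used once on the base and once for the change of level.
  refine ⟨844 * E + 2 * V, E, by positivity, hE0, ?_⟩
  intro a b h τ κ ht Λ hΛ hΛ32 hΛL hτ hlarge x₀ hx₀ k hk y hy
  have hl := ht.width_pos
  set l := b - a with hldef
  have hΛ0 : 0 < Λ := by linarith
  have hρ : 0 < l / Λ := by positivity
  have hρ32 : l / Λ ≤ l / 32 := div_le_div_of_nonneg_left hl.le (by norm_num) hΛ32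
  have hsub : Ioo (a + 2 * (l / Λ)) (b - 2 * (l / Λ)) ⊆ Ioo a b :=
    Ioo_subset_Ioo (by linarith) (by linarith)
  have hτ' := abs_le.1 hτ
  have hmem : ∀ y : T.Base, (y : ℝ) ∈ Ioo (a + 2 * (l / Λ)) (b - 2 * (l / Λ)) →
      ((T.map ^ h) y : ℝ) ∈ Ioo a b := by
    intro y hy
    rw [ht.map_pow h le_rfl y (hsub hy)]
    exact ⟨by linarith [hy.1], by linarith [hy.2]⟩
  -- The displacement `|τ h| ≤ l / Λ` meets a Lipschitz constant of order `Λ / l`: the logarithm in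
  -- the rigidity rate absorbs the harmonic sum.
  have hK : ∀ k < h, ∀ y : T.Base, (y : ℝ) ∈ Ioo (a + 2 * (l / Λ)) (b - 2 * (l / Λ)) →
      |T.birkhoff p h ((T.map ^ k) y) - T.birkhoff p h y| ≤ 6 * E := by
    intro k hk y hy
    have hTy := ht.map_pow h le_rfl y (hsub hy)
    have h1 := ht.abs_birkhoff_sub_le hpl (hmem y hy) (hsub hy) hρ
      (by rw [hTy]; linarith [hy.1]) (by rw [hTy]; linarith [hy.2])
      (by linarith [hy.1]) (by linarith [hy.2]) hk.le
    rw [birkhoff_pow_apply, add_sub_cancel_left]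
    refine h1.trans ?_
    rw [hTy, add_sub_cancel_left]
    have e1 : Real.log (T.length / l) = Real.log T.length + Λ := by
      rw [hΛ, Real.log_div hL.ne' hl.ne', one_div, Real.log_inv, sub_eq_add_neg]
    have e2 : 1 / (l / Λ) + 1 / l * (1 + Real.log (T.length / l)) ≤ 3 * (Λ / l) := by
      rw [e1, one_div_div, one_div_mul_eq_div, ← add_div, mul_div_assoc']
      exact div_le_div_of_nonneg_right (by linarith) hl.le
    have e3 : 0 ≤ 1 / (l / Λ) + 1 / l * (1 + Real.log (T.length / l)) := by
      have : 0 ≤ Real.log (T.length / l) :=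
        Real.log_nonneg ((one_le_div hl).2 ht.width_le_length)
      positivity
    calc 2 * D * |τ h| * (d * (1 / (l / Λ) + 1 / l * (1 + Real.log (T.length / l))))
        ≤ 2 * D * (l / Λ) * (d * (3 * (Λ / l))) := by gcongr
      _ = 6 * E := by rw [hE]; field_simp; ring
  obtain ⟨σ, hσ⟩ := ht.exists_slope hpl
  have hsub16 : Ioo (a + l / 16) (b - l / 16) ⊆ Ioo (a + 2 * (l / Λ)) (b - 2 * (l / Λ)) :=
    Ioo_subset_Ioo (by linarith) (by linarith)
  -- On the middle part both ratios lie in `[1/8, 2]`, so the error is at most `7 + 7 + 6` times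
  -- `E`.
  have hK' : ∀ y : T.Base, (y : ℝ) ∈ Ioo (a + l / 16) (b - l / 16) →
      |T.birkhoff p h y - T.birkhoff p h x₀ - σ * (y - (a + b) / 2)| ≤ 20 * E := by
    intro y hy
    have h1 := hσ y x₀ (hsub (hsub16 hy)) hx₀
    rw [hx₀] at h1
    have e1 : |Real.log ((y - a) / (l / 2))| ≤ 7 := by
      apply abs_log_le_of_mem
      · rw [le_div_iff₀ (by positivity)]; linarith [hy.1]
      · rw [div_le_iff₀ (by positivity)]; linarith [hy.2]
    have e2 : |Real.log ((b - y) / (l / 2))| ≤ 7 := by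
      apply abs_log_le_of_mem
      · rw [le_div_iff₀ (by positivity)]; linarith [hy.2]
      · rw [div_le_iff₀ (by positivity)]; linarith [hy.1]
    refine h1.trans ?_
    rw [← hE, mul_comm 20]
    exact mul_le_mul_of_nonneg_left (by linarith) hE0
  have hslope := ht.abs_slope_mul_le hT hpl hlarge (hτ.trans hρ32)
    (fun k hk y hy => hK k hk y (hsub16 hy)) hK'
  have b1 : |T.birkhoff p h y - T.birkhoff p h x₀| ≤ 832 * E + E *
      (|Real.log ((y - a) / (l / 2))| + |Real.log ((b - y) / (l / 2))| + 6) := by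
    have h1 := hσ y x₀ (hsub hy) hx₀
    have h2 : |σ * ((y : ℝ) - x₀)| ≤ 832 * E := by
      rw [abs_mul]
      refine (mul_le_mul_of_nonneg_left (?_ : |(y : ℝ) - x₀| ≤ l) (abs_nonneg σ)).trans
        (hslope.trans (by linarith))
      rw [hx₀, abs_le]
      constructor <;> linarith [(hsub hy).1, (hsub hy).2]
    have h3 := abs_add_le (T.birkhoff p h y - T.birkhoff p h x₀ - σ * (y - x₀))
      (σ * ((y : ℝ) - x₀))
    rw [sub_add_cancel] at h3
    linarith
  have hx₀' : (x₀ : ℝ) ∈ Ioo a b := by rw [hx₀]; constructor <;> linarith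
  have b2 := hK k hk y hy
  have b3 := hgV a b h τ κ ht h le_rfl y x₀ (hsub hy) hx₀'
  have b4 := hgV a b h τ κ ht k hk.le _ y (hmem y hy) (hsub hy)
  rw [birkhoff_sub_natCast, birkhoff_sub_natCast] at b3 b4
  rw [birkhoff_pow_apply] at b2 ⊢
  have c1 := abs_le.1 b1
  have c2 := abs_le.1 b2
  have c3 := abs_le.1 b3
  have c4 := abs_le.1 b4
  rw [abs_le]
  constructor <;> linarith [c1.1, c1.2, c2.1, c2.2, c3.1, c3.2, c4.1, c4.2]

/-- Halving the logarithm turns its exponential into the integrable singularity `t^(-1/2)`. -/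
theorem exp_abs_log_half_le {t : ℝ} (ht : 0 < t) (ht2 : t ≤ 2) :
    Real.exp (|Real.log t| / 2) ≤ 2 + t ^ (-(1 / 2) : ℝ) := by
  have h0 : 0 ≤ t ^ (-(1 / 2) : ℝ) := by positivity
  rcases le_total t 1 with h | h
  · rw [abs_of_nonpos (Real.log_nonpos ht.le h), Real.rpow_def_of_pos ht]
    have : -Real.log t / 2 = Real.log t * -(1 / 2) := by ring
    rw [this]
    linarith
  · rw [abs_of_nonneg (Real.log_nonneg h)]
    have h1 : Real.exp (Real.log t / 2) ≤ Real.exp (Real.log t) :=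
      Real.exp_le_exp.2 (by linarith [Real.log_nonneg h])
    rw [Real.exp_log ht] at h1
    linarith

theorem lintegral_exp_abs_log_le {a b : ℝ} (hab : a < b) :
    ∫⁻ y in Ioo a b, ENNReal.ofReal (Real.exp (|Real.log ((y - a) / ((b - a) / 2))| / 2)) ≤
      ENNReal.ofReal (4 * (b - a)) := by
  set c := (b - a) / 2 with hc
  have hc0 : 0 < c := by rw [hc]; linarith
  have hii : IntervalIntegrable (fun t : ℝ => 2 + t ^ (-(1 / 2) : ℝ)) volume 0 2 :=
    intervalIntegrable_const.add (intervalIntegral.intervalIntegrable_rpow' (by norm_num))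
  have hcomp : ∀ y, y / c - a / c = (y - a) / c := fun y => by rw [sub_div]
  have hi2 : IntervalIntegrable (fun y : ℝ => 2 + ((y - a) / c) ^ (-(1 / 2) : ℝ)) volume a b := by
    have h1 := hii.comp_mul_left (c := c⁻¹)
    have h2 := h1.comp_sub_right a
    have e1 : 0 / c⁻¹ + a = a := by simp
    have e2 : 2 / c⁻¹ + a = b := by rw [div_inv_eq_mul, hc]; ring
    rw [e1, e2] at h2
    convert h2 using 4 with y
    rw [div_eq_inv_mul]
  calc ∫⁻ y in Ioo a b, ENNReal.ofReal (Real.exp (|Real.log ((y - a) / c)| / 2))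
      ≤ ∫⁻ y in Ioo a b, ENNReal.ofReal (2 + ((y - a) / c) ^ (-(1 / 2) : ℝ)) := by
        refine setLIntegral_mono' measurableSet_Ioo fun y hy => ENNReal.ofReal_le_ofReal ?_
        refine exp_abs_log_half_le (div_pos (by linarith [hy.1]) hc0) ?_
        rw [div_le_iff₀ hc0]
        linarith [hy.2]
    _ = ENNReal.ofReal (∫ y in Ioo a b, (2 + ((y - a) / c) ^ (-(1 / 2) : ℝ))) := by
        rw [ofReal_integral_eq_lintegral_ofReal]
        · exact ((intervalIntegrable_iff_integrableOn_Ioo_of_le hab.le).1 hi2)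
        · refine (ae_restrict_iff' measurableSet_Ioo).2 (ae_of_all _ fun y hy => ?_)
          have : 0 ≤ (y - a) / c := div_nonneg (by linarith [hy.1]) hc0.le
          simp only [Pi.zero_apply]
          positivity
    _ ≤ ENNReal.ofReal (4 * (b - a)) := by
        refine ENNReal.ofReal_le_ofReal ?_
        rw [← integral_Ioc_eq_integral_Ioo, ← intervalIntegral.integral_of_le hab.le]
        simp_rw [← hcomp]
        rw [intervalIntegral.integral_comp_div_sub (fun t : ℝ => 2 + t ^ (-(1 / 2) : ℝ)) hc0.ne',
          hcomp, hcomp, sub_self, zero_div, show (b - a) / c = 2 by rw [div_eq_iff hc0.ne', hc]; ring,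
          intervalIntegral.integral_add intervalIntegrable_const
            (intervalIntegral.intervalIntegrable_rpow' (by norm_num)),
          integral_rpow (Or.inl (by norm_num)), intervalIntegral.integral_const]
        have h2 : (2 : ℝ) ^ (-(1 / 2) + 1 : ℝ) ≤ 2 ^ (1 : ℝ) :=
          Real.rpow_le_rpow_of_exponent_le (by norm_num) (by norm_num)
        have h3 : (0 : ℝ) ^ (-(1 / 2) + 1 : ℝ) = 0 := Real.zero_rpow (by norm_num)
        rw [Real.rpow_one] at h2
        rw [h3]
        simp only [smul_eq_mul, sub_zero]
        have h4 : (-(1 / 2) + 1 : ℝ) = 1 / 2 := by norm_num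
        rw [h4] at h2 ⊢
        have h5 : (2 : ℝ) ^ (1 / 2 : ℝ) / (1 / 2) ≤ 4 := by
          rw [div_le_iff₀ (by norm_num)]; linarith
        have h6 : c * (2 * 2 + (2 : ℝ) ^ (1 / 2 : ℝ) / (1 / 2)) ≤ c * 8 :=
          mul_le_mul_of_nonneg_left (by linarith) hc0.le
        refine h6.trans (le_of_eq ?_)
        rw [hc]; ring

theorem lintegral_exp_abs_log_le' {a b : ℝ} (hab : a < b) :
    ∫⁻ y in Ioo a b, ENNReal.ofReal (Real.exp (|Real.log ((b - y) / ((b - a) / 2))| / 2)) ≤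
      ENNReal.ofReal (4 * (b - a)) := by
  have hmp := Measure.measurePreserving_sub_left (volume : Measure ℝ) (a + b)
  have hemb : MeasurableEmbedding fun y : ℝ => a + b - y :=
    (MeasurableEquiv.subLeft (a + b)).measurableEmbedding
  have h1 := hmp.setLIntegral_comp_preimage_emb hemb (fun y => ENNReal.ofReal
    (Real.exp (|Real.log ((y - a) / ((b - a) / 2))| / 2))) (Ioo a b)
  have h2 : (fun y : ℝ => a + b - y) ⁻¹' Ioo a b = Ioo a b := by
    ext y
    simp only [mem_preimage, mem_Ioo]
    constructor <;> rintro ⟨h, h'⟩ <;> constructor <;> linarith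
  rw [h2] at h1
  refine le_trans (le_of_eq ?_) (h1.trans_le (lintegral_exp_abs_log_le hab))
  refine lintegral_congr fun y => ?_
  congr 6
  ring

theorem setLIntegral_base {a b : ℝ} (hsub : Ioo a b ⊆ Ico 0 T.length) (F : ℝ → ENNReal) :
    ∫⁻ x in {x : T.Base | (x : ℝ) ∈ Ioo a b}, F x ∂T.leb = ∫⁻ y in Ioo a b, F y := by
  have hemb := T.measurableEmbedding_coe
  have h1 := hemb.restrict_map T.leb (Ioo a b)
  rw [leb, hemb.map_comap, Subtype.range_coe, Measure.restrict_restrict measurableSet_Ioo,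
    inter_eq_left.2 hsub] at h1
  rw [h1, hemb.lintegral_map]
  rfl

theorem setLIntegral_tower_le {a b : ℝ} {h : ℕ} {Θ Ψ : T.Base → ENNReal}
    (hle : ∀ i < h, ∀ y : T.Base, (y : ℝ) ∈ Ioo a b → Θ ((T.map ^ i) y) ≤ Ψ y) :
    ∫⁻ x in T.tower a b h, Θ x ∂T.leb ≤
      h * ∫⁻ x in {x : T.Base | (x : ℝ) ∈ Ioo a b}, Ψ x ∂T.leb := by
  have h1 : ∫⁻ x in T.tower a b h, Θ x ∂T.leb ≤
      ∑ i ∈ Finset.range h, ∫⁻ x in T.level a b i, Θ x ∂T.leb := by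
    unfold tower
    induction Finset.range h using Finset.induction_on with
    | empty => simp
    | insert i s hi ih =>
      rw [Finset.set_biUnion_insert, Finset.sum_insert hi]
      exact (lintegral_union_le _ _ _).trans (add_le_add_right ih _)
  refine h1.trans ((Finset.sum_le_sum fun i hi => ?_).trans_eq
    (by rw [Finset.sum_const, Finset.card_range, nsmul_eq_mul]))
  rw [setLIntegral_level]
  exact setLIntegral_mono' (T.measurableSet_base a b)
    fun y hy => hle i (Finset.mem_range.1 hi) y hy

/-- `c n` is the Birkhoff sum at the centre of the base, and `good n` is the tower over the base
trimmed by `2 l / Λ` at both ends, where the pointwise bound holds on every level. -/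
theorem exists_concentration (hT : T.IsSymmetric) {f : ℝ → ℝ} (hf : T.IsSymLog f) {m : ℝ}
    (hm : 0 < m) (hmf : ∀ x : T.Base, m ≤ f x) {a b : ℕ → ℝ} {h : ℕ → ℕ}
    (hrig : T.IsGoodRigiditySeq a b h) :
    ∃ (c : ℕ → ℝ) (good : ℕ → Set T.Base) (ε K : ℝ), Tendsto c atTop atTop ∧
      (∀ n, MeasurableSet (good n)) ∧ Tendsto (fun n => T.leb (good n)ᶜ) atTop (𝓝 0) ∧ 0 < ε ∧
      ∀ᶠ n in atTop, ∫⁻ x in good n, ENNReal.ofReal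
        (Real.exp (ε * |T.birkhoff f (h n) x - c n|)) ∂T.leb ≤ ENNReal.ofReal K := by
  have hL := T.length_pos_of_isTower (hrig.isTower 0)
  obtain ⟨K₁, K₂, hK₁, hK₂, hbd⟩ := T.exists_abs_birkhoff_sub_le hT hL hf
  have hmid : ∀ n, (a n + b n) / 2 ∈ Ioo (a n) (b n) := fun n =>
    ⟨by linarith [(hrig.isTower n).lt], by linarith [(hrig.isTower n).lt]⟩
  let x₀ : ℕ → T.Base := fun n => ⟨(a n + b n) / 2, (hrig.isTower n).subset (hmid n)⟩
  set Λ : ℕ → ℝ := fun n => Real.log (1 / (b n - a n)) with hΛ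
  -- This gives `ε * K₂ ≤ 1 / 4`, so that after separating the two logarithms each is multiplied by
  -- at most `1 / 2`.
  set ε : ℝ := 1 / (4 * (K₂ + 1)) with hε
  have hε0 : 0 < ε := by positivity
  have hmul : Tendsto (fun n => (h n : ℝ) * (b n - a n)) atTop (𝓝 T.length) := by
    have h1 := (ENNReal.tendsto_toReal ENNReal.ofReal_ne_top).comp hrig.measure
    rw [ENNReal.toReal_ofReal hL.le] at h1
    refine h1.congr fun n => ?_
    rw [Function.comp_apply, (hrig.isTower n).leb_tower, ENNReal.toReal_mul,
      ENNReal.toReal_natCast, ENNReal.toReal_ofReal (sub_pos.2 (hrig.isTower n).lt).le]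
  have hlarge : ∀ᶠ n in atTop, 2 * T.length < 3 * ((h n : ℝ) * (b n - a n)) :=
    (hmul.const_mul 3).eventually_const_lt (by linarith)
  have hev : ∀ᶠ n in atTop, 32 ≤ Λ n ∧ 1 + Real.log T.length ≤ Λ n :=
    (hrig.tendsto_log.eventually_ge_atTop _).and (hrig.tendsto_log.eventually_ge_atTop _)
  refine ⟨fun n => T.birkhoff f (h n) (x₀ n), fun n => T.tower (a n + 2 * ((b n - a n) / Λ n))
    (b n - 2 * ((b n - a n) / Λ n)) (h n), ε, Real.exp (ε * K₁) * (4 * T.length), ?_,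
    fun n => T.measurableSet_tower _ _ _, ?_, hε0, ?_⟩
  · refine tendsto_atTop_mono (fun n => T.mul_le_birkhoff hmf (h n) (x₀ n)) ?_
    exact (tendsto_natCast_atTop_atTop.comp hrig.height).atTop_mul_const hm
  -- Trimming loses the fraction `4 / Λ` of the tower, which tends to `0`.
  · have h1 : Tendsto (fun n => T.length - ((h n : ℝ) * (b n - a n) -
        4 * ((h n : ℝ) * (b n - a n) / Λ n))) atTop (𝓝 0) := by
      have h2 := tendsto_const_nhds (x := T.length) |>.sub
        (hmul.sub ((hmul.div_atTop hrig.tendsto_log).const_mul 4))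
      rwa [mul_zero, sub_zero, sub_self] at h2
    have h2 := (ENNReal.tendsto_ofReal h1)
    rw [ENNReal.ofReal_zero] at h2
    refine h2.congr' ?_
    filter_upwards [hev, hrig.eventually_isTranslationTower hT] with n ⟨h32, _⟩ ⟨τ, κ, ht⟩
    have hl := ht.width_pos
    have hρ32 : (b n - a n) / Λ n ≤ (b n - a n) / 32 :=
      div_le_div_of_nonneg_left hl.le (by norm_num) h32
    have hρ : 0 < (b n - a n) / Λ n := div_pos hl (by linarith)
    have ht' := ht.mono (a' := a n + 2 * ((b n - a n) / Λ n))
      (b' := b n - 2 * ((b n - a n) / Λ n)) (by linarith) (by linarith) (by linarith)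
    have h3 := ht'.leb_tower_real
    rw [measure_compl (T.measurableSet_tower _ _ _) (measure_ne_top _ _), leb_univ,
      ← ENNReal.ofReal_toReal (measure_ne_top T.leb (T.tower _ _ _)), ← measureReal_def, h3,
      ← ENNReal.ofReal_sub]
    · congr 1
      ring
    · exact mul_nonneg (Nat.cast_nonneg _) (by linarith)
  · filter_upwards [hev, hlarge, hrig.eventually_isTranslationTower hT,
      hrig.height.eventually_gt_atTop 0] with n ⟨h32, hΛL⟩ hlg ⟨τ, κ, ht⟩ hh
    have hl := ht.width_pos
    have hρ : 0 < (b n - a n) / Λ n := div_pos hl (by linarith)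
    have hτ : |τ (h n)| ≤ (b n - a n) / Λ n := by
      have h1 := hrig.rigid n (x₀ n) (by
        simp only [tower, mem_iUnion, Finset.mem_range]
        exact ⟨0, hh, x₀ n, hmid n, rfl⟩)
      rw [ht.map_pow (h n) le_rfl (x₀ n) (hmid n), add_sub_cancel_left] at h1
      refine h1.trans (le_of_eq ?_)
      rw [one_div_mul_eq_div, one_div_div]
    have hmain := hbd _ _ _ _ _ ht (Λ n) rfl h32 hΛL hτ hlg (x₀ n) rfl
    set A : ℝ → ENNReal := fun y => ENNReal.ofReal
      (Real.exp (|Real.log ((y - a n) / ((b n - a n) / 2))| / 2)) with hA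
    set A' : ℝ → ENNReal := fun y => ENNReal.ofReal
      (Real.exp (|Real.log ((b n - y) / ((b n - a n) / 2))| / 2)) with hA'
    have hpt : ∀ i < h n, ∀ y : T.Base, (y : ℝ) ∈ Ioo (a n + 2 * ((b n - a n) / Λ n))
        (b n - 2 * ((b n - a n) / Λ n)) → ENNReal.ofReal (Real.exp (ε *
          |T.birkhoff f (h n) ((T.map ^ i) y) - T.birkhoff f (h n) (x₀ n)|)) ≤
        ENNReal.ofReal (Real.exp (ε * K₁) / 2) * (A y + A' y) := by
      intro i hi y hy
      have h1 := hmain i hi y hy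
      set u := |Real.log ((y - a n) / ((b n - a n) / 2))|
      set v := |Real.log ((b n - y) / ((b n - a n) / 2))|
      rw [hA, hA', ← ENNReal.ofReal_add (Real.exp_pos _).le (Real.exp_pos _).le,
        ← ENNReal.ofReal_mul (by positivity)]
      refine ENNReal.ofReal_le_ofReal ?_
      have hu : 0 ≤ u := abs_nonneg _
      have hv : 0 ≤ v := abs_nonneg _
      have hεK : ε * K₂ ≤ 1 / 4 := by
        rw [hε, one_div_mul_eq_div, div_le_div_iff₀ (by positivity) (by norm_num)]
        linarith
      have h2 : ε * |T.birkhoff f (h n) ((T.map ^ i) y) - T.birkhoff f (h n) (x₀ n)| ≤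
          ε * K₁ + (u / 4 + v / 4) := by
        have := mul_le_mul_of_nonneg_left h1 hε0.le
        have h3 := mul_le_mul_of_nonneg_right hεK (add_nonneg hu hv)
        linarith
      refine (Real.exp_le_exp.2 h2).trans ?_
      have e1 : Real.exp (u / 2) = Real.exp (u / 4) ^ 2 := by
        rw [← Real.exp_nat_mul]; congr 1; push_cast; ring
      have e2 : Real.exp (v / 2) = Real.exp (v / 4) ^ 2 := by
        rw [← Real.exp_nat_mul]; congr 1; push_cast; ring
      change _ ≤ Real.exp (ε * K₁) / 2 * (Real.exp (u / 2) + Real.exp (v / 2))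
      rw [Real.exp_add, Real.exp_add, e1, e2]
      -- The inequality `2 x y ≤ x² + y²` separates the singularities at the two ends of the base.
      have e3 := mul_nonneg (Real.exp_pos (ε * K₁)).le
        (sq_nonneg (Real.exp (u / 4) - Real.exp (v / 4)))
      linarith
    refine (T.setLIntegral_tower_le (Ψ := fun y => ENNReal.ofReal (Real.exp (ε * K₁) / 2) *
      (A y + A' y)) hpt).trans ?_
    have hsub : Ioo (a n + 2 * ((b n - a n) / Λ n)) (b n - 2 * ((b n - a n) / Λ n)) ⊆
        Ioo (a n) (b n) := Ioo_subset_Ioo (by linarith) (by linarith)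
    have hsub' : {x : T.Base | (x : ℝ) ∈ Ioo (a n + 2 * ((b n - a n) / Λ n))
        (b n - 2 * ((b n - a n) / Λ n))} ⊆ {x : T.Base | (x : ℝ) ∈ Ioo (a n) (b n)} :=
      fun x hx => hsub hx
    have hint : ∫⁻ y in {x : T.Base | (x : ℝ) ∈ Ioo (a n) (b n)},
        ENNReal.ofReal (Real.exp (ε * K₁) / 2) * (A y + A' y) ∂T.leb ≤
        ENNReal.ofReal (Real.exp (ε * K₁) / 2) * ENNReal.ofReal (8 * (b n - a n)) := by
      rw [T.setLIntegral_base ht.isTower.subset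
        (fun y => ENNReal.ofReal (Real.exp (ε * K₁) / 2) * (A y + A' y)),
        lintegral_const_mul' _ _ ENNReal.ofReal_ne_top, lintegral_add_left (by fun_prop)]
      refine mul_le_mul_right ((add_le_add (lintegral_exp_abs_log_le ht.isTower.lt)
        (lintegral_exp_abs_log_le' ht.isTower.lt)).trans_eq ?_) _
      rw [← ENNReal.ofReal_add (by positivity) (by positivity)]
      congr 1
      ring
    refine (mul_le_mul_right ((lintegral_mono_set hsub').trans hint) _).trans ?_
    rw [← ENNReal.ofReal_natCast, ← ENNReal.ofReal_mul (by positivity),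
      ← ENNReal.ofReal_mul (by positivity)]
    refine ENNReal.ofReal_le_ofReal ?_
    have h1 := mul_le_mul_of_nonneg_left ht.isTower.mul_le_length
      (mul_nonneg (Real.exp_pos (ε * K₁)).le (by norm_num : (0 : ℝ) ≤ 4))
    linarith

end IET

/-! ### Rigidity and asymptotic independence -/

namespace Rigidity

/-! ### From fixed shifts to random shifts -/

section Grid

variable {Ω : Type*} [MeasurableSpace Ω] (μ : Measure Ω) [IsFiniteMeasure μ]

theorem exists_finset_near {δ : ℝ} (hδ : 0 < δ) (R : ℝ) :
    ∃ A : Finset ℝ, ∀ s : ℝ, |s| ≤ R → ∃ t ∈ A, |s - t| ≤ δ := by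
  have hc : IsCompact (Icc (-R) R) := isCompact_Icc
  obtain ⟨A, -, hA, hcov⟩ := hc.finite_cover_balls hδ
  refine ⟨hA.toFinset, fun s hs => ?_⟩
  obtain ⟨t, ht, hst⟩ := mem_iUnion₂.1 (hcov (abs_le.1 hs))
  exact ⟨t, hA.mem_toFinset.2 ht, (Metric.mem_ball.1 hst).le⟩

variable {μ}

/-- The integral of `D (x, ζ x)` is controlled by the integrals of `D (x, s)` for finitely many
fixed `s`, when `D` is uniformly continuous in `s`. -/
theorem exists_finset_integral_le {δ : ℝ} (hδ : 0 < δ) (R : ℝ) :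
    ∃ A : Finset ℝ, ∀ {M ε : ℝ}, 0 ≤ M → 0 ≤ ε → ∀ (D : Ω → ℝ → ℝ) (ζ : Ω → ℝ),
      Measurable (Function.uncurry D) → Measurable ζ → (∀ x s, 0 ≤ D x s) →
      (∀ x s, D x s ≤ M) → (∀ x s t, |s - t| ≤ δ → |D x s - D x t| ≤ ε) →
      ∫ x, D x (ζ x) ∂μ ≤ ∑ s ∈ A, ∫ x, D x s ∂μ + ε * μ.real univ +
        M * μ.real {x | R < |ζ x|} := by
  obtain ⟨A, hA⟩ := exists_finset_near hδ R
  refine ⟨A, ?_⟩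
  intro M ε hM hε D ζ hD hζ h0 hle hmod
  have hS : MeasurableSet {x | R < |ζ x|} := measurableSet_lt measurable_const hζ.abs
  have hDs : ∀ s, Integrable (fun x => D x s) μ := fun s =>
    Integrable.of_bound (hD.comp measurable_prodMk_right).aestronglyMeasurable M
      (ae_of_all _ fun x => by rw [Real.norm_of_nonneg (h0 x s)]; exact hle x s)
  have hDζ : Integrable (fun x => D x (ζ x)) μ :=
    Integrable.of_bound (hD.comp (measurable_id.prodMk hζ)).aestronglyMeasurable M
      (ae_of_all _ fun x => by rw [Real.norm_of_nonneg (h0 x _)]; exact hle x _)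
  have hsum : Integrable (fun x => ∑ s ∈ A, D x s) μ := integrable_finsetSum _ fun s _ => hDs s
  have hind : Integrable ({x | R < |ζ x|}.indicator fun _ => M) μ :=
    (integrable_const M).indicator hS
  have hsum' : Integrable (fun x => ∑ s ∈ A, D x s + ε) μ := hsum.add (integrable_const ε)
  calc ∫ x, D x (ζ x) ∂μ
      ≤ ∫ x, (∑ s ∈ A, D x s + ε + {x | R < |ζ x|}.indicator (fun _ => M) x) ∂μ := by
        refine integral_mono hDζ (hsum'.add hind) fun x => ?_
        have hs0 : 0 ≤ ∑ s ∈ A, D x s := Finset.sum_nonneg fun s _ => h0 x s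
        by_cases hx : R < |ζ x|
        · have : x ∈ {x | R < |ζ x|} := hx
          rw [indicator_of_mem this]
          linarith [hle x (ζ x)]
        · have : x ∉ {x | R < |ζ x|} := hx
          rw [indicator_of_notMem this]
          obtain ⟨t, ht, hst⟩ := hA (ζ x) (not_lt.1 hx)
          have h1 := (abs_le.1 (hmod x _ _ hst)).2
          have h2 := Finset.single_le_sum (f := fun s => D x s) (fun s _ => h0 x s) ht
          linarith
    _ = _ := by
        rw [integral_add hsum' hind,
          integral_add hsum (integrable_const ε), integral_finsetSum _ fun s _ => hDs s,
          integral_indicator hS, integral_const, setIntegral_const]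
        simp only [smul_eq_mul]
        ring

/-- The random variables `ζ n` are tight. -/
def IsTightSeq (μ : Measure Ω) (ζ : ℕ → Ω → ℝ) : Prop :=
  ∀ ε > 0, ∃ R : ℝ, ∀ᶠ n in atTop, μ.real {x | R < |ζ n x|} ≤ ε

/-- Tightness confines `ζ n` to a compact set covered by finitely many grid values. The indices `k`
and `n` are kept independent, so that `k` may equal `n` or stay fixed. -/
theorem tendsto_integral_diag {D : ℕ → Ω → ℝ → ℝ} {ζ : ℕ → Ω → ℝ} {M : ℝ}
    (hD : ∀ n, Measurable (Function.uncurry (D n))) (hζ : ∀ n, Measurable (ζ n))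
    (h0 : ∀ n x s, 0 ≤ D n x s) (hle : ∀ n x s, D n x s ≤ M)
    (hmod : ∀ ε > 0, ∃ δ > 0, ∀ n x s t, |s - t| ≤ δ → |D n x s - D n x t| ≤ ε)
    (htight : IsTightSeq μ ζ) (hlim : ∀ s, Tendsto (fun n => ∫ x, D n x s ∂μ) atTop (𝓝 0)) :
    ∀ ε > 0, ∃ K, ∀ k ≥ K, ∀ n ≥ K, ∫ x, D k x (ζ n x) ∂μ ≤ ε := by
  intro ε hε
  by_cases hΩ : Nonempty Ω
  swap
  · rw [not_nonempty_iff] at hΩ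
    exact ⟨0, fun k _ n _ => by
      rw [Measure.eq_zero_of_isEmpty μ, integral_zero_measure]; exact hε.le⟩
  obtain ⟨x₀⟩ := hΩ
  have hM : 0 ≤ M := (h0 0 x₀ 0).trans (hle 0 x₀ 0)
  obtain ⟨δ, hδ, hmodδ⟩ := hmod (ε / (3 * (μ.real univ + 1))) (by positivity)
  obtain ⟨R, hR⟩ := htight (ε / (3 * (M + 1))) (by positivity)
  obtain ⟨A, hA⟩ := exists_finset_integral_le (μ := μ) hδ R
  have hsum : Tendsto (fun k => ∑ s ∈ A, ∫ x, D k x s ∂μ) atTop (𝓝 0) := by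
    have := tendsto_finsetSum A fun s _ => hlim s
    simpa using this
  obtain ⟨K, hK⟩ := eventually_atTop.1 (hsum.eventually_le_const (by positivity : 0 < ε / 3))
  obtain ⟨N, hN⟩ := eventually_atTop.1 hR
  refine ⟨max K N, fun k hk n hn => ?_⟩
  replace hn := hN n (le_of_max_le_right hn)
  have h1 := hA hM (by positivity : 0 ≤ ε / (3 * (μ.real univ + 1))) (D k) (ζ n) (hD k) (hζ n)
    (h0 k) (hle k) (hmodδ k)
  have h2 := hK k (le_of_max_le_left hk)
  have h3 : ε / (3 * (μ.real univ + 1)) * μ.real univ ≤ ε / 3 := by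
    rw [div_mul_eq_mul_div, div_le_div_iff₀ (by positivity) (by positivity)]
    nlinarith [measureReal_nonneg (μ := μ) (s := univ)]
  have h4 : M * μ.real {x | R < |ζ n x|} ≤ ε / 3 := by
    refine (mul_le_mul_of_nonneg_left hn hM).trans ?_
    rw [mul_div_assoc', div_le_div_iff₀ (by positivity) (by positivity)]
    nlinarith
  linarith

end Grid

/-! ### Measure preserving maps close to the identity -/

section Rigid

variable {Ω : Type*} [PseudoMetricSpace Ω] [MeasurableSpace Ω] [BorelSpace Ω]
  [SecondCountableTopology Ω] [LocallyCompactSpace Ω] {μ : Measure Ω} [IsFiniteMeasure μ]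
  [μ.Regular] {R : ℕ → Ω → Ω}

/-- If measure preserving maps `R n` converge to the identity in measure, then `u ∘ R n`
converges to `u` in `L¹`. -/
theorem tendsto_integral_norm_comp_sub {E : Type*} [NormedAddCommGroup E] [NormedSpace ℝ E]
    (hR : ∀ n, MeasurePreserving (R n) μ μ)
    (hdist : ∀ η > 0, Tendsto (fun n => μ.real {x | η ≤ dist (R n x) x}) atTop (𝓝 0))
    {u : Ω → E} (hu : Integrable u μ) :
    Tendsto (fun n => ∫ x, ‖u (R n x) - u x‖ ∂μ) atTop (𝓝 0) := by
  rw [Metric.tendsto_atTop']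
  intro ε hε
  -- The error of replacing `u` by a uniformly continuous `g` is unchanged under `R n`; for `g`,
  -- proximity of `R n x` to `x` suffices.
  obtain ⟨g, hgs, hgu, hgc, hgi⟩ := hu.exists_hasCompactSupport_integral_sub_le
    (by positivity : 0 < ε / 8)
  obtain ⟨B, hB⟩ := hgs.exists_bound_of_continuous hgc
  have hBabs : ∀ x, ‖g x‖ ≤ |B| := fun x => (hB x).trans (le_abs_self B)
  obtain ⟨η, hη, hunif⟩ := Metric.uniformContinuous_iff.1 (hgs.uniformContinuous_of_continuous hgc)
    (ε / (8 * (μ.real univ + 1))) (by positivity)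
  have hev := (hdist η hη).eventually_lt_const
    (by positivity : 0 < ε / (8 * (2 * |B| + 1)))
  obtain ⟨N, hN⟩ := eventually_atTop.1 hev
  refine ⟨N, fun n hn => ?_⟩
  have hset : MeasurableSet {x | η ≤ dist (R n x) x} :=
    measurableSet_le measurable_const ((hR n).measurable.dist measurable_id)
  have hgR : Integrable (fun x => g (R n x)) μ := (hR n).integrable_comp_of_integrable hgi
  have huR : Integrable (fun x => u (R n x)) μ := (hR n).integrable_comp_of_integrable hu
  have hi1 : Integrable (fun x => ‖u (R n x) - g (R n x)‖) μ := (huR.sub hgR).norm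
  have hi2 : Integrable (fun x => ‖u x - g x‖) μ := (hu.sub hgi).norm
  have hi3 : Integrable ({x | η ≤ dist (R n x) x}.indicator fun _ => 2 * |B|) μ :=
    (integrable_const _).indicator hset
  have hi12 : Integrable (fun x => ‖u (R n x) - g (R n x)‖ + ‖u x - g x‖) μ := hi1.add hi2
  have hi4 : Integrable (fun x => ‖u (R n x) - g (R n x)‖ + ‖u x - g x‖ +
      ε / (8 * (μ.real univ + 1))) μ := hi12.add (integrable_const _)
  have hI1 : ∫ x, ‖u (R n x) - g (R n x)‖ ∂μ = ∫ x, ‖u x - g x‖ ∂μ := by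
    have h1 : AEStronglyMeasurable (fun x => ‖u x - g x‖) (μ.map (R n)) := by
      rw [(hR n).map_eq]; exact hi2.aestronglyMeasurable
    have h2 := integral_map (hR n).measurable.aemeasurable h1
    rw [(hR n).map_eq] at h2
    exact h2.symm
  have hle : ∫ x, ‖u (R n x) - u x‖ ∂μ ≤ ∫ x, (‖u (R n x) - g (R n x)‖ + ‖u x - g x‖ +
      ε / (8 * (μ.real univ + 1)) + {x | η ≤ dist (R n x) x}.indicator (fun _ => 2 * |B|) x) ∂μ := by
    refine integral_mono (huR.sub hu).norm (hi4.add hi3)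
      fun x => ?_
    have h1 : ‖u (R n x) - u x‖ ≤ ‖u (R n x) - g (R n x)‖ + ‖u x - g x‖ +
        ‖g (R n x) - g x‖ := by
      have : u (R n x) - u x = (u (R n x) - g (R n x)) - (u x - g x) + (g (R n x) - g x) := by
        abel
      rw [this]
      exact (norm_add_le _ _).trans (add_le_add_left (norm_sub_le _ _) _)
    by_cases hx : η ≤ dist (R n x) x
    · have hx' : x ∈ {x | η ≤ dist (R n x) x} := hx
      rw [indicator_of_mem hx']
      have h2 := norm_sub_le (g (R n x)) (g x)
      have h3 : 0 ≤ ε / (8 * (μ.real univ + 1)) := by positivity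
      linarith [hBabs x, hBabs (R n x)]
    · have hx' : x ∉ {x | η ≤ dist (R n x) x} := hx
      rw [indicator_of_notMem hx']
      have h2 := hunif (not_le.1 hx)
      rw [dist_eq_norm] at h2
      linarith
  rw [integral_add hi4 hi3, integral_add hi12 (integrable_const _), integral_add hi1 hi2, hI1,
    integral_indicator hset, integral_const, setIntegral_const, smul_eq_mul, smul_eq_mul] at hle
  have h3 : μ.real univ * (ε / (8 * (μ.real univ + 1))) ≤ ε / 8 := by
    rw [mul_div_assoc', div_le_div_iff₀ (by positivity) (by positivity)]
    nlinarith [measureReal_nonneg (μ := μ) (s := univ)]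
  have h4 : μ.real {x | η ≤ dist (R n x) x} * (2 * |B|) ≤ ε / 8 := by
    refine (mul_le_mul_of_nonneg_right (hN n hn.le).le (by positivity)).trans ?_
    rw [div_mul_eq_mul_div, div_le_div_iff₀ (by positivity) (by positivity)]
    nlinarith [abs_nonneg B]
  rw [Real.dist_eq, sub_zero, abs_of_nonneg (integral_nonneg fun x => norm_nonneg _)]
  linarith

theorem exists_measureReal_lt_abs_le {Ω : Type*} [MeasurableSpace Ω] {μ : Measure Ω}
    [IsFiniteMeasure μ] {f : Ω → ℝ} (hf : Measurable f) {ε : ℝ} (hε : 0 < ε) :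
    ∃ K : ℝ, 0 ≤ K ∧ μ.real {x | K < |f x|} ≤ ε := by
  have h1 : Tendsto (fun k : ℕ => μ {x | (k : ℝ) < |f x|}) atTop
      (𝓝 (μ (⋂ k : ℕ, {x | (k : ℝ) < |f x|}))) := by
    refine tendsto_measure_iInter_atTop
      (fun k => (measurableSet_lt measurable_const hf.abs).nullMeasurableSet) ?_
      ⟨0, measure_ne_top _ _⟩
    intro i j hij x hx
    have hx' : (j : ℝ) < |f x| := hx
    exact lt_of_le_of_lt (Nat.cast_le.2 hij) hx'
  have h2 : ⋂ k : ℕ, {x | (k : ℝ) < |f x|} = ∅ := by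
    ext x
    simp only [mem_iInter, mem_ofPred_eq, mem_empty_iff_false, iff_false, not_forall, not_lt]
    exact ⟨_, Nat.le_ceil _⟩
  rw [h2, measure_empty] at h1
  have h3 := (ENNReal.tendsto_toReal ENNReal.zero_ne_top).comp h1
  obtain ⟨k, hk⟩ := (h3.eventually_le_const (by simpa using hε)).exists
  exact ⟨k, by positivity, hk⟩

/-- If measure preserving maps `R n` converge to the identity in measure, then so does `f ∘ R n`
to `f`, for every measurable `f`. -/
theorem tendsto_measureReal_comp_sub (hR : ∀ n, MeasurePreserving (R n) μ μ)
    (hdist : ∀ η > 0, Tendsto (fun n => μ.real {x | η ≤ dist (R n x) x}) atTop (𝓝 0))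
    {f : Ω → ℝ} (hf : Measurable f) {η : ℝ} (hη : 0 < η) :
    Tendsto (fun n => μ.real {x | η < |f (R n x) - f x|}) atTop (𝓝 0) := by
  rw [Metric.tendsto_atTop']
  intro ε hε
  obtain ⟨K, hK0, hK⟩ := exists_measureReal_lt_abs_le (μ := μ) hf (by positivity : 0 < ε / 4)
  -- Truncation at `K` makes `f` integrable and alters it only on a set of small measure, whose
  -- preimage under `R n` is equally small.
  set u : Ω → ℝ := fun x => max (-K) (min K (f x)) with hu
  have hum : Measurable u := by fun_prop
  have hub : ∀ x, |u x| ≤ K := fun x => abs_le.2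
    ⟨le_max_left _ _, max_le (by linarith) (min_le_left _ _)⟩
  have hufx : ∀ x, |f x| ≤ K → u x = f x := fun x hx => by
    have := abs_le.1 hx
    rw [hu]
    simp only
    rw [min_eq_right this.2, max_eq_right this.1]
  have hui : Integrable u μ := Integrable.of_bound hum.aestronglyMeasurable K (ae_of_all _ hub)
  have hlim := tendsto_integral_norm_comp_sub hR hdist hui
  obtain ⟨N, hN⟩ := eventually_atTop.1 (hlim.eventually_lt_const
    (by positivity : 0 < η * (ε / 4)))
  refine ⟨N, fun n hn => ?_⟩
  have hset : MeasurableSet {x | K < |f x|} := measurableSet_lt measurable_const hf.abs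
  have hsub : {x | η < |f (R n x) - f x|} ⊆ ({x | K < |f x|} ∪ R n ⁻¹' {x | K < |f x|}) ∪
      {x | η ≤ ‖u (R n x) - u x‖} := by
    intro x hx
    by_cases h1 : K < |f x|
    · exact Or.inl (Or.inl h1)
    by_cases h2 : K < |f (R n x)|
    · exact Or.inl (Or.inr h2)
    · right
      rw [mem_ofPred_eq, hufx x (not_lt.1 h1), hufx _ (not_lt.1 h2)]
      exact le_of_lt hx
  have h1 : μ.real (R n ⁻¹' {x | K < |f x|}) = μ.real {x | K < |f x|} := by
    rw [measureReal_def, measureReal_def, (hR n).measure_preimage hset.nullMeasurableSet]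
  have hint : Integrable (fun x => ‖u (R n x) - u x‖) μ :=
    (((hR n).integrable_comp_of_integrable hui).sub hui).norm
  have h2 := mul_meas_ge_le_integral_of_nonneg (ae_of_all _ fun x => norm_nonneg _) hint η
  have h3 := (measureReal_mono (μ := μ) hsub).trans ((measureReal_union_le _ _).trans
    (add_le_add_left (measureReal_union_le _ _) _))
  rw [h1] at h3
  have h4 : μ.real {x | η ≤ ‖u (R n x) - u x‖} ≤ ε / 4 := by
    have := hN n hn.le
    by_contra! hc
    have h5 := mul_lt_mul_of_pos_left hc hη
    linarith
  rw [Real.dist_eq, sub_zero, abs_of_nonneg measureReal_nonneg]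
  linarith

end Rigid

/-! ### Asymptotic independence from ergodicity -/

section Independence

variable {Ω : Type*} [MeasurableSpace Ω] {μ : Measure Ω} [IsFiniteMeasure μ] {S : Ω → Ω}

/-- The mean ergodic theorem in `L¹`, for bounded functions. -/
theorem tendsto_integral_norm_average_sub (hS : Ergodic S μ) (hμ : μ.real univ ≠ 0)
    {u : Ω → ℂ} (hu : Measurable u) {M : ℝ} (hM : ∀ x, ‖u x‖ ≤ M) :
    Tendsto (fun K : ℕ => ∫ x, ‖(K : ℂ)⁻¹ * ∑ k ∈ Finset.range K, u (S^[k] x) -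
      (μ.real univ : ℂ)⁻¹ * ∫ y, u y ∂μ‖ ∂μ) atTop (𝓝 0) := by
  have hu2 : MemLp u 2 μ := MemLp.of_bound hu.aestronglyMeasurable M (ae_of_all _ hM)
  have hmp := hS.toMeasurePreserving
  have huk : ∀ k, MemLp (fun x => u (S^[k] x)) 2 μ := fun k =>
    hu2.comp_measurePreserving (hmp.iterate k)
  -- By the mean ergodic theorem for the Koopman isometry, the averages converge in `L²` to a fixed
  -- vector, which is constant by ergodicity.
  set U := (Lp.compMeasurePreservingₗᵢ ℂ S hmp : Lp ℂ 2 μ →ₗᵢ[ℂ] Lp ℂ 2 μ).toContinuousLinearMap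
    with hU
  have hUnorm : ‖U‖ ≤ 1 := LinearIsometry.norm_toContinuousLinearMap_le _
  have hconv := U.tendsto_birkhoffAverage_orthogonalProjection hUnorm (hu2.toLp u)
  set v : Lp ℂ 2 μ := ((U.eqLocus (1 : Lp ℂ 2 μ →L[ℂ] Lp ℂ 2 μ)).orthogonalProjectionOnto
    (hu2.toLp u) : Lp ℂ 2 μ) with hv
  have hvfix : U v = v := by
    have h1 := ((U.eqLocus (1 : Lp ℂ 2 μ →L[ℂ] Lp ℂ 2 μ)).orthogonalProjectionOnto
      (hu2.toLp u)).2
    exact h1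
  have hvinv : (v : Ω → ℂ) ∘ S =ᵐ[μ] v := by
    have h1 : (U v : Ω → ℂ) =ᵐ[μ] v ∘ S := Lp.coeFn_compMeasurePreserving v hmp
    rw [hvfix] at h1
    exact h1.symm
  obtain ⟨c, hc⟩ := hS.ae_eq_const_of_ae_eq_comp_ae (Lp.aestronglyMeasurable v) hvinv
  have hA : ∀ K : ℕ, MemLp (fun x => (K : ℂ)⁻¹ * ∑ k ∈ Finset.range K, u (S^[k] x)) 2 μ :=
    fun K => (memLp_finsetSum _ fun k _ => huk k).const_mul _
  have hbirk : ∀ K : ℕ, ((birkhoffAverage ℂ U _root_.id K (hu2.toLp u) : Lp ℂ 2 μ) : Ω → ℂ) =ᵐ[μ]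
      fun x => (K : ℂ)⁻¹ * ∑ k ∈ Finset.range K, u (S^[k] x) := by
    intro K
    have h1 : ∀ K : ℕ, ((birkhoffSum U _root_.id K (hu2.toLp u) : Lp ℂ 2 μ) : Ω → ℂ) =ᵐ[μ]
        fun x => ∑ k ∈ Finset.range K, u (S^[k] x) := by
      intro K
      induction K with
      | zero =>
        simp only [birkhoffSum_zero, Finset.range_zero, Finset.sum_empty]
        exact Lp.coeFn_zero ℂ 2 μ
      | succ K ih =>
        rw [birkhoffSum_succ]
        have h2 : (U^[K] (hu2.toLp u) : Lp ℂ 2 μ) = (huk K).toLp _ := by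
          have h3 := congrFun (Lp.compMeasurePreserving_iterate (E := ℂ) (p := 2) hmp K)
            (hu2.toLp u)
          exact h3
        filter_upwards [ih, Lp.coeFn_add (birkhoffSum U _root_.id K (hu2.toLp u))
          (_root_.id (U^[K] (hu2.toLp u))), (huk K).coeFn_toLp] with x hx h3 h4
        rw [h3, Pi.add_apply, hx, Finset.sum_range_succ, id, h2, h4]
    filter_upwards [h1 K, Lp.coeFn_smul ((K : ℂ)⁻¹) (birkhoffSum U _root_.id K (hu2.toLp u))]
      with x hx h2
    rw [birkhoffAverage, h2, Pi.smul_apply, hx, smul_eq_mul]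
  have h2 : Tendsto (fun K : ℕ => eLpNorm (fun x => (K : ℂ)⁻¹ * ∑ k ∈ Finset.range K, u (S^[k] x)
      - c) 2 μ) atTop (𝓝 0) := by
    have h3 := (Lp.tendsto_Lp_iff_tendsto_eLpNorm' _ _).1 hconv
    refine h3.congr fun K => eLpNorm_congr_ae ?_
    filter_upwards [hbirk K, hc] with x hx hx'
    rw [Pi.sub_apply, hx, hx', Function.const_apply]
  have hI : ∀ (c : ℂ) (K : ℕ), MemLp (fun x => (K : ℂ)⁻¹ * ∑ k ∈ Finset.range K, u (S^[k] x)
      - c) 2 μ := fun c K => (hA K).sub (memLp_const c)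
  have h1 : Tendsto (fun K : ℕ => ∫ x, ‖(K : ℂ)⁻¹ * ∑ k ∈ Finset.range K, u (S^[k] x)
      - c‖ ∂μ) atTop (𝓝 0) := by
    have h3 : Tendsto (fun K : ℕ => eLpNorm (fun x => (K : ℂ)⁻¹ *
        ∑ k ∈ Finset.range K, u (S^[k] x) - c) 1 μ) atTop (𝓝 0) := by
      have h4 := ENNReal.Tendsto.mul_const (b := μ univ ^ (1 / (1 : ENNReal).toReal -
        1 / (2 : ENNReal).toReal)) h2 (Or.inr (ENNReal.rpow_ne_top_of_nonneg (by norm_num)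
          (measure_ne_top _ _)))
      rw [zero_mul] at h4
      exact tendsto_of_tendsto_of_tendsto_of_le_of_le tendsto_const_nhds h4 (fun _ => zero_le)
        fun K => eLpNorm_le_eLpNorm_mul_rpow_measure_univ (by norm_num) (hI c K).1
    have h4 := (ENNReal.tendsto_toReal ENNReal.zero_ne_top).comp h3
    refine h4.congr fun K => ?_
    rw [Function.comp_apply, eLpNorm_one_eq_lintegral_enorm,
      integral_norm_eq_lintegral_enorm (hI c K).1]
  -- The constant is found by integrating the averages; `K > 0` is needed to normalize them.
  have hcval : c = (μ.real univ : ℂ)⁻¹ * ∫ y, u y ∂μ := by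
    have h3 : Tendsto (fun K : ℕ => ∫ x, ((K : ℂ)⁻¹ * ∑ k ∈ Finset.range K, u (S^[k] x)
        - c) ∂μ) atTop (𝓝 0) :=
      squeeze_zero_norm (fun K => norm_integral_le_integral_norm _) h1
    have h4 : ∀ᶠ K : ℕ in atTop, ∫ x, ((K : ℂ)⁻¹ * ∑ k ∈ Finset.range K, u (S^[k] x) - c) ∂μ =
        ∫ y, u y ∂μ - μ.real univ * c := by
      filter_upwards [eventually_gt_atTop 0] with K hK
      have hik : ∀ k, Integrable (fun x => u (S^[k] x)) μ := fun k =>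
        (huk k).integrable (by norm_num)
      have hiA : Integrable (fun x => (K : ℂ)⁻¹ * ∑ k ∈ Finset.range K, u (S^[k] x)) μ :=
        (hA K).integrable (by norm_num)
      rw [integral_sub hiA (integrable_const c), integral_const_mul,
        integral_finsetSum _ fun k _ => hik k]
      have h5 : ∀ k, ∫ x, u (S^[k] x) ∂μ = ∫ y, u y ∂μ := by
        intro k
        have h6 : AEStronglyMeasurable u (μ.map S^[k]) := hu.aestronglyMeasurable
        rw [← integral_map (hmp.iterate k).measurable.aemeasurable h6, (hmp.iterate k).map_eq]
      simp only [h5, Finset.sum_const, Finset.card_range, nsmul_eq_mul, integral_const]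
      have hK0 : (K : ℂ) ≠ 0 := by exact_mod_cast hK.ne'
      rw [← mul_assoc, inv_mul_cancel₀ hK0, one_mul, Complex.real_smul]
    have h5 := tendsto_nhds_unique (tendsto_const_nhds.congr' (h4.mono fun _ h => h.symm)) h3
    have h6 : (μ.real univ : ℂ) ≠ 0 := by exact_mod_cast hμ
    rw [eq_inv_mul_iff_mul_eq₀ h6]
    exact (sub_eq_zero.1 h5).symm
  rw [← hcval]
  exact h1

/-- Functions `ζ n` that are asymptotically invariant under an ergodic transformation become
independent of the point: the integral of `w (x, ζ n x)` approaches its average over `x`. -/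
theorem tendsto_integral_sub_average (hS : Ergodic S μ) (hμ : μ.real univ ≠ 0)
    {ζ : ℕ → Ω → ℝ} (hζ : ∀ n, Measurable (ζ n)) (htight : IsTightSeq μ ζ)
    (hinv : ∀ k : ℕ, ∀ η > 0,
      Tendsto (fun n => μ.real {x | η < |ζ n (S^[k] x) - ζ n x|}) atTop (𝓝 0))
    {w : Ω → ℝ → ℂ} (hw : Measurable (Function.uncurry w)) {M : ℝ} (hM : ∀ x s, ‖w x s‖ ≤ M)
    (hmod : ∀ ε > 0, ∃ δ > 0, ∀ x s t, |s - t| ≤ δ → ‖w x s - w x t‖ ≤ ε) :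
    Tendsto (fun n => ∫ x, w x (ζ n x) ∂μ -
      ∫ x, (μ.real univ : ℂ)⁻¹ * ∫ y, w y (ζ n x) ∂μ ∂μ) atTop (𝓝 0) := by
  have hmp := hS.toMeasurePreserving
  have hws : ∀ s, Measurable fun x => w x s := fun s => hw.comp measurable_prodMk_right
  have hwint : ∀ s, Integrable (fun x => w x s) μ := fun s =>
    Integrable.of_bound (hws s).aestronglyMeasurable M (ae_of_all _ fun x => hM x s)
  have hwk : ∀ (k n : ℕ), Measurable fun x => w (S^[k] x) (ζ n x) := fun k n =>
    hw.comp ((hmp.iterate k).measurable.prodMk (hζ n))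
  have hwki : ∀ (k n : ℕ), Integrable (fun x => w (S^[k] x) (ζ n x)) μ := fun k n =>
    Integrable.of_bound (hwk k n).aestronglyMeasurable M (ae_of_all _ fun x => hM _ _)
  have hwkk : ∀ (k n : ℕ), Integrable (fun x => w (S^[k] x) (ζ n (S^[k] x))) μ := fun k n =>
    (hmp.iterate k).integrable_comp_of_integrable (hwki 0 n)
  have hΩ : Nonempty Ω := by
    by_contra hc
    rw [not_nonempty_iff] at hc
    exact hμ (by rw [Measure.eq_zero_of_isEmpty μ]; simp)
  have hM0 : 0 ≤ M := (norm_nonneg _).trans (hM hΩ.some 0)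
  have hμ0 : 0 < μ.real univ := lt_of_le_of_ne measureReal_nonneg hμ.symm
  set W : ℝ → ℂ := fun s => (μ.real univ : ℂ)⁻¹ * ∫ y, w y s ∂μ with hW
  have hWm : Measurable W := by
    have : StronglyMeasurable fun s => ∫ y, w y s ∂μ :=
      StronglyMeasurable.integral_prod_left (f := w) hw.stronglyMeasurable
    exact this.measurable.const_mul _
  have hWle : ∀ s, ‖W s‖ ≤ M := by
    intro s
    rw [hW]
    simp only [norm_mul, norm_inv, Complex.norm_real, Real.norm_eq_abs, abs_of_pos hμ0]
    rw [inv_mul_le_iff₀ hμ0]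
    refine (norm_integral_le_of_norm_le_const (ae_of_all _ fun y => hM y s)).trans_eq ?_
    rw [mul_comm]
  have hWmod : ∀ ε > 0, ∀ δ > 0, (∀ x s t, |s - t| ≤ δ → ‖w x s - w x t‖ ≤ ε) →
      ∀ s t, |s - t| ≤ δ → ‖W s - W t‖ ≤ ε := by
    intro ε _ δ _ h s t hst
    rw [hW]
    simp only
    rw [← mul_sub, ← integral_sub (hwint s) (hwint t), norm_mul, norm_inv, Complex.norm_real,
      Real.norm_eq_abs, abs_of_pos hμ0, inv_mul_le_iff₀ hμ0, mul_comm]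
    exact norm_integral_le_of_norm_le_const (ae_of_all _ fun y => h y s t hst)
  -- shifting the point while keeping the value of `ζ n`
  have step : ∀ k : ℕ, Tendsto (fun n => ∫ x, w x (ζ n x) ∂μ - ∫ x, w (S^[k] x) (ζ n x) ∂μ)
      atTop (𝓝 0) := by
    intro k
    rw [Metric.tendsto_atTop']
    intro ε hε
    obtain ⟨δ, hδ, hδw⟩ := hmod (ε / (4 * (μ.real univ + 1))) (by positivity)
    obtain ⟨N, hN⟩ := eventually_atTop.1 ((hinv k δ hδ).eventually_lt_const
      (by positivity : 0 < ε / (4 * (2 * M + 1))))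
    refine ⟨N, fun n hn => ?_⟩
    have hset : MeasurableSet {x | δ < |ζ n (S^[k] x) - ζ n x|} := measurableSet_lt
      measurable_const (((hζ n).comp (hmp.iterate k).measurable).sub (hζ n)).abs
    have h1 : ∫ x, w x (ζ n x) ∂μ = ∫ x, w (S^[k] x) (ζ n (S^[k] x)) ∂μ := by
      have h6 : AEStronglyMeasurable (fun x => w x (ζ n x)) (μ.map S^[k]) :=
        (hwk 0 n).aestronglyMeasurable
      have h7 := integral_map (hmp.iterate k).measurable.aemeasurable h6
      rwa [(hmp.iterate k).map_eq] at h7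
    have hind : Integrable ({x | δ < |ζ n (S^[k] x) - ζ n x|}.indicator fun _ => 2 * M) μ :=
      (integrable_const _).indicator hset
    rw [dist_zero_right, h1, ← integral_sub (hwkk k n) (hwki k n)]
    refine (norm_integral_le_integral_norm _).trans_lt ?_
    have h2 : ∫ x, ‖w (S^[k] x) (ζ n (S^[k] x)) - w (S^[k] x) (ζ n x)‖ ∂μ ≤
        ∫ x, (ε / (4 * (μ.real univ + 1)) +
          {x | δ < |ζ n (S^[k] x) - ζ n x|}.indicator (fun _ => 2 * M) x) ∂μ := by
      refine integral_mono ((hwkk k n).sub (hwki k n)).norm ((integrable_const _).add hind)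
        fun x => ?_
      by_cases hx : δ < |ζ n (S^[k] x) - ζ n x|
      · have hx' : x ∈ {x | δ < |ζ n (S^[k] x) - ζ n x|} := hx
        rw [indicator_of_mem hx']
        have h3 := norm_sub_le (w (S^[k] x) (ζ n (S^[k] x))) (w (S^[k] x) (ζ n x))
        have h4 : 0 ≤ ε / (4 * (μ.real univ + 1)) := by positivity
        linarith [hM (S^[k] x) (ζ n (S^[k] x)), hM (S^[k] x) (ζ n x)]
      · have hx' : x ∉ {x | δ < |ζ n (S^[k] x) - ζ n x|} := hx
        rw [indicator_of_notMem hx', add_zero]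
        exact hδw _ _ _ (not_lt.1 hx)
    rw [integral_add (integrable_const _) hind, integral_indicator hset, integral_const,
      setIntegral_const, smul_eq_mul, smul_eq_mul] at h2
    have h3 : μ.real univ * (ε / (4 * (μ.real univ + 1))) ≤ ε / 4 := by
      rw [mul_div_assoc', div_le_div_iff₀ (by positivity) (by positivity)]
      nlinarith
    have h4 : μ.real {x | δ < |ζ n (S^[k] x) - ζ n x|} * (2 * M) ≤ ε / 4 := by
      refine (mul_le_mul_of_nonneg_right (hN n hn.le).le (by positivity)).trans ?_
      rw [div_mul_eq_mul_div, div_le_div_iff₀ (by positivity) (by positivity)]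
      nlinarith
    linarith
  -- Distance of the ergodic averages from the mean, at a frozen value `s`. Averaging over `K + 1`
  -- terms avoids the empty average.
  set D : ℕ → Ω → ℝ → ℝ := fun K x s =>
    ‖((K + 1 : ℕ) : ℂ)⁻¹ * ∑ k ∈ Finset.range (K + 1), w (S^[k] x) s - W s‖ with hD
  have havg : ∀ (K : ℕ) (v : ℕ → ℂ) (B : ℝ), (∀ k, ‖v k‖ ≤ B) →
      ‖((K + 1 : ℕ) : ℂ)⁻¹ * ∑ k ∈ Finset.range (K + 1), v k‖ ≤ B := by
    intro K v B hv
    have hK : (0 : ℝ) < (K + 1 : ℕ) := by positivity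
    rw [norm_mul, norm_inv, Complex.norm_natCast, inv_mul_le_iff₀ hK]
    refine (norm_sum_le_of_le _ fun k _ => hv k).trans_eq ?_
    rw [Finset.sum_const, Finset.card_range, nsmul_eq_mul]
  have hDm : ∀ K, Measurable (Function.uncurry (D K)) := by
    intro K
    refine Measurable.norm (((Finset.measurable_fun_sum _ fun k _ => ?_).const_mul _).sub
      (hWm.comp measurable_snd))
    exact hw.comp (((hmp.iterate k).measurable.comp measurable_fst).prodMk measurable_snd)
  have hDmod : ∀ ε > 0, ∃ δ > 0, ∀ K x s t, |s - t| ≤ δ → |D K x s - D K x t| ≤ ε := by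
    intro ε hε
    obtain ⟨δ, hδ, hδw⟩ := hmod (ε / 2) (by positivity)
    refine ⟨δ, hδ, fun K x s t hst => ?_⟩
    refine (abs_norm_sub_norm_le _ _).trans ?_
    have e1 : ((K + 1 : ℕ) : ℂ)⁻¹ * ∑ k ∈ Finset.range (K + 1), w (S^[k] x) s - W s -
        (((K + 1 : ℕ) : ℂ)⁻¹ * ∑ k ∈ Finset.range (K + 1), w (S^[k] x) t - W t) =
        ((K + 1 : ℕ) : ℂ)⁻¹ * ∑ k ∈ Finset.range (K + 1), (w (S^[k] x) s - w (S^[k] x) t) -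
          (W s - W t) := by
      rw [Finset.sum_sub_distrib]; ring
    rw [e1]
    refine (norm_sub_le _ _).trans ?_
    have h1 := havg K (fun k => w (S^[k] x) s - w (S^[k] x) t) (ε / 2)
      fun k => hδw _ _ _ hst
    have h2 := hWmod (ε / 2) (by positivity) δ hδ hδw s t hst
    linarith
  have hdiag := tendsto_integral_diag (μ := μ) (M := 2 * M) hDm hζ (fun _ _ _ => norm_nonneg _)
    (fun K x s => (norm_sub_le _ _).trans (by
      linarith [havg K (fun k => w (S^[k] x) s) M fun k => hM _ _, hWle s])) hDmod htight
    (fun s => (tendsto_integral_norm_average_sub hS hμ (hws s) fun x => hM x s).comp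
      (tendsto_add_atTop_nat 1))
  rw [Metric.tendsto_atTop']
  intro ε hε
  obtain ⟨K, hK⟩ := hdiag (ε / 4) (by positivity)
  have hstepK : Tendsto (fun n => ((K + 1 : ℕ) : ℂ)⁻¹ * ∑ k ∈ Finset.range (K + 1),
      (∫ x, w x (ζ n x) ∂μ - ∫ x, w (S^[k] x) (ζ n x) ∂μ)) atTop (𝓝 0) := by
    have := (tendsto_finsetSum (Finset.range (K + 1)) fun k _ => step k).const_mul
      (((K + 1 : ℕ) : ℂ)⁻¹)
    simpa using this
  obtain ⟨N, hN⟩ := eventually_atTop.1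
    (Metric.tendsto_nhds.1 hstepK (ε / 4) (by positivity))
  refine ⟨max K N, fun n hn => ?_⟩
  have h1 := hK K le_rfl n (le_of_max_le_left hn.le)
  have h2 := hN n (le_of_max_le_right hn.le)
  have hK0 : ((K + 1 : ℕ) : ℂ) ≠ 0 := by exact_mod_cast K.succ_ne_zero
  have hWi : Integrable (fun x => W (ζ n x)) μ := Integrable.of_bound
    (hWm.comp (hζ n)).aestronglyMeasurable M (ae_of_all _ fun x => hWle _)
  have hsumi : Integrable (fun x => ((K + 1 : ℕ) : ℂ)⁻¹ * ∑ k ∈ Finset.range (K + 1),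
      w (S^[k] x) (ζ n x)) μ := (integrable_finsetSum _ fun k _ => hwki k n).const_mul _
  -- First `w (x, ζ n x)` is replaced by its average over shifted points, with `ζ n x` kept; then
  -- this average is replaced by `W (ζ n x)`.
  have hid : ∫ x, w x (ζ n x) ∂μ - ∫ x, W (ζ n x) ∂μ =
      ((K + 1 : ℕ) : ℂ)⁻¹ * ∑ k ∈ Finset.range (K + 1),
        (∫ x, w x (ζ n x) ∂μ - ∫ x, w (S^[k] x) (ζ n x) ∂μ) +
      ∫ x, (((K + 1 : ℕ) : ℂ)⁻¹ * ∑ k ∈ Finset.range (K + 1), w (S^[k] x) (ζ n x) -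
        W (ζ n x)) ∂μ := by
    have e : ∫ x, ((K + 1 : ℕ) : ℂ)⁻¹ * ∑ k ∈ Finset.range (K + 1), w (S^[k] x) (ζ n x) ∂μ =
        ((K + 1 : ℕ) : ℂ)⁻¹ * ∑ k ∈ Finset.range (K + 1), ∫ x, w (S^[k] x) (ζ n x) ∂μ := by
      rw [integral_const_mul, integral_finsetSum _ fun k _ => hwki k n]
    rw [integral_sub hsumi hWi, e,
      Finset.sum_sub_distrib, Finset.sum_const, Finset.card_range, nsmul_eq_mul]
    field_simp
    ring
  rw [dist_zero_right] at h2 ⊢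
  rw [hid]
  refine (norm_add_le _ _).trans_lt ?_
  have h3 := (norm_integral_le_integral_norm (μ := μ) fun x => ((K + 1 : ℕ) : ℂ)⁻¹ *
    ∑ k ∈ Finset.range (K + 1), w (S^[k] x) (ζ n x) - W (ζ n x)).trans h1
  linarith

end Independence

end Rigidity

/-! ### Smoothing along the fibres -/

/-- Translations act continuously on `L¹(ℝ)`. -/
theorem tendsto_integral_norm_translate_sub {k : ℝ → ℂ} (hk : Integrable k) :
    Tendsto (fun s : ℝ => ∫ t, ‖k (s + t) - k t‖) (𝓝 0) (𝓝 0) := by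
  have hp : Fact ((1 : ENNReal) ≠ ⊤) := ⟨ENNReal.one_ne_top⟩
  have hkm : MemLp k 1 volume := memLp_one_iff_integrable.2 hk
  have hc : Continuous fun s : ℝ => DomAddAct.mk s +ᵥ hkm.toLp k :=
    (continuous_id.vadd continuous_const).comp DomAddAct.continuous_mk
  have h1 : Tendsto (fun s : ℝ => dist (DomAddAct.mk s +ᵥ hkm.toLp k) (hkm.toLp k)) (𝓝 0)
      (𝓝 0) := by
    have h2 := (hc.dist (continuous_const (y := hkm.toLp k))).tendsto 0
    have h3 : DomAddAct.mk (0 : ℝ) +ᵥ hkm.toLp k = hkm.toLp k := by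
      rw [DomAddAct.mk_zero, zero_vadd]
    rwa [h3, dist_self] at h2
  refine h1.congr fun s => ?_
  rw [DomAddAct.mk_vadd_toLp, dist_eq_norm, ← MemLp.toLp_sub, L1.norm_eq_integral_norm]
  refine integral_congr_ae ?_
  filter_upwards [MemLp.coeFn_toLp ((hkm.comp_measurePreserving
    (measurePreserving_vadd s volume)).sub hkm)] with t ht
  exact congrArg norm ht

namespace IET

variable {d : ℕ} (T : IET d)

instance : LocallyCompactSpace T.Base := isLocallyClosed_Ico.locallyCompactSpace

/-- The convolution of `H` with `k` along the fibres of `I × ℝ`. -/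
noncomputable def smooth (k : ℝ → ℂ) (H : T.Base × ℝ → ℂ) (z : T.Base × ℝ) : ℂ :=
  ∫ t, k t * H (z.1, z.2 + t)

variable {T} {k : ℝ → ℂ} {H : T.Base × ℝ → ℂ} {M : ℝ}

theorem measurable_smooth (hk : Measurable k) (hH : Measurable H) :
    Measurable (T.smooth k H) := by
  have h : Measurable fun p : (T.Base × ℝ) × ℝ => k p.2 * H (p.1.1, p.1.2 + p.2) :=
    (hk.comp measurable_snd).mul (hH.comp ((measurable_fst.comp measurable_fst).prodMk
      ((measurable_snd.comp measurable_fst).add measurable_snd)))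
  exact (StronglyMeasurable.integral_prod_right (f := fun (z : T.Base × ℝ) t => k t * H (z.1, z.2 + t))
    h.stronglyMeasurable).measurable

theorem norm_smooth_le (hk : Integrable k) (hM : ∀ z, ‖H z‖ ≤ M) (z : T.Base × ℝ) :
    ‖T.smooth k H z‖ ≤ M * ∫ t, ‖k t‖ := by
  rw [← integral_const_mul]
  refine norm_integral_le_of_norm_le (hk.norm.const_mul M) (ae_of_all _ fun t => ?_)
  rw [norm_mul, mul_comm]
  exact mul_le_mul_of_nonneg_right (hM _) (norm_nonneg _)

/-- Convolution along the fibres commutes with the skew product, which acts on fibres by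
translations. -/
theorem smooth_skew_zpow {f : ℝ → ℝ} {n : ℤ} (hinv : ∀ z, H ((T.skew f ^ n) z) = H z)
    (z : T.Base × ℝ) : T.smooth k H ((T.skew f ^ n) z) = T.smooth k H z := by
  refine integral_congr_ae (ae_of_all _ fun t => ?_)
  have h := hinv (z.1, z.2 + t)
  rw [skew_zpow_apply] at h ⊢
  simp only at h ⊢
  rw [← h, add_sub_right_comm]

/-- The modulus of continuity comes from the kernel alone. This uniformity in the fibre variable is
needed because `H`, a function folded into `X^f`, is discontinuous in general. -/
theorem exists_norm_smooth_sub_le (hk : Integrable k) (hH : Measurable H) (hM : ∀ z, ‖H z‖ ≤ M)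
    {ε : ℝ} (hε : 0 < ε) : ∃ δ > 0, ∀ x s t, |s - t| ≤ δ →
      ‖T.smooth k H (x, s) - T.smooth k H (x, t)‖ ≤ ε := by
  obtain ⟨η, hη, h⟩ := Metric.tendsto_nhds_nhds.1 (tendsto_integral_norm_translate_sub hk)
    (ε / (|M| + 1)) (by positivity)
  refine ⟨η / 2, by positivity, fun x s t hst => ?_⟩
  have e : ∀ s, T.smooth k H (x, s) = ∫ r, k (r - s) * H (x, r) := fun s => by
    rw [smooth, ← integral_sub_right_eq_self _ s]
    simp
  have hi : ∀ s, Integrable fun r => k (r - s) * H (x, r) := fun s =>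
    (hk.comp_sub_right s).mul_bdd (hH.comp measurable_prodMk_left).aestronglyMeasurable
      (ae_of_all _ fun r => hM _)
  rw [e, e, ← integral_sub (hi s) (hi t)]
  have h1 : ∫ r, ‖k (r - s) - k (r - t)‖ = ∫ r, ‖k ((t - s) + r) - k r‖ := by
    rw [← integral_sub_right_eq_self (fun r => ‖k ((t - s) + r) - k r‖) t]
    refine integral_congr_ae (ae_of_all _ fun r => ?_)
    simp only
    rw [show t - s + (r - t) = r - s by ring]
  have hi2 : Integrable fun r => |M| * ‖k (r - s) - k (r - t)‖ :=
    ((hk.comp_sub_right s).sub (hk.comp_sub_right t)).norm.const_mul _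
  refine (norm_integral_le_of_norm_le hi2 (ae_of_all _ fun r => ?_)).trans ?_
  · rw [← sub_mul, norm_mul, mul_comm]
    exact mul_le_mul_of_nonneg_right ((hM _).trans (le_abs_self M)) (norm_nonneg _)
  · have h2 := h (x := t - s) (by
      rw [dist_zero_right, Real.norm_eq_abs, abs_sub_comm]; linarith)
    rw [dist_zero_right, Real.norm_of_nonneg (integral_nonneg fun _ => norm_nonneg _)] at h2
    rw [integral_const_mul, h1]
    rw [lt_div_iff₀ (by positivity)] at h2
    have h3 : 0 ≤ ∫ r, ‖k ((t - s) + r) - k r‖ := integral_nonneg fun _ => norm_nonneg _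
    nlinarith

/-! ### The return times -/

theorem ergodic_of_isGoodRigiditySeq (hT : T.IsSymmetric) {a b : ℕ → ℝ} {h : ℕ → ℕ}
    (hrig : T.IsGoodRigiditySeq a b h) : Ergodic T.map T.leb where
  toMeasurePreserving := T.measurePreserving_map
  aeconst_set := by
    intro s hs hinv
    rcases T.null_or_conull_of_isGoodRigiditySeq hT hrig hs (EventuallyEq.of_eq hinv) with h0 | h0
    · exact eventuallyConst_set'.2 (Or.inl (ae_eq_empty.2 h0))
    · exact eventuallyConst_set'.2 (Or.inr (ae_eq_univ.2 h0))

theorem tendsto_measureReal_dist_pow {a b : ℕ → ℝ} {h : ℕ → ℕ}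
    (hrig : T.IsGoodRigiditySeq a b h) {η : ℝ} (hη : 0 < η) :
    Tendsto (fun n => T.leb.real {x | η ≤ dist ((T.map ^ h n) x) x}) atTop (𝓝 0) := by
  have h1 := (ENNReal.tendsto_toReal ENNReal.zero_ne_top).comp hrig.tendsto_leb_compl
  refine squeeze_zero' (Eventually.of_forall fun _ => measureReal_nonneg) ?_ h1
  filter_upwards [hrig.tendsto_radius.eventually_lt_const hη] with n hn
  refine measureReal_mono fun x hx hxt => ?_
  have h2 := hrig.rigid n x hxt
  have hx' : η ≤ dist ((T.map ^ h n) x) x := hx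
  rw [Subtype.dist_eq, Real.dist_eq] at hx'
  linarith

theorem measurePreserving_prodMap_pow (n : ℕ) (M : ℝ) :
    MeasurePreserving (Prod.map (T.map ^ n) id)
      (T.leb.prod (volume.restrict (Icc (0 : ℝ) M)))
      (T.leb.prod (volume.restrict (Icc (0 : ℝ) M))) :=
  (T.measurePreserving_pow n).prod (MeasurePreserving.id _)


/-- The deviations `S_h(f) - c` at the rigidity times. -/
noncomputable def deviation (T : IET d) (f : ℝ → ℝ) (h : ℕ → ℕ) (c : ℕ → ℝ) (n : ℕ)
    (x : T.Base) : ℝ := T.birkhoff f (h n) x - c n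

/-! ### Asymptotic invariance and tightness of the deviations -/

section Deviation

variable {f : ℝ → ℝ} {a b : ℕ → ℝ} {h : ℕ → ℕ} {c : ℕ → ℝ}

theorem measurable_deviation (hfm : Measurable fun x : T.Base => f x) (n : ℕ) :
    Measurable (T.deviation f h c n) := (T.measurable_birkhoff hfm _).sub_const _

/-- The difference is `S_k(f) ∘ T^h - S_k(f)`, which tends to `0` in measure for fixed `k` because
`T^h` tends to the identity. -/
theorem tendsto_measureReal_deviation (hrig : T.IsGoodRigiditySeq a b h)
    (hfm : Measurable fun x : T.Base => f x) (k : ℕ) {η : ℝ} (hη : 0 < η) :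
    Tendsto (fun n => T.leb.real {x | η < |T.deviation f h c n (T.map^[k] x) -
      T.deviation f h c n x|}) atTop (𝓝 0) := by
  refine (Rigidity.tendsto_measureReal_comp_sub (μ := T.leb) (R := fun n => ⇑(T.map ^ h n))
    (fun n => T.measurePreserving_pow _) (fun η hη => tendsto_measureReal_dist_pow hrig hη)
    (T.measurable_birkhoff hfm k) hη).congr fun n => ?_
  have e : ∀ x, T.deviation f h c n (T.map^[k] x) - T.deviation f h c n x =
      T.birkhoff f k ((T.map ^ h n) x) - T.birkhoff f k x := fun x => by
    rw [Equiv.Perm.iterate_eq_pow, deviation, deviation, birkhoff_pow_apply]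
    ring
  simp only [e]

/-- Markov's inequality for the exponential moment on `good n`, plus the vanishing measure of its
complement. -/
theorem isTightSeq_deviation (hfm : Measurable fun x : T.Base => f x) {good : ℕ → Set T.Base}
    {ε K : ℝ} (hlim : Tendsto (fun n => T.leb (good n)ᶜ) atTop (𝓝 0)) (hε : 0 < ε)
    (hK : ∀ᶠ n in atTop, ∫⁻ x in good n, ENNReal.ofReal
        (Real.exp (ε * |T.deviation f h c n x|)) ∂T.leb ≤ ENNReal.ofReal K) :
    Rigidity.IsTightSeq T.leb (T.deviation f h c) := by
  intro η hη
  have h0 : Tendsto (fun R : ℝ => |K| / Real.exp (ε * R)) atTop (𝓝 0) :=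
    tendsto_const_nhds.div_atTop (Real.tendsto_exp_atTop.comp
      (tendsto_id.const_mul_atTop hε))
  obtain ⟨R, hR⟩ := (h0.eventually_le_const (half_pos hη)).exists
  refine ⟨R, ?_⟩
  have h1 := (ENNReal.tendsto_toReal ENNReal.zero_ne_top).comp hlim
  filter_upwards [hK, h1.eventually_le_const (half_pos hη)] with n hn hn2
  have hm : Measurable fun x => ENNReal.ofReal (Real.exp (ε * |T.deviation f h c n x|)) := by
    have := measurable_deviation (T := T) (h := h) (c := c) hfm n
    fun_prop
  have h2 : ENNReal.ofReal (Real.exp (ε * R)) *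
      (T.leb.restrict (good n)) {x | R < |T.deviation f h c n x|} ≤ ENNReal.ofReal |K| := by
    refine le_trans ?_ (hn.trans (ENNReal.ofReal_le_ofReal (le_abs_self K)))
    refine le_trans (mul_le_mul_right (measure_mono fun x hx => ?_) _)
      (mul_meas_ge_le_lintegral hm _)
    have hx' : R < |T.deviation f h c n x| := hx
    exact ENNReal.ofReal_le_ofReal (Real.exp_le_exp.2 (mul_le_mul_of_nonneg_left hx'.le hε.le))
  have h3 := ENNReal.toReal_mono ENNReal.ofReal_ne_top h2
  rw [ENNReal.toReal_mul, ENNReal.toReal_ofReal (Real.exp_pos _).le,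
    ENNReal.toReal_ofReal (abs_nonneg K), mul_comm, ← le_div_iff₀ (Real.exp_pos _)] at h3
  have hset : MeasurableSet {x | R < |T.deviation f h c n x|} :=
    measurableSet_lt measurable_const (measurable_deviation hfm n).abs
  have h4 : T.leb.real {x | R < |T.deviation f h c n x|} ≤
      T.leb.real ({x | R < |T.deviation f h c n x|} ∩ good n) + T.leb.real (good n)ᶜ := by
    refine (measureReal_mono fun x hx => ?_).trans (measureReal_union_le _ _)
    by_cases hg : x ∈ good n
    · exact Or.inl ⟨hx, hg⟩
    · exact Or.inr hg
  rw [Measure.restrict_apply hset] at h3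
  have h5 : T.leb.real (good n)ᶜ ≤ η / 2 := hn2
  have h6 : T.leb.real ({x | R < |T.deviation f h c n x|} ∩ good n) ≤ η / 2 := h3.trans hR
  linarith

end Deviation

end IET

/-! ### The smoothed correlations along the rigidity times -/

namespace IET

variable {d : ℕ} (T : IET d)

/-- Lebesgue measure on the strip `I × [0, M]`. -/
noncomputable abbrev strip (M : ℝ) : Measure (T.Base × ℝ) :=
  T.leb.prod (volume.restrict (Icc 0 M))

/-- The correlation of the smoothing of `H`, shifted by `s`, with `g`, on the strip. -/
noncomputable def corr (k : ℝ → ℂ) (H g : T.Base × ℝ → ℂ) (M s : ℝ) : ℂ :=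
  ∫ z, T.smooth k H (z.1, z.2 + s) * g z ∂T.strip M

variable {T}

theorem strip_real_setOf_fst (M : ℝ) (s : Set T.Base) :
    (T.strip M).real {z | z.1 ∈ s} = T.leb.real s * volume.real (Icc 0 M) := by
  have : {z : T.Base × ℝ | z.1 ∈ s} = s ×ˢ univ := by
    ext z; simp
  rw [this, measureReal_def, Measure.prod_prod, ENNReal.toReal_mul]
  simp [measureReal_def]

variable {f : ℝ → ℝ} {a b : ℕ → ℝ} {h : ℕ → ℕ} {c : ℕ → ℝ} {k : ℝ → ℂ} {H g : T.Base × ℝ → ℂ}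
  {M B B' : ℝ}

theorem isTightSeq_deviation_fst (htight : Rigidity.IsTightSeq T.leb (T.deviation f h c)) (M : ℝ) :
    Rigidity.IsTightSeq (T.strip M) fun n z => -T.deviation f h c n z.1 := by
  intro ε hε
  obtain ⟨R, hR⟩ := htight (ε / (volume.real (Icc 0 M) + 1)) (by positivity)
  refine ⟨R, hR.mono fun n hn => ?_⟩
  simp only [abs_neg]
  have h1 := strip_real_setOf_fst M {x | R < |T.deviation f h c n x|}
  refine (show (T.strip M).real {z | R < |T.deviation f h c n z.1|} = _ from h1).trans_le ?_
  have h2 : 0 ≤ volume.real (Icc 0 M) := measureReal_nonneg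
  rw [le_div_iff₀ (by positivity)] at hn
  have h3 : 0 ≤ T.leb.real {x | R < |T.deviation f h c n x|} := measureReal_nonneg
  nlinarith

theorem tendsto_strip_dist (hrig : T.IsGoodRigiditySeq a b h) (M : ℝ) {η : ℝ} (hη : 0 < η) :
    Tendsto (fun n => (T.strip M).real {z | η ≤ dist (Prod.map (T.map ^ h n) id z) z}) atTop
      (𝓝 0) := by
  have h1 := (tendsto_measureReal_dist_pow hrig hη).mul_const (volume.real (Icc 0 M))
  rw [zero_mul] at h1
  refine h1.congr fun n => ?_
  rw [← strip_real_setOf_fst]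
  congr 1
  ext z
  simp [Prod.dist_eq]

/-- Shifting by `c n` can be replaced by shifting by the random variable `-(S_h(f) - c n)`. -/
theorem tendsto_corr_sub_integral (hrig : T.IsGoodRigiditySeq a b h)
    (hfm : Measurable fun x : T.Base => f x)
    (htight : Rigidity.IsTightSeq T.leb (T.deviation f h c))
    (hkm : Measurable k) (hk : Integrable k) (hH : Measurable H) (hHB : ∀ z, ‖H z‖ ≤ B)
    (hinv : ∀ (n : ℤ) z, H ((T.skew f ^ n) z) = H z)
    (hg : Measurable g) (hgB : ∀ z, ‖g z‖ ≤ B') :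
    Tendsto (fun n => T.corr k H g M (c n) -
      ∫ z, T.smooth k H (z.1, z.2 - T.deviation f h c n z.1) * g z ∂T.strip M) atTop (𝓝 0) := by
  have hF := measurable_smooth hkm hH
  have hFB := norm_smooth_le hk hHB
  set L := B * ∫ t, ‖k t‖ with hL
  have hdev := fun n => measurable_deviation (T := T) (h := h) (c := c) hfm n
  -- The effect of replacing `T^h x` by `x` at a fixed height, to be evaluated at the random shift
  -- `-ζ n`.
  set D : ℕ → T.Base × ℝ → ℝ → ℝ := fun n z s =>
    ‖T.smooth k H ((T.map ^ h n) z.1, z.2 + s) - T.smooth k H (z.1, z.2 + s)‖ with hD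
  have hDm : ∀ n, Measurable (Function.uncurry (D n)) := fun n => by
    have h1 := (T.measurePreserving_pow (h n)).measurable
    exact ((hF.comp ((h1.comp (measurable_fst.comp measurable_fst)).prodMk
      ((measurable_snd.comp measurable_fst).add measurable_snd))).sub
      (hF.comp ((measurable_fst.comp measurable_fst).prodMk
      ((measurable_snd.comp measurable_fst).add measurable_snd)))).norm
  have hDL : ∀ n z s, D n z s ≤ 2 * L := fun n z s =>
    (norm_sub_le _ _).trans (by linarith [hFB ((T.map ^ h n) z.1, z.2 + s), hFB (z.1, z.2 + s)])
  have hDmod : ∀ ε > 0, ∃ δ > 0, ∀ n z s t, |s - t| ≤ δ → |D n z s - D n z t| ≤ ε := by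
    intro ε hε
    obtain ⟨δ, hδ, hδF⟩ := exists_norm_smooth_sub_le hk hH hHB (half_pos hε)
    refine ⟨δ, hδ, fun n z s t hst => (abs_norm_sub_norm_le _ _).trans ?_⟩
    rw [sub_sub_sub_comm]
    have h1 : |z.2 + s - (z.2 + t)| ≤ δ := by rwa [add_sub_add_left_eq_sub]
    exact (norm_sub_le _ _).trans (by
      linarith [hδF ((T.map ^ h n) z.1) _ _ h1, hδF z.1 _ _ h1])
  have hlim : ∀ s, Tendsto (fun n => ∫ z, D n z s ∂T.strip M) atTop (𝓝 0) := by
    intro s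
    have hu : Measurable fun z : T.Base × ℝ => T.smooth k H (z.1, z.2 + s) :=
      hF.comp (measurable_fst.prodMk (measurable_snd.add_const s))
    exact Rigidity.tendsto_integral_norm_comp_sub (μ := T.strip M)
      (R := fun n => Prod.map ⇑(T.map ^ h n) id) (fun n => measurePreserving_prodMap_pow _ M)
      (fun η hη => tendsto_strip_dist hrig M hη)
      (Integrable.of_bound hu.aestronglyMeasurable L (ae_of_all _ fun z => hFB _))
  have hdiag := Rigidity.tendsto_integral_diag hDm
    (fun n => ((hdev n).comp measurable_fst).neg) (fun _ _ _ => norm_nonneg _) hDL hDmod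
    (isTightSeq_deviation_fst htight M) hlim
  -- Applying the skew product `h n` times trades the shift `c n` over `x` for the
  -- bounded-in-probability shift `-ζ n x` over `T^h x`.
  have hFh : ∀ n (z : T.Base × ℝ), T.smooth k H (z.1, z.2 + c n) =
      T.smooth k H ((T.map ^ h n) z.1, z.2 + -T.deviation f h c n z.1) := by
    intro n z
    rw [← smooth_skew_zpow (hinv (h n)) (z.1, z.2 + c n), skew_zpow_apply, deviation, zpow_natCast]
    congr 2
    ring
  have hm1 : ∀ n, Measurable fun z : T.Base × ℝ => T.smooth k H (z.1, z.2 + c n) := fun n =>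
    hF.comp (measurable_fst.prodMk (measurable_snd.add_const _))
  have hm2 : ∀ n, Measurable fun z : T.Base × ℝ =>
      T.smooth k H (z.1, z.2 - T.deviation f h c n z.1) := fun n =>
    hF.comp (measurable_fst.prodMk (measurable_snd.sub ((hdev n).comp measurable_fst)))
  have hi : ∀ {u : T.Base × ℝ → ℂ}, Measurable u → (∀ z, ‖u z‖ ≤ L) →
      Integrable (fun z => u z * g z) (T.strip M) := fun hu huL =>
    (Integrable.of_bound hu.aestronglyMeasurable L (ae_of_all _ huL)).mul_bdd
      hg.aestronglyMeasurable (ae_of_all _ hgB)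
  rw [Metric.tendsto_atTop]
  intro ε hε
  obtain ⟨N, hN⟩ := hdiag (ε / (2 * (|B'| + 1))) (by positivity)
  refine ⟨N, fun n hn => ?_⟩
  rw [dist_zero_right, corr, ← integral_sub (hi (hm1 n) fun z => hFB _) (hi (hm2 n) fun z => hFB _)]
  have hDi : Integrable (fun z => |B'| * D n z (-T.deviation f h c n z.1)) (T.strip M) :=
    (Integrable.of_bound ((hDm n).comp (measurable_id.prodMk
      ((hdev n).comp measurable_fst).neg)).aestronglyMeasurable (2 * L) (ae_of_all _ fun z => by
        exact (norm_norm _).trans_le (hDL n z _))).const_mul _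
  refine (norm_integral_le_of_norm_le hDi (ae_of_all _ fun z => ?_)).trans_lt ?_
  · rw [← sub_mul, norm_mul, mul_comm, hFh, sub_eq_add_neg]
    exact mul_le_mul_of_nonneg_right ((hgB z).trans (le_abs_self _)) (norm_nonneg _)
  · rw [integral_const_mul]
    refine (mul_le_mul_of_nonneg_left (hN n hn n hn) (abs_nonneg _)).trans_lt ?_
    rw [mul_div_assoc', div_lt_iff₀ (by positivity)]
    nlinarith [abs_nonneg B']

/-- After the replacement of `T^h x` by `x`, integration over the fibre leaves a function of `x` and
`ζ n x`, to which asymptotic independence applies. -/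
theorem tendsto_corr_sub_average (hT : T.IsSymmetric) (hrig : T.IsGoodRigiditySeq a b h)
    (hfm : Measurable fun x : T.Base => f x)
    (htight : Rigidity.IsTightSeq T.leb (T.deviation f h c))
    (hkm : Measurable k) (hk : Integrable k) (hH : Measurable H) (hHB : ∀ z, ‖H z‖ ≤ B)
    (hinv : ∀ (n : ℤ) z, H ((T.skew f ^ n) z) = H z)
    (hg : Measurable g) (hgB : ∀ z, ‖g z‖ ≤ B') :
    Tendsto (fun n => T.corr k H g M (c n) - ∫ x, (T.leb.real univ : ℂ)⁻¹ *
      T.corr k H g M (-T.deviation f h c n x) ∂T.leb) atTop (𝓝 0) := by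
  have hF := measurable_smooth hkm hH
  have hFB := norm_smooth_le hk hHB
  set L := B * ∫ t, ‖k t‖ with hL
  have hdev := fun n => measurable_deviation (T := T) (h := h) (c := c) hfm n
  have hLpos := T.length_pos_of_isTower (hrig.isTower 0)
  have hμ : T.leb.real univ ≠ 0 := by
    rw [measureReal_def, leb_univ, ENNReal.toReal_ofReal hLpos.le]
    exact hLpos.ne'
  have hL0 : 0 ≤ L := (norm_nonneg _).trans (hFB (⟨0, le_rfl, hLpos⟩, 0))
  set w : T.Base → ℝ → ℂ := fun x s => ∫ r in Icc 0 M, T.smooth k H (x, r - s) * g (x, r) with hw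
  have hwm : Measurable (Function.uncurry w) := by
    have h1 : Measurable fun p : (T.Base × ℝ) × ℝ =>
        T.smooth k H (p.1.1, p.2 - p.1.2) * g (p.1.1, p.2) :=
      (hF.comp ((measurable_fst.comp measurable_fst).prodMk
        (measurable_snd.sub (measurable_snd.comp measurable_fst)))).mul
      (hg.comp ((measurable_fst.comp measurable_fst).prodMk measurable_snd))
    exact (StronglyMeasurable.integral_prod_right (ν := volume.restrict (Icc 0 M))
      (f := fun (z : T.Base × ℝ) r => T.smooth k H (z.1, r - z.2) * g (z.1, r))
      h1.stronglyMeasurable).measurable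
  have hwB : ∀ x s, ‖w x s‖ ≤ L * |B'| * volume.real (Icc 0 M) := fun x s => by
    refine (norm_setIntegral_le_of_norm_le_const (by simp) fun r _ => ?_)
    rw [norm_mul]
    exact mul_le_mul (hFB _) ((hgB _).trans (le_abs_self _)) (norm_nonneg _) hL0
  have hsec : ∀ x s, Integrable (fun r => T.smooth k H (x, r - s) * g (x, r))
      (volume.restrict (Icc 0 M)) := fun x s =>
    (Integrable.of_bound (hF.comp (measurable_const.prodMk
      (measurable_id.sub_const s))).aestronglyMeasurable L (ae_of_all _ fun r => hFB _)).mul_bdd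
      (hg.comp measurable_prodMk_left).aestronglyMeasurable (ae_of_all _ fun r => hgB _)
  have hwmod : ∀ ε > 0, ∃ δ > 0, ∀ x s t, |s - t| ≤ δ → ‖w x s - w x t‖ ≤ ε := by
    intro ε hε
    have hV : 0 ≤ volume.real (Icc 0 M) := measureReal_nonneg
    obtain ⟨δ, hδ, hδF⟩ := exists_norm_smooth_sub_le hk hH hHB
      (by positivity : 0 < ε / ((|B'| + 1) * (volume.real (Icc 0 M) + 1)))
    refine ⟨δ, hδ, fun x s t hst => ?_⟩
    rw [hw]
    simp only
    rw [← integral_sub (hsec x s) (hsec x t)]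
    refine (norm_setIntegral_le_of_norm_le_const
      (C := ε / ((|B'| + 1) * (volume.real (Icc 0 M) + 1)) * (|B'| + 1)) (by simp)
      fun r _ => ?_).trans ?_
    · rw [← sub_mul, norm_mul]
      refine mul_le_mul (hδF x _ _ ?_) ((hgB _).trans ((le_abs_self _).trans (by linarith)))
        (norm_nonneg _) (by positivity)
      rwa [sub_sub_sub_cancel_left, abs_sub_comm]
    · rw [div_mul_eq_mul_div, div_mul_eq_mul_div, div_le_iff₀ (by positivity)]
      nlinarith [mul_nonneg hε.le (by positivity : 0 ≤ |B'| + 1)]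
  have havg := Rigidity.tendsto_integral_sub_average (ergodic_of_isGoodRigiditySeq hT hrig) hμ hdev
    htight (fun k η hη => tendsto_measureReal_deviation hrig hfm k hη) hwm hwB hwmod
  have h1 := (tendsto_corr_sub_integral (M := M) hrig hfm htight hkm hk hH hHB hinv hg hgB).add havg
  rw [add_zero] at h1
  have hprod : ∀ (v : T.Base → ℝ), Measurable v →
      ∫ z, T.smooth k H (z.1, z.2 - v z.1) * g z ∂T.strip M = ∫ x, w x (v x) ∂T.leb := by
    intro v hv
    refine integral_prod _ ?_
    exact (Integrable.of_bound (hF.comp (measurable_fst.prodMk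
      (measurable_snd.sub (hv.comp measurable_fst)))).aestronglyMeasurable L
      (ae_of_all _ fun r => hFB _)).mul_bdd hg.aestronglyMeasurable (ae_of_all _ hgB)
  refine h1.congr fun n => ?_
  rw [hprod _ (hdev n), sub_add_sub_cancel]
  congr 1
  refine integral_congr_ae (ae_of_all _ fun x => ?_)
  have h2 := hprod (fun _ => T.deviation f h c n x) measurable_const
  simp only [sub_eq_add_neg] at h2 ⊢
  rw [corr, h2]

end IET

/-! ### Singularity from the decay of the correlations -/

open ProbabilityTheory in
-- An exponential moment makes the characteristic function real analytic. It equals `1` at `0`, so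
-- its zeros are isolated and form a null set.
theorem ae_charFun_ne_zero {P : Measure ℝ} [IsProbabilityMeasure P] {ε : ℝ} (hε : 0 < ε)
    (hint : Integrable (fun x => Real.exp (ε * |x|)) P) : ∀ᵐ u : ℝ, charFun P u ≠ 0 := by
  have h0 : (0 : ℝ) ∈ interior (integrableExpSet id P) := by
    rw [mem_interior_iff_mem_nhds]
    refine mem_of_superset (Ioo_mem_nhds (neg_lt_zero.2 hε) hε) fun t ht => ?_
    refine hint.mono' (by fun_prop) (ae_of_all _ fun x => ?_)
    rw [Real.norm_of_nonneg (Real.exp_pos _).le, Real.exp_le_exp]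
    refine (le_abs_self _).trans ?_
    rw [abs_mul]
    exact mul_le_mul_of_nonneg_right (abs_le.2 ⟨ht.1.le, ht.2.le⟩) (abs_nonneg _)
  have han : AnalyticOnNhd ℝ (charFun P) univ := by
    have e : charFun P = fun t : ℝ => complexMGF id P (t * Complex.I) := by
      ext t; rw [complexMGF_id_mul_I]
    rw [e]
    intro t _
    have h1 : AnalyticAt ℂ (complexMGF id P) (t * Complex.I) :=
      analyticAt_complexMGF (by simpa using h0)
    have h2 : AnalyticAt ℝ (fun t : ℝ => (t : ℂ) * Complex.I) t :=
      (Complex.ofRealCLM.analyticAt t).mul analyticAt_const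
    exact AnalyticAt.comp (f := fun t : ℝ => (t : ℂ) * Complex.I)
      (h1.restrictScalars (𝕜 := ℝ)) h2
  rcases han.eqOn_zero_or_eventually_ne_zero_of_preconnected isPreconnected_univ with h | h
  · have h1 := h (mem_univ 0)
    simp at h1
  · have h1 := ae_restrict_le_codiscreteWithin (μ := (volume : Measure ℝ)) MeasurableSet.univ h
    rwa [Measure.restrict_univ] at h1

/-- A sequence of probability measures with asymptotically bounded exponential moments has a
convergent subsequence, and the limit has an exponential moment. -/
theorem exists_tendsto_of_exp_moment {Q : ℕ → ProbabilityMeasure ℝ} {ε K : ℝ} (hε : 0 < ε)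
    (hK : ∀ B : ℝ, ∀ᶠ n in atTop, ∫ x, min (Real.exp (ε * |x|)) B ∂(Q n : Measure ℝ) ≤ K) :
    ∃ (φ : ℕ → ℕ) (P : ProbabilityMeasure ℝ), StrictMono φ ∧
      Tendsto (fun n => Q (φ n)) atTop (𝓝 P) ∧
      Integrable (fun x => Real.exp (ε * |x|)) (P : Measure ℝ) := by
  have hmin : ∀ (B : ℝ) (hB : 0 ≤ B) (x : ℝ), ‖min (Real.exp (ε * |x|)) B‖ ≤ B := fun B hB x => by
    rw [Real.norm_of_nonneg (le_min (Real.exp_pos _).le hB)]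
    exact min_le_right _ _
  have hint : ∀ (B : ℝ), 0 ≤ B → ∀ R : ProbabilityMeasure ℝ,
      Integrable (fun x => min (Real.exp (ε * |x|)) B) (R : Measure ℝ) := fun B hB R =>
    Integrable.of_bound (by fun_prop) B (ae_of_all _ (hmin B hB))
  -- Markov's inequality for the moment truncated at the very level `exp (ε r)` being tested.
  have htight : IsTightMeasureSet (range fun n => (Q n : Measure ℝ)) := by
    refine isTightMeasureSet_range_of_tendsto_limsup_measure_norm_gt ?_
    have h1 : Tendsto (fun r : ℝ => ENNReal.ofReal (K / Real.exp (ε * r))) atTop (𝓝 0) := by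
      rw [← ENNReal.ofReal_zero]
      exact (ENNReal.continuous_ofReal.tendsto _).comp (tendsto_const_nhds.div_atTop
        (Real.tendsto_exp_atTop.comp (tendsto_id.const_mul_atTop hε)))
    refine tendsto_of_tendsto_of_tendsto_of_le_of_le tendsto_const_nhds h1 (fun _ => zero_le)
      fun r => ?_
    refine limsup_le_of_le (by isBoundedDefault) ?_
    filter_upwards [hK (Real.exp (ε * r))] with n hn
    have h2 := mul_meas_ge_le_integral_of_nonneg (μ := (Q n : Measure ℝ)) (ae_of_all _ fun x =>
      le_min (Real.exp_pos (ε * |x|)).le (Real.exp_pos (ε * r)).le)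
      (hint _ (Real.exp_pos _).le (Q n)) (Real.exp (ε * r))
    rw [mul_comm, ← le_div_iff₀ (Real.exp_pos _)] at h2
    have h3 := h2.trans (div_le_div_of_nonneg_right hn (Real.exp_pos _).le)
    rw [measureReal_def] at h3
    rw [← ENNReal.ofReal_toReal (measure_ne_top (Q n : Measure ℝ) _)]
    refine ENNReal.ofReal_le_ofReal (le_trans ?_ h3)
    refine ENNReal.toReal_mono (measure_ne_top _ _) (measure_mono fun x hx => ?_)
    have hx' : r < |x| := hx
    exact le_min (Real.exp_le_exp.2 (mul_le_mul_of_nonneg_left hx'.le hε.le)) le_rfl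
  have hcomp : IsCompact (closure (range Q)) := isCompact_closure_of_isTightMeasureSet (by
    convert! htight using 1
    ext μ
    simp)
  obtain ⟨P, -, φ, hφ, hP⟩ := hcomp.tendsto_subseq fun n => subset_closure (mem_range_self (f := Q) n)
  refine ⟨φ, P, hφ, hP, ?_⟩
  -- Truncated moments are integrals of bounded continuous functions and pass to the limit; Fatou's
  -- lemma then removes the truncation.
  have hPB : ∀ B : ℝ, 0 ≤ B → ∫ x, min (Real.exp (ε * |x|)) B ∂(P : Measure ℝ) ≤ K := by
    intro B hB
    let g : BoundedContinuousFunction ℝ ℝ := BoundedContinuousFunction.ofNormedAddCommGroup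
      (fun x => min (Real.exp (ε * |x|)) B) (by fun_prop) B (hmin B hB)
    have h1 := ProbabilityMeasure.tendsto_iff_forall_integral_tendsto.1 hP g
    exact le_of_tendsto h1 (hφ.tendsto_atTop.eventually (hK B))
  refine ⟨by fun_prop, ?_⟩
  rw [hasFiniteIntegral_iff_ofReal (ae_of_all _ fun x => (Real.exp_pos _).le)]
  have h1 : ∀ x : ℝ, Tendsto (fun n : ℕ => ENNReal.ofReal (min (Real.exp (ε * |x|)) n)) atTop
      (𝓝 (ENNReal.ofReal (Real.exp (ε * |x|)))) := fun x => by
    refine tendsto_const_nhds.congr' ?_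
    filter_upwards [tendsto_natCast_atTop_atTop.eventually_ge_atTop (Real.exp (ε * |x|))] with n hn
    rw [min_eq_left hn]
  calc ∫⁻ x, ENNReal.ofReal (Real.exp (ε * |x|)) ∂(P : Measure ℝ)
      = ∫⁻ x, liminf (fun n : ℕ => ENNReal.ofReal (min (Real.exp (ε * |x|)) n)) atTop
          ∂(P : Measure ℝ) := lintegral_congr fun x => (h1 x).liminf_eq.symm
    _ ≤ liminf (fun n : ℕ => ∫⁻ x, ENNReal.ofReal (min (Real.exp (ε * |x|)) n)
          ∂(P : Measure ℝ)) atTop := lintegral_liminf_le fun n => by fun_prop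
    _ ≤ ENNReal.ofReal K := by
        refine liminf_le_of_le (by isBoundedDefault) fun b hb => ?_
        obtain ⟨n, hn⟩ := hb.exists
        refine hn.trans ?_
        rw [← ofReal_integral_eq_lintegral_ofReal (hint n n.cast_nonneg P)
          (ae_of_all _ fun x => le_min (Real.exp_pos _).le n.cast_nonneg)]
        exact ENNReal.ofReal_le_ofReal (hPB n n.cast_nonneg)
    _ < ⊤ := ENNReal.ofReal_lt_top

/-! ### Weak limits of exponentials exclude an absolutely continuous part -/

section Singular

variable {σ : Measure ℝ} [IsFiniteMeasure σ]

theorem norm_cexp_I_mul (s u : ℝ) : ‖Complex.exp (Complex.I * s * u)‖ = 1 := by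
  rw [mul_assoc, ← Complex.ofReal_mul, mul_comm, Complex.norm_exp_ofReal_mul_I]

omit [IsFiniteMeasure σ] in
theorem integrable_mul_cexp {θ : ℝ → ℂ} (hθ : Integrable θ σ) (s : ℝ) :
    Integrable (fun u : ℝ => θ u * Complex.exp (Complex.I * s * u)) σ :=
  hθ.mul_bdd (c := 1) (by fun_prop) (ae_of_all _ fun u => (norm_cexp_I_mul s u).le)

/-- Smooth compactly supported functions are dense in `L¹(σ)`, and all multipliers involved are
bounded by `1`. -/
theorem tendsto_integral_mul_cexp_of_schwartz {s : ℕ → ℝ} {χ : ℝ → ℂ} (hχm : Measurable χ)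
    (hχ : ∀ u, ‖χ u‖ ≤ 1)
    (h : ∀ θ : SchwartzMap ℝ ℂ, Tendsto (fun n => ∫ u, θ u * Complex.exp (Complex.I * s n * u) ∂σ)
      atTop (𝓝 (∫ u, θ u * χ u ∂σ))) {f : ℝ → ℂ} (hf : Integrable f σ) :
    Tendsto (fun n => ∫ u, f u * Complex.exp (Complex.I * s n * u) ∂σ) atTop
      (𝓝 (∫ u, f u * χ u ∂σ)) := by
  rw [Metric.tendsto_atTop]
  intro ε hε
  obtain ⟨g, hg1, hg2, hg3⟩ := MemLp.exist_eLpNorm_sub_le ENNReal.one_ne_top le_rfl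
    (memLp_one_iff_integrable.2 hf) (by positivity : 0 < ε / 3)
  set θ : SchwartzMap ℝ ℂ := hg1.toSchwartzMap hg2
  have hθg : ∀ u, θ u = g u := fun u => rfl
  have hgi : Integrable g σ := hg2.continuous.integrable_of_hasCompactSupport hg1
  have hfg : ∫ u, ‖f u - g u‖ ∂σ ≤ ε / 3 := by
    have h1 := ENNReal.toReal_mono ENNReal.ofReal_ne_top hg3
    rw [ENNReal.toReal_ofReal (by positivity)] at h1
    rw [eLpNorm_one_eq_lintegral_enorm,
      ← integral_norm_eq_lintegral_enorm (hf.sub hgi).aestronglyMeasurable] at h1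
    exact h1
  have hkey : ∀ e : ℝ → ℂ, Measurable e → (∀ u, ‖e u‖ ≤ 1) →
      ‖∫ u, f u * e u ∂σ - ∫ u, θ u * e u ∂σ‖ ≤ ε / 3 := by
    intro e he he1
    simp only [hθg]
    rw [← integral_sub (hf.mul_bdd (c := 1) he.aestronglyMeasurable (ae_of_all _ he1))
      (hgi.mul_bdd (c := 1) he.aestronglyMeasurable (ae_of_all _ he1))]
    refine (norm_integral_le_of_norm_le (hf.sub hgi).norm (ae_of_all _ fun u => ?_)).trans hfg
    rw [← sub_mul, norm_mul]
    exact mul_le_of_le_one_right (norm_nonneg _) (he1 u)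
  obtain ⟨N, hN⟩ := Metric.tendsto_atTop.1 (h θ) (ε / 3) (by positivity)
  refine ⟨N, fun n hn => ?_⟩
  have h1 := hkey (fun u => Complex.exp (Complex.I * s n * u)) (by fun_prop)
    fun u => (norm_cexp_I_mul _ u).le
  have h2 := hkey χ hχm hχ
  have h3 := hN n hn
  rw [← dist_eq_norm] at h1 h2
  rw [dist_comm] at h2
  have h4 := dist_triangle4 (∫ u, f u * Complex.exp (Complex.I * s n * u) ∂σ)
    (∫ u, θ u * Complex.exp (Complex.I * s n * u) ∂σ) (∫ u, θ u * χ u ∂σ) (∫ u, f u * χ u ∂σ)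
  linarith

theorem tendsto_integral_mul_cexp_smul_cocompact (r : ℝ → ℂ) {s : ℕ → ℝ}
    (hs : Tendsto s atTop atTop) :
    Tendsto (fun n => ∫ u, r u * Complex.exp (Complex.I * s n * u)) atTop (𝓝 0) := by
  have h1 : Tendsto (fun n => -(s n / (2 * Real.pi))) atTop (cocompact ℝ) := by
    refine (tendsto_neg_atTop_atBot.comp (hs.atTop_div_const (by positivity))).mono_right ?_
    exact atBot_le_cocompact
  refine ((Real.tendsto_integral_exp_smul_cocompact r).comp h1).congr fun n => ?_
  refine integral_congr_ae (ae_of_all _ fun u => ?_)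
  simp only
  rw [Circle.smul_def, smul_eq_mul, mul_comm, Real.fourierChar_apply]
  congr 2
  push_cast
  have : (Real.pi : ℂ) ≠ 0 := by exact_mod_cast Real.pi_ne_zero
  field_simp

/-- On the absolutely continuous part the exponentials tend weakly to `0` as well as to `χ`, so `χ`
vanishes there; since `χ ≠ 0` almost everywhere, that part is zero. -/
theorem mutuallySingular_of_tendsto_integral_mul_cexp {s : ℕ → ℝ} (hs : Tendsto s atTop atTop)
    {χ : ℝ → ℂ} (hχm : Measurable χ) (hχ : ∀ u, ‖χ u‖ ≤ 1) (hχ0 : ∀ᵐ u : ℝ, χ u ≠ 0)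
    (h : ∀ f : ℝ → ℂ, Integrable f σ →
      Tendsto (fun n => ∫ u, f u * Complex.exp (Complex.I * s n * u) ∂σ) atTop
        (𝓝 (∫ u, f u * χ u ∂σ))) :
    σ.MutuallySingular volume := by
  -- `E` is null for the singular part and conull for Lebesgue measure, so it carries exactly the
  -- absolutely continuous part.
  obtain ⟨E, hE, hE1, hE2⟩ := σ.mutuallySingular_singularPart volume
  have hσE : σ.restrict E = volume.withDensity (σ.rnDeriv volume) := by
    have h1 : (volume.withDensity (σ.rnDeriv volume)) Eᶜ = 0 := withDensity_absolutelyContinuous _ _ hE2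
    conv_lhs => rw [← σ.singularPart_add_rnDeriv volume]
    rw [Measure.restrict_add, Measure.restrict_eq_zero.2 hE1, zero_add]
    exact Measure.restrict_eq_self_of_ae_mem (mem_ae_iff.2 h1)
  -- Testing against the conjugate of `χ` on `E` makes the limit equal to `∫_E |χ|²`.
  set f : ℝ → ℂ := E.indicator fun u => (starRingEnd ℂ) (χ u) with hf
  have hχc : Measurable fun u => (starRingEnd ℂ) (χ u) :=
    (Complex.continuous_conj.measurable).comp hχm
  have hfm : Measurable f := hχc.indicator hE
  have hf1 : ∀ u, ‖f u‖ ≤ 1 := fun u => by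
    refine (norm_indicator_le_norm_self _ _).trans ?_
    rw [RCLike.norm_conj]; exact hχ u
  have hfi : Integrable f σ := Integrable.of_bound hfm.aestronglyMeasurable 1 (ae_of_all _ hf1)
  have hE3 : ∀ e : ℝ → ℂ, ∫ u, f u * e u ∂σ = ∫ u in E, (starRingEnd ℂ) (χ u) * e u ∂σ := by
    intro e
    rw [← integral_indicator hE]
    refine integral_congr_ae (ae_of_all _ fun u => ?_)
    simp only [hf, indicator]
    split_ifs <;> simp
  have h0 : Tendsto (fun n => ∫ u, f u * Complex.exp (Complex.I * s n * u) ∂σ) atTop (𝓝 0) := by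
    refine (tendsto_integral_mul_cexp_smul_cocompact
      (fun u => ((σ.rnDeriv volume u).toReal : ℂ) * (starRingEnd ℂ) (χ u)) hs).congr fun n => ?_
    rw [hE3, hσE, integral_withDensity_eq_integral_toReal_smul (σ.measurable_rnDeriv _)
      (σ.rnDeriv_lt_top _)]
    refine integral_congr_ae (ae_of_all _ fun u => ?_)
    simp only [Complex.real_smul, mul_assoc]
  have h1 := tendsto_nhds_unique (h f hfi) h0
  rw [hE3] at h1
  have h2 : ∫ u in E, ‖χ u‖ ^ 2 ∂σ = 0 := by
    have h3 : ∀ u, (starRingEnd ℂ) (χ u) * χ u = ((‖χ u‖ ^ 2 : ℝ) : ℂ) := fun u => by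
      rw [Complex.conj_mul']; push_cast; rfl
    simp only [h3] at h1
    rw [integral_complex_ofReal] at h1
    exact_mod_cast h1
  have h3 : Integrable (fun u => ‖χ u‖ ^ 2) (σ.restrict E) :=
    Integrable.of_bound (by fun_prop) 1 (ae_of_all _ fun u => by
      rw [Real.norm_of_nonneg (by positivity)]
      exact pow_le_one₀ (norm_nonneg _) (hχ u))
  rw [integral_eq_zero_iff_of_nonneg (fun u => by positivity) h3] at h2
  have h4 : ∀ᵐ u ∂σ.restrict E, χ u ≠ 0 := by
    rw [hσE]; exact (withDensity_absolutelyContinuous _ _).ae_le hχ0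
  have h5 : ∀ᵐ u ∂σ.restrict E, False := by
    filter_upwards [h2, h4] with u hu hu'
    exact hu' (by simpa using hu)
  refine ⟨E, hE, ?_, hE2⟩
  rwa [ae_iff, not_false_eq_true, show {u : ℝ | True} = univ from rfl,
    Measure.restrict_apply_univ] at h5

theorem mutuallySingular_of_tendsto_correlation {c : ℕ → ℝ} (hc : Tendsto c atTop atTop)
    {Q : ℕ → ProbabilityMeasure ℝ} {ε K : ℝ} (hε : 0 < ε)
    (hK : ∀ B : ℝ, ∀ᶠ n in atTop, ∫ x, min (Real.exp (ε * |x|)) B ∂(Q n : Measure ℝ) ≤ K)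
    (h : ∀ θ : SchwartzMap ℝ ℂ, Tendsto (fun n =>
      ∫ u, θ u * Complex.exp (Complex.I * c n * u) ∂σ -
        ∫ x, ∫ u, θ u * Complex.exp (Complex.I * (-x : ℝ) * u) ∂σ ∂(Q n : Measure ℝ))
      atTop (𝓝 0)) :
    σ.MutuallySingular volume := by
  obtain ⟨φ, P, hφ, hP, hPint⟩ := exists_tendsto_of_exp_moment hε hK
  set χ : ℝ → ℂ := fun u => charFun (P : Measure ℝ) (-u) with hχ
  have hχm : Measurable χ := by
    have : Measurable (charFun (P : Measure ℝ)) := by fun_prop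
    exact this.comp measurable_neg
  have hχ1 : ∀ u, ‖χ u‖ ≤ 1 := fun u => norm_charFun_le_one _
  have hχ0 : ∀ᵐ u : ℝ, χ u ≠ 0 :=
    (Measure.measurePreserving_neg (volume : Measure ℝ)).quasiMeasurePreserving.ae
      (ae_charFun_ne_zero hε hPint)
  refine mutuallySingular_of_tendsto_integral_mul_cexp (hc.comp hφ.tendsto_atTop) hχm hχ1 hχ0
    fun f hf => tendsto_integral_mul_cexp_of_schwartz hχm hχ1 (fun θ => ?_) hf
  have hθi : Integrable θ σ := by
    obtain ⟨C, hC⟩ := θ.decay 0 0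
    refine Integrable.of_bound θ.continuous.aestronglyMeasurable C (ae_of_all _ fun u => ?_)
    simpa using hC.2 u
  -- Bounded and continuous in `x`, hence admissible for weak convergence of the laws; Fubini turns
  -- its integral against `P` into `∫ θ χ dσ`.
  let k : BoundedContinuousFunction ℝ ℂ := BoundedContinuousFunction.ofNormedAddCommGroup
    (fun x => ∫ u, θ u * Complex.exp (Complex.I * (-x : ℝ) * u) ∂σ)
    (continuous_of_dominated (bound := fun u => ‖θ u‖)
      (fun x => (integrable_mul_cexp hθi _).aestronglyMeasurable)
      (fun x => ae_of_all _ fun u => by rw [norm_mul, norm_cexp_I_mul, mul_one])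
      hθi.norm (ae_of_all _ fun u => by fun_prop)) (∫ u, ‖θ u‖ ∂σ)
    (fun x => norm_integral_le_of_norm_le hθi.norm
      (ae_of_all _ fun u => by rw [norm_mul, norm_cexp_I_mul, mul_one]))
  have h1 := (ProbabilityMeasure.tendsto_iff_forall_integral_rclike_tendsto ℂ).1 hP k
  have h2 : ∫ x, k x ∂(P : Measure ℝ) = ∫ u, θ u * χ u ∂σ := by
    have h3 : ∫ x, k x ∂(P : Measure ℝ) =
        ∫ x, ∫ u, θ u * Complex.exp (Complex.I * (-x : ℝ) * u) ∂σ ∂(P : Measure ℝ) := rfl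
    rw [h3, integral_integral_swap]
    · refine integral_congr_ae (ae_of_all _ fun u => ?_)
      simp only [hχ, charFun_apply_real]
      rw [integral_const_mul]
      congr 1
      refine integral_congr_ae (ae_of_all _ fun x => ?_)
      simp only
      congr 1
      push_cast
      ring
    · have h4 : Integrable (fun z : ℝ × ℝ => θ z.2) ((P : Measure ℝ).prod σ) := hθi.comp_snd _
      exact h4.mul_bdd (c := 1) (by fun_prop) (ae_of_all _ fun z => (norm_cexp_I_mul _ _).le)
  rw [h2] at h1
  have h3 := ((h θ).comp hφ.tendsto_atTop).add h1
  rw [zero_add] at h3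
  refine h3.congr fun n => ?_
  exact sub_add_cancel _ _

end Singular

/-! ### Correlations of square integrable functions -/

open scoped FourierTransform in
/-- Every Schwartz function is the Fourier transform of an integrable kernel. -/
theorem exists_kernel_of_schwartz (θ : SchwartzMap ℝ ℂ) : ∃ k : ℝ → ℂ, Measurable k ∧
    Integrable k ∧ ∀ u : ℝ, ∫ t : ℝ, k t * Complex.exp (Complex.I * t * u) = θ u := by
  have hpi : (2 * Real.pi) ≠ 0 := by positivity
  refine ⟨fun t => ((2 * Real.pi : ℝ) : ℂ)⁻¹ * 𝓕 θ (t / (2 * Real.pi)), ?_, ?_, fun u => ?_⟩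
  · exact (((𝓕 θ).continuous.measurable).comp (measurable_id.div_const _)).const_mul _
  · exact ((𝓕 θ).integrable.comp_div hpi).const_mul _
  · have h1 : θ u = (𝓕⁻ (𝓕 θ)) u := by rw [FourierTransform.fourierInv_fourier_eq]
    rw [h1, SchwartzMap.fourierInv_coe, Real.fourierInv_eq']
    have h2 := Measure.integral_comp_div (fun w : ℝ =>
      Complex.exp (((2 * Real.pi * inner ℝ w u : ℝ) : ℂ) * Complex.I) • 𝓕 θ w) (2 * Real.pi)
    rw [abs_of_pos (by positivity), Complex.real_smul,
      ← inv_mul_eq_iff_eq_mul₀ (by exact_mod_cast hpi)] at h2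
    rw [← h2, ← integral_const_mul]
    refine integral_congr_ae (ae_of_all _ fun t => ?_)
    simp only [smul_eq_mul, mul_assoc]
    congr 1
    rw [mul_comm]
    congr 2
    simp only [RCLike.inner_apply, conj_trivial]
    rw [show 2 * (Real.pi * (u * (t / (2 * Real.pi)))) = t * u by field_simp]
    push_cast
    ring

section L2

variable {X : Type*} [MeasurableSpace X] {μ : Measure X}

theorem norm_integral_mul_conj_le {u v : X → ℂ} (hu : MemLp u 2 μ) (hv : MemLp v 2 μ) :
    ‖∫ z, u z * (starRingEnd ℂ) (v z) ∂μ‖ ≤ (eLpNorm u 2 μ).toReal * (eLpNorm v 2 μ).toReal := by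
  have h1 := norm_inner_le_norm (𝕜 := ℂ) (hv.toLp v) (hu.toLp u)
  rw [L2.inner_def, Lp.norm_toLp, Lp.norm_toLp, mul_comm] at h1
  refine le_trans (le_of_eq ?_) h1
  congr 1
  refine integral_congr_ae ?_
  filter_upwards [hu.coeFn_toLp, hv.coeFn_toLp] with z h2 h3
  rw [h2, h3, RCLike.inner_apply]

/-- The correlation `⟨u ∘ φ, u⟩` is close to `⟨v ∘ φ, v⟩` when `u` is close to `v` in `L²`. -/
theorem norm_integral_comp_mul_conj_sub_le {φ : X → X} (hφ : MeasurePreserving φ μ μ)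
    {u v : X → ℂ} (hu : MemLp u 2 μ) (hv : MemLp v 2 μ) :
    ‖∫ z, u (φ z) * (starRingEnd ℂ) (u z) ∂μ - ∫ z, v (φ z) * (starRingEnd ℂ) (v z) ∂μ‖ ≤
      (eLpNorm (u - v) 2 μ).toReal * ((eLpNorm u 2 μ).toReal + (eLpNorm v 2 μ).toReal) := by
  have hmul : ∀ {a b : X → ℂ}, MemLp a 2 μ → MemLp b 2 μ →
      Integrable (fun z => a z * (starRingEnd ℂ) (b z)) μ := fun ha hb =>
    ha.integrable_mul hb.star
  have hcomp : ∀ {a : X → ℂ}, MemLp a 2 μ → MemLp (fun z => a (φ z)) 2 μ := fun ha =>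
    ha.comp_measurePreserving hφ
  have hnorm : ∀ {a : X → ℂ}, MemLp a 2 μ → eLpNorm (fun z => a (φ z)) 2 μ = eLpNorm a 2 μ :=
    fun ha => eLpNorm_comp_measurePreserving ha.1 hφ
  have e : ∫ z, u (φ z) * (starRingEnd ℂ) (u z) ∂μ - ∫ z, v (φ z) * (starRingEnd ℂ) (v z) ∂μ =
      ∫ z, (u - v) (φ z) * (starRingEnd ℂ) (u z) ∂μ +
        ∫ z, v (φ z) * (starRingEnd ℂ) ((u - v) z) ∂μ := by
    rw [← integral_sub (hmul (hcomp hu) hu) (hmul (hcomp hv) hv),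
      ← integral_add (hmul (hcomp (hu.sub hv)) hu) (hmul (hcomp hv) (hu.sub hv))]
    refine integral_congr_ae (ae_of_all _ fun z => ?_)
    simp only [Pi.sub_apply, map_sub]
    ring
  rw [e]
  refine (norm_add_le _ _).trans ?_
  have h1 := norm_integral_mul_conj_le (hcomp (hu.sub hv)) hu
  have h2 := norm_integral_mul_conj_le (hcomp hv) (hu.sub hv)
  rw [hnorm (hu.sub hv)] at h1
  rw [hnorm hv] at h2
  linarith

end L2

/-! ### From flow correlations to correlations on a strip -/

namespace IET

variable {d : ℕ} (T : IET d)

variable {T} {f : ℝ → ℝ} {m : ℝ}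

/-- Compact support provides both the uniform bound `B` and the height `M` above which the
approximant vanishes. -/
theorem exists_continuous_eLpNorm_sub_le (hfm : Measurable fun x : T.Base => f x)
    {G : T.Base × ℝ → ℂ} (hG : MemLp G 2 (T.flowMeasure f)) {δ : ℝ} (hδ : 0 < δ) :
    ∃ (G' : T.Base × ℝ → ℂ) (B M : ℝ), Continuous G' ∧ (∀ z, ‖G' z‖ ≤ B) ∧
      (∀ z, M < z.2 → G' z = 0) ∧ MemLp G' 2 (T.flowMeasure f) ∧
      (eLpNorm (G - G') 2 (T.flowMeasure f)).toReal ≤ δ := by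
  have hX := T.measurableSet_region hfm
  have hG' : MemLp ((T.region f).indicator G) 2 (T.leb.prod volume) :=
    (memLp_indicator_iff_restrict hX).2 hG
  obtain ⟨g, hg1, hg2, hg3, hg4⟩ := hG'.exists_hasCompactSupport_eLpNorm_sub_le
    ENNReal.ofNat_ne_top (ε := ENNReal.ofReal δ) (by simpa using hδ)
  obtain ⟨B, hB⟩ := hg1.exists_bound_of_continuous hg3
  obtain ⟨M, hM⟩ := (hg1.isCompact.image continuous_snd).bddAbove
  refine ⟨g, B, M, hg3, hB, fun z hz => ?_, hg4.restrict _, ?_⟩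
  · by_contra hne
    exact absurd (hM (mem_image_of_mem _ (subset_tsupport g hne))) (not_le.2 hz)
  · refine ENNReal.toReal_le_of_le_ofReal hδ.le (le_trans ?_ hg2)
    have e : eLpNorm (G - g) 2 (T.flowMeasure f) =
        eLpNorm ((T.region f).indicator G - g) 2 (T.flowMeasure f) := by
      refine eLpNorm_congr_ae ?_
      filter_upwards [ae_restrict_mem hX] with z hz
      rw [Pi.sub_apply, Pi.sub_apply, indicator_of_mem hz]
    rw [e]
    exact eLpNorm_mono_measure _ Measure.restrict_le_self

variable {G : T.Base × ℝ → ℂ} {B M : ℝ} {k : ℝ → ℂ}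

/-- The roof is in general unbounded; the cutoff at `M` places the integral on a strip of finite
measure, where the rigidity lemmas apply. -/
theorem integral_strip_eq_integral_flowMeasure (hfm : Measurable fun x : T.Base => f x)
    (hGM : ∀ z, M < z.2 → G z = 0) (t : ℝ) :
    ∫ z, G (T.fold f (z.1, z.2 + t)) *
        (T.region f).indicator (fun z => (starRingEnd ℂ) (G z)) z ∂T.strip M =
      ∫ z, G (T.specialFlow f t z) * (starRingEnd ℂ) (G z) ∂T.flowMeasure f := by
  have e : T.strip M = (T.leb.prod volume).restrict (univ ×ˢ Icc 0 M) := by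
    rw [← Measure.prod_restrict, Measure.restrict_univ]
  rw [e, flowMeasure, ← integral_indicator (T.measurableSet_region hfm),
    ← integral_indicator (MeasurableSet.univ.prod measurableSet_Icc)]
  refine integral_congr_ae (ae_of_all _ fun z => ?_)
  simp only [indicator, T.specialFlow_eq_fold]
  by_cases hz : z ∈ T.region f
  · by_cases hM : z.2 ≤ M
    · have h1 : z ∈ (univ : Set T.Base) ×ˢ Icc 0 M := ⟨mem_univ _, hz.1, hM⟩
      simp only [if_pos hz, if_pos h1]
    · rw [hGM z (not_le.1 hM)]
      simp
  · simp only [if_neg hz, mul_zero, ite_self]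

/-- By Fubini, smoothing the lifted function averages the flow correlations with weight `k`, which
on the spectral side is multiplication by `θ`. -/
theorem corr_eq_integral (hfm : Measurable fun x : T.Base => f x) (hm : 0 < m)
    (hmf : ∀ x : T.Base, m ≤ f x) (hG : Measurable G) (hGB : ∀ z, ‖G z‖ ≤ B)
    (hGM : ∀ z, M < z.2 → G z = 0) (hk : Integrable k) (s : ℝ) :
    T.corr k (fun z => G (T.fold f z)) ((T.region f).indicator fun z => (starRingEnd ℂ) (G z)) M s =
      ∫ t, k t * ∫ z, G (T.specialFlow f (s + t) z) * (starRingEnd ℂ) (G z) ∂T.flowMeasure f := by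
  have hfold := T.measurable_fold hfm hm hmf
  have hgm : Measurable ((T.region f).indicator fun z => (starRingEnd ℂ) (G z)) :=
    (Complex.continuous_conj.measurable.comp hG).indicator (T.measurableSet_region hfm)
  have hgB : ∀ z, ‖(T.region f).indicator (fun z => (starRingEnd ℂ) (G z)) z‖ ≤ B := fun z =>
    (norm_indicator_le_norm_self _ _).trans (by rw [RCLike.norm_conj]; exact hGB z)
  have hint : Integrable (Function.uncurry fun (z : T.Base × ℝ) (t : ℝ) =>
      k t * G (T.fold f (z.1, z.2 + s + t)) *
        (T.region f).indicator (fun z => (starRingEnd ℂ) (G z)) z)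
      ((T.strip M).prod volume) := by
    have h1 : Integrable (fun p : (T.Base × ℝ) × ℝ => k p.2) ((T.strip M).prod volume) :=
      hk.comp_snd _
    refine (h1.mul_bdd (c := B) (Measurable.aestronglyMeasurable ?_)
      (ae_of_all _ fun p => hGB _)).mul_bdd (c := B) (Measurable.aestronglyMeasurable ?_)
      (ae_of_all _ fun p => hgB _)
    · exact hG.comp (hfold.comp ((measurable_fst.comp measurable_fst).prodMk
        (((measurable_snd.comp measurable_fst).add_const s).add measurable_snd)))
    · exact hgm.comp measurable_fst
  simp only [corr, smooth, ← integral_mul_const]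
  rw [integral_integral_swap hint]
  refine integral_congr_ae (ae_of_all _ fun t => ?_)
  simp only
  rw [← integral_strip_eq_integral_flowMeasure hfm hGM, ← integral_const_mul]
  refine integral_congr_ae (ae_of_all _ fun z => ?_)
  simp only
  rw [mul_assoc, add_assoc]

theorem measurable_corr {H g : T.Base × ℝ → ℂ} (hkm : Measurable k) (hH : Measurable H)
    (hg : Measurable g) : Measurable (T.corr k H g M) := by
  have hF := measurable_smooth hkm hH
  have h1 : Measurable fun p : ℝ × (T.Base × ℝ) => T.smooth k H (p.2.1, p.2.2 + p.1) * g p.2 :=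
    (hF.comp ((measurable_fst.comp measurable_snd).prodMk
      ((measurable_snd.comp measurable_snd).add measurable_fst))).mul (hg.comp measurable_snd)
  exact (StronglyMeasurable.integral_prod_right (ν := T.strip M)
    (f := fun (s : ℝ) (z : T.Base × ℝ) => T.smooth k H (z.1, z.2 + s) * g z)
    h1.stronglyMeasurable).measurable

theorem norm_corr_le {H g : T.Base × ℝ → ℂ} {B' : ℝ} (hk : Integrable k) (hHB : ∀ z, ‖H z‖ ≤ B)
    (hgB : ∀ z, ‖g z‖ ≤ B') (s : ℝ) :
    ‖T.corr k H g M s‖ ≤ |B * ∫ t, ‖k t‖| * |B'| * (T.strip M).real univ := by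
  refine norm_integral_le_of_norm_le_const (ae_of_all _ fun z => ?_)
  rw [norm_mul]
  exact mul_le_mul ((norm_smooth_le hk hHB _).trans (le_abs_self _))
    ((hgB _).trans (le_abs_self _)) (norm_nonneg _) (abs_nonneg _)

end IET

/-! ### The laws of the deviations and the singularity of the spectrum -/

namespace IET

variable {d : ℕ} {T : IET d} {f : ℝ → ℝ} {m : ℝ} {a b : ℕ → ℝ} {h : ℕ → ℕ} {c : ℕ → ℝ}

/-- The law of the deviation at the `n`-th rigidity time, for the normalized Lebesgue measure. -/
noncomputable def deviationLaw (T : IET d) (f : ℝ → ℝ) (h : ℕ → ℕ) (c : ℕ → ℝ) (n : ℕ) :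
    Measure ℝ := ((T.leb univ)⁻¹ • T.leb).map (T.deviation f h c n)

theorem leb_univ_ne_zero (hL : 0 < T.length) : T.leb univ ≠ 0 := by
  rw [leb_univ]; simpa using hL

theorem isProbabilityMeasure_deviationLaw (hL : 0 < T.length)
    (hfm : Measurable fun x : T.Base => f x) (n : ℕ) :
    IsProbabilityMeasure (T.deviationLaw f h c n) := by
  have : IsProbabilityMeasure ((T.leb univ)⁻¹ • T.leb) := ⟨by
    rw [Measure.smul_apply, smul_eq_mul,
      ENNReal.inv_mul_cancel (leb_univ_ne_zero hL) (measure_ne_top _ _)]⟩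
  exact Measure.isProbabilityMeasure_map (measurable_deviation hfm n).aemeasurable

theorem integral_deviationLaw {E : Type*} [NormedAddCommGroup E] [NormedSpace ℝ E]
    (hfm : Measurable fun x : T.Base => f x) (n : ℕ) {F : ℝ → E} (hF : StronglyMeasurable F) :
    ∫ x, F x ∂T.deviationLaw f h c n =
      (T.leb.real univ)⁻¹ • ∫ x, F (T.deviation f h c n x) ∂T.leb := by
  rw [deviationLaw, integral_map (measurable_deviation hfm n).aemeasurable
    hF.aestronglyMeasurable, integral_smul_measure, ENNReal.toReal_inv, measureReal_def]

/-- The moment is controlled only on `good n`. Truncation at `B` makes the complement contribute at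
most `|B|` times its measure, eventually at most `1`, so the bound does not depend on `B`. -/
theorem eventually_integral_min_exp_le
    (hfm : Measurable fun x : T.Base => f x) {good : ℕ → Set T.Base} {ε K : ℝ}
    (hgood : ∀ n, MeasurableSet (good n))
    (hlim : Tendsto (fun n => T.leb (good n)ᶜ) atTop (𝓝 0))
    (hK : ∀ᶠ n in atTop, ∫⁻ x in good n, ENNReal.ofReal
        (Real.exp (ε * |T.deviation f h c n x|)) ∂T.leb ≤ ENNReal.ofReal K) (B : ℝ) :
    ∀ᶠ n in atTop, ∫ x, min (Real.exp (ε * |x|)) B ∂T.deviationLaw f h c n ≤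
      (T.leb.real univ)⁻¹ * (|K| + 1) := by
  have h1 := ((ENNReal.tendsto_toReal ENNReal.zero_ne_top).comp hlim).const_mul |B|
  rw [ENNReal.toReal_zero, mul_zero] at h1
  filter_upwards [hK, h1.eventually_le_const one_pos] with n hn hn2
  have hn2' : |B| * T.leb.real (good n)ᶜ ≤ 1 := hn2
  have hdev := measurable_deviation (T := T) (h := h) (c := c) hfm n
  rw [integral_deviationLaw hfm n (F := fun x => min (Real.exp (ε * |x|)) B)
    (Measurable.stronglyMeasurable (by fun_prop)), smul_eq_mul]
  refine mul_le_mul_of_nonneg_left ?_ (inv_nonneg.2 measureReal_nonneg)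
  have hem : Measurable fun x => Real.exp (ε * |T.deviation f h c n x|) := by fun_prop
  have hei : IntegrableOn (fun x => Real.exp (ε * |T.deviation f h c n x|)) (good n) T.leb := by
    refine ⟨hem.aestronglyMeasurable, ?_⟩
    rw [hasFiniteIntegral_iff_ofReal (ae_of_all _ fun x => (Real.exp_pos _).le)]
    exact hn.trans_lt ENNReal.ofReal_lt_top
  have hmi : Integrable (fun x => min (Real.exp (ε * |T.deviation f h c n x|)) |B|) T.leb :=
    Integrable.of_bound (by fun_prop) |B| (ae_of_all _ fun x => by
      rw [Real.norm_of_nonneg (le_min (Real.exp_pos _).le (abs_nonneg B))]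
      exact min_le_right _ _)
  have hmi' : Integrable (fun x => min (Real.exp (ε * |T.deviation f h c n x|)) B) T.leb :=
    Integrable.of_bound (by fun_prop) |B| (ae_of_all _ fun x => by
      have h5 := Real.exp_pos (ε * |T.deviation f h c n x|)
      exact abs_le.2 ⟨le_min (by linarith [abs_nonneg B]) (neg_abs_le B),
        (min_le_right _ _).trans (le_abs_self B)⟩)
  have h2 : ∫ x, min (Real.exp (ε * |T.deviation f h c n x|)) B ∂T.leb ≤
      ∫ x, min (Real.exp (ε * |T.deviation f h c n x|)) |B| ∂T.leb :=
    integral_mono hmi' hmi fun x => min_le_min_left _ (le_abs_self B)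
  have h3 : ∫ x in good n, min (Real.exp (ε * |T.deviation f h c n x|)) |B| ∂T.leb ≤ |K| := by
    refine (setIntegral_mono hmi.integrableOn hei fun x => min_le_left _ _).trans ?_
    rw [integral_eq_lintegral_of_nonneg_ae (ae_of_all _ fun x => (Real.exp_pos _).le)
      hem.aestronglyMeasurable]
    refine ENNReal.toReal_le_of_le_ofReal (abs_nonneg K) (hn.trans ?_)
    exact ENNReal.ofReal_le_ofReal (le_abs_self K)
  have h4 : ∫ x in (good n)ᶜ, min (Real.exp (ε * |T.deviation f h c n x|)) |B| ∂T.leb ≤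
      |B| * T.leb.real (good n)ᶜ := by
    refine (setIntegral_mono hmi.integrableOn (integrable_const |B|)
      fun x => min_le_right _ _).trans_eq ?_
    rw [setIntegral_const, smul_eq_mul, mul_comm]
  rw [← integral_add_compl (hgood n) hmi] at h2
  linarith

/-- The special flow has purely singular spectrum when the base has a good rigidity sequence.
No zero of the Birkhoff sums of the derivative has to be assumed: the reflection of `I` conjugates
`T` to its inverse, which makes the singular terms of the Birkhoff sums cancel. -/
theorem hasPurelySingularSpectrum (hT : T.IsSymmetric) (hf : T.IsSymLog f)
    (hfm : Measurable fun x : T.Base => f x) (hm : 0 < m) (hmf : ∀ x : T.Base, m ≤ f x)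
    (hrig : T.IsGoodRigiditySeq a b h) :
    HasPurelySingularSpectrum (T.specialFlow f) (T.flowMeasure f) := by
  intro G hG σ hσ
  have hσf := hσ.finite
  have hL := T.length_pos_of_isTower (hrig.isTower 0)
  obtain ⟨c, good, ε, K, hc, hgood, hlim, hε, hK⟩ := T.exists_concentration hT hf hm hmf hrig
  have htight : Rigidity.IsTightSeq T.leb (T.deviation f h c) :=
    isTightSeq_deviation hfm hlim hε hK
  have hprob := isProbabilityMeasure_deviationLaw (h := h) (c := c) hL hfm
  refine mutuallySingular_of_tendsto_correlation
    (Q := fun n => ⟨T.deviationLaw f h c n, hprob n⟩) hc hε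
    (eventually_integral_min_exp_le hfm hgood hlim hK) fun θ => ?_
  obtain ⟨k, hkm, hk, hkθ⟩ := exists_kernel_of_schwartz θ
  set A : ℝ → ℂ := fun s => ∫ u, θ u * Complex.exp (Complex.I * s * u) ∂σ with hA
  -- As `θ` is the transform of `k`, Fubini expresses the spectral integral through flow
  -- correlations.
  have hA1 : ∀ s, A s = ∫ t, k t *
      ∫ z, G (T.specialFlow f (s + t) z) * (starRingEnd ℂ) (G z) ∂T.flowMeasure f := by
    intro s
    simp only [hσ.correlation, ← integral_const_mul, hA, ← hkθ, ← integral_mul_const]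
    rw [integral_integral_swap]
    · refine integral_congr_ae (ae_of_all _ fun t => integral_congr_ae (ae_of_all _ fun u => ?_))
      simp only
      rw [mul_assoc, ← Complex.exp_add]
      congr 2
      push_cast
      ring
    · have h1 : Integrable (fun p : ℝ × ℝ => k p.2) (σ.prod volume) := hk.comp_snd _
      exact (h1.mul_bdd (c := 1) (by fun_prop) (ae_of_all _ fun p =>
        (norm_cexp_I_mul _ _).le)).mul_bdd (c := 1) (by fun_prop) (ae_of_all _ fun p =>
        (norm_cexp_I_mul _ _).le)
  have hAm : Measurable A := by
    have h1 : Measurable fun p : ℝ × ℝ => θ p.2 * Complex.exp (Complex.I * p.1 * p.2) := by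
      have := θ.continuous
      fun_prop
    exact (StronglyMeasurable.integral_prod_right (ν := σ)
      (f := fun s u : ℝ => θ u * Complex.exp (Complex.I * s * u)) h1.stronglyMeasurable).measurable
  have hAB : ∀ s, ‖A s‖ ≤ ∫ u, ‖θ u‖ ∂σ := fun s =>
    (norm_integral_le_integral_norm _).trans_eq (integral_congr_ae (ae_of_all _ fun u => by
      simp only [norm_mul, norm_cexp_I_mul, mul_one]))
  set N := (eLpNorm G 2 (T.flowMeasure f)).toReal with hN
  have hN0 : 0 ≤ N := ENNReal.toReal_nonneg
  set L := ∫ t, ‖k t‖ with hLk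
  have hL0 : 0 ≤ L := integral_nonneg fun _ => norm_nonneg _
  rw [Metric.tendsto_atTop]
  intro η hη
  obtain ⟨δ, hδ, hδ1, hδη⟩ : ∃ δ > 0, δ ≤ 1 ∧ δ * ((2 * N + 1) * L) ≤ η / 4 := by
    refine ⟨min 1 (η / (4 * ((2 * N + 1) * L + 1))), by positivity, min_le_left _ _, ?_⟩
    refine (mul_le_mul_of_nonneg_right (min_le_right _ _) (by positivity)).trans ?_
    rw [div_mul_eq_mul_div, div_le_div_iff₀ (by positivity) (by positivity)]
    nlinarith
  obtain ⟨G', B, M, hG'c, hG'B, hG'M, hG'2, hGG'⟩ := exists_continuous_eLpNorm_sub_le hfm hG hδ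
  set H : T.Base × ℝ → ℂ := fun z => G' (T.fold f z) with hH
  set g : T.Base × ℝ → ℂ := (T.region f).indicator fun z => (starRingEnd ℂ) (G' z) with hg
  have hHm : Measurable H := hG'c.measurable.comp (T.measurable_fold hfm hm hmf)
  have hHB : ∀ z, ‖H z‖ ≤ B := fun z => hG'B _
  have hgm : Measurable g := (Complex.continuous_conj.measurable.comp hG'c.measurable).indicator
    (T.measurableSet_region hfm)
  have hgB : ∀ z, ‖g z‖ ≤ B := fun z =>
    (norm_indicator_le_norm_self _ _).trans (by rw [RCLike.norm_conj]; exact hG'B z)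
  -- The bound is uniform in `s`, so it serves both at `s = c n` and under the integral over the law
  -- of the deviation.
  have hclose : ∀ s, ‖A s - T.corr k H g M s‖ ≤ η / 4 := by
    intro s
    have hφ := fun t => T.measurePreserving_specialFlow hfm hm hmf t
    rw [hA1, hH, hg, corr_eq_integral hfm hm hmf hG'c.measurable hG'B hG'M hk]
    have hρ : ∀ t, ‖∫ z, G (T.specialFlow f t z) * (starRingEnd ℂ) (G z) ∂T.flowMeasure f -
        ∫ z, G' (T.specialFlow f t z) * (starRingEnd ℂ) (G' z) ∂T.flowMeasure f‖ ≤
        δ * (2 * N + 1) := by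
      intro t
      refine (norm_integral_comp_mul_conj_sub_le (hφ t) hG hG'2).trans ?_
      have h1 : (eLpNorm G' 2 (T.flowMeasure f)).toReal ≤ N + δ := by
        have h2 : eLpNorm G' 2 (T.flowMeasure f) ≤
            eLpNorm G 2 (T.flowMeasure f) + eLpNorm (G - G') 2 (T.flowMeasure f) := by
          have h3 := eLpNorm_sub_le hG.1 (hG.sub hG'2).1 (p := 2) (by norm_num)
          rwa [sub_sub_cancel] at h3
        have h3 := ENNReal.toReal_mono (ENNReal.add_ne_top.2 ⟨hG.2.ne, (hG.sub hG'2).2.ne⟩) h2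
        rw [ENNReal.toReal_add hG.2.ne (hG.sub hG'2).2.ne] at h3
        linarith
      exact mul_le_mul hGG' (by linarith) (by positivity) hδ.le
    set ρ : ℝ → ℂ := fun t =>
      ∫ z, G (T.specialFlow f t z) * (starRingEnd ℂ) (G z) ∂T.flowMeasure f with hρ0
    set ρ' : ℝ → ℂ := fun t =>
      ∫ z, G' (T.specialFlow f t z) * (starRingEnd ℂ) (G' z) ∂T.flowMeasure f with hρ0'
    have hρm : Measurable ρ := by
      have e : ρ = fun t : ℝ => ∫ u : ℝ, Complex.exp (Complex.I * t * u) ∂σ :=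
        funext hσ.correlation
      have h1 : Measurable fun p : ℝ × ℝ => Complex.exp (Complex.I * p.1 * p.2) := by fun_prop
      rw [e]
      exact (StronglyMeasurable.integral_prod_right (ν := σ)
        (f := fun t u : ℝ => Complex.exp (Complex.I * t * u)) h1.stronglyMeasurable).measurable
    have hρm' : Measurable ρ' := by
      have e : ρ' = fun t : ℝ => ∫ z, H (z.1, z.2 + t) * g z ∂T.strip M :=
        funext fun t => (integral_strip_eq_integral_flowMeasure hfm hG'M t).symm
      have h1 : Measurable fun p : ℝ × (T.Base × ℝ) => H (p.2.1, p.2.2 + p.1) * g p.2 :=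
        (hHm.comp ((measurable_fst.comp measurable_snd).prodMk
          ((measurable_snd.comp measurable_snd).add measurable_fst))).mul (hgm.comp measurable_snd)
      rw [e]
      exact (StronglyMeasurable.integral_prod_right (ν := T.strip M)
        (f := fun (t : ℝ) (z : T.Base × ℝ) => H (z.1, z.2 + t) * g z)
        h1.stronglyMeasurable).measurable
    have hρB : ∀ t, ‖ρ t‖ ≤ N * N := fun t => by
      have h1 := norm_integral_mul_conj_le (hG.comp_measurePreserving (hφ t)) hG
      rwa [eLpNorm_comp_measurePreserving hG.1 (hφ t)] at h1
    have hρB' : ∀ t, ‖ρ' t‖ ≤ N * N + δ * (2 * N + 1) := fun t => by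
      have h1 := norm_sub_norm_le (ρ' t) (ρ t)
      rw [norm_sub_rev] at h1
      linarith [hρ t, hρB t]
    have hi : Integrable fun t => k t * ρ (s + t) :=
      hk.mul_bdd (hρm.comp (measurable_const_add s)).aestronglyMeasurable
        (ae_of_all _ fun t => hρB _)
    have hi' : Integrable fun t => k t * ρ' (s + t) :=
      hk.mul_bdd (hρm'.comp (measurable_const_add s)).aestronglyMeasurable
        (ae_of_all _ fun t => hρB' _)
    rw [← integral_sub hi hi']
    refine (norm_integral_le_of_norm_le (hk.norm.mul_const (δ * (2 * N + 1)))
      (ae_of_all _ fun t => ?_)).trans ?_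
    · rw [← mul_sub, norm_mul]
      exact mul_le_mul_of_nonneg_left (hρ _) (norm_nonneg _)
    · rw [integral_mul_const]
      linarith
  have hint : ∀ {v : ℝ → ℂ} {C : ℝ}, Measurable v → (∀ s, ‖v s‖ ≤ C) → ∀ n,
      Integrable (fun x => v (-x)) (T.deviationLaw f h c n) := fun hv hC n =>
    Integrable.of_bound (hv.comp measurable_neg).aestronglyMeasurable _ (ae_of_all _ fun x => hC _)
  have hcm := measurable_corr (M := M) hkm hHm hgm
  have hcB := norm_corr_le (M := M) hk hHB hgB
  have hcorr := tendsto_corr_sub_average (M := M) hT hrig hfm htight hkm hk hHm hHB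
    (fun n z => by rw [hH]; simp only [T.fold_skew_zpow hm hmf]) hgm hgB
  obtain ⟨N₀, hN₀⟩ := Metric.tendsto_atTop.1 hcorr (η / 4) (by positivity)
  refine ⟨N₀, fun n hn => ?_⟩
  have h1 := hN₀ n hn
  have h2 : ∫ x, (T.leb.real univ : ℂ)⁻¹ * T.corr k H g M (-T.deviation f h c n x) ∂T.leb =
      ∫ x, T.corr k H g M (-x) ∂T.deviationLaw f h c n := by
    rw [integral_deviationLaw hfm n (F := fun x => T.corr k H g M (-x))
      (hcm.comp measurable_neg).stronglyMeasurable, integral_const_mul, Complex.real_smul]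
    push_cast
    rfl
  have h3 : ‖∫ x, A (-x) ∂T.deviationLaw f h c n -
      ∫ x, T.corr k H g M (-x) ∂T.deviationLaw f h c n‖ ≤ η / 4 := by
    rw [← integral_sub (hint hAm hAB n) (hint hcm hcB n)]
    have hp := hprob n
    refine (norm_integral_le_of_norm_le_const (ae_of_all _ fun x => hclose (-x))).trans_eq ?_
    rw [probReal_univ, mul_one]
  rw [h2, dist_zero_right] at h1
  rw [dist_zero_right]
  have h4 := hclose (c n)
  -- Approximation at time `c n`, asymptotic independence for the approximant, and approximation
  -- under the averaged law: three errors of size `η / 4`.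
  have e : A (c n) - ∫ x, A (-x) ∂T.deviationLaw f h c n =
      (A (c n) - T.corr k H g M (c n)) +
      (T.corr k H g M (c n) - ∫ x, T.corr k H g M (-x) ∂T.deviationLaw f h c n) -
      (∫ x, A (-x) ∂T.deviationLaw f h c n -
        ∫ x, T.corr k H g M (-x) ∂T.deviationLaw f h c n) := by ring
  change ‖A (c n) - ∫ x, A (-x) ∂T.deviationLaw f h c n‖ < η
  rw [e]
  refine (norm_sub_le _ _).trans_lt ?_
  have h5 := norm_add_le (A (c n) - T.corr k H g M (c n))
    (T.corr k H g M (c n) - ∫ x, T.corr k H g M (-x) ∂T.deviationLaw f h c n)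
  linarith

end IET

theorem mainTheorem6 {d : ℕ} (T : IET d) (hT : T.IsSymmetric)
    (f : ℝ → ℝ) (hf : T.IsSymLog f)
    (hpos : ∃ m : ℝ, 0 < m ∧ ∀ x ∈ Set.Ico (0 : ℝ) T.length, m ≤ f x)
    (a b : ℕ → ℝ) (h : ℕ → ℕ) (hrig : T.IsGoodRigiditySeq a b h)
    (φ : ℝ → ℝ) (hφ : φ = f ∨ T.IsLogPart φ f)
    (c : ℝ) (hc : 0 < c) (hc' : c < 1 / 2)
    (hzero : ∀ n, ∃ x : T.Base,
      a n + c * (b n - a n) ≤ x ∧ (x : ℝ) ≤ b n - c * (b n - a n) ∧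
      (∀ i < h n, DifferentiableAt ℝ φ ((T.map ^ i) x)) ∧
      T.birkhoff (deriv φ) (h n) x = 0) :
    IsErgodicFlow (T.specialFlow f) (T.flowMeasure f) ∧
      HasPurelySingularSpectrum (T.specialFlow f) (T.flowMeasure f) := by
  obtain ⟨m, hm, hmf⟩ := hpos
  have hmf' : ∀ x : T.Base, m ≤ f x := fun x => hmf x x.2
  obtain ⟨p, hp⟩ := hf
  have hfm := T.measurable_of_isLogPart hp
  exact ⟨T.isErgodicFlow_of_base hfm hm hmf' fun B hB hinv =>
      T.null_or_conull_of_isGoodRigiditySeq hT hrig hB hinv,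
    IET.hasPurelySingularSpectrum hT ⟨p, hp⟩ hfm hm hmf' hrig⟩
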